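/- Fix an integer $r\ge 1$. Let $\mathcal U$ be a universe of $n$ elements and let $\mathcal U^r$ be the set of its subsets of size at most $r$. A function $\alpha:\mathcal U^r\times\mathcal U^r\to\{0,1\}$ (value $1$ means that the two sets conflict) is *well-conditioned* if (i) $\alpha(s,t)=0$ implies $\alpha(s',t')=0$ for all $s'\subseteq s$, $t'\subseteq t$; (ii) $\alpha(s,t)=1$ implies $|s\cap t|\ge 1$ and, for all $s'\subseteq s$, $t'\subseteq t$ with $\alpha(s',t')=0$, also $(s\cap t)\setminus(s'\cap t')\ne\emptyset$; (iii) $\alpha$ is computable in polynomial time, i.e. by a program within $a\,n^c$ steps for constants $a,c$. An instance of *PCH-$r$-Set Packing with $\alpha()$-Overlap* consists of $\mathcal U$, a collection $\mathcal S\subseteq\mathcal U^r$ of distinct sets, an integer $k\ge 0$, and a collection $\mathcal C$ of distinct non-empty subsets of $\mathcal U$ (the cluster heads). The task is to find a *$(k,\alpha())$-set packing (PCH)*, or to report that there is none: a set $\mathcal K$ of at least $k$ members of $\mathcal S$ such that each member of $\mathcal K$ contains at least one cluster head, and for any two distinct $S,S'\in\mathcal K$ one has $S\cap S'\cap\bigcup_{C\in\mathcal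 C}C=\emptyset$ and $\alpha(S,S')=0$. **Theorem.** For each fixed $r\ge1$ there is an algorithm (a unit-cost random access machine program with addition and truncated subtraction that calls a subroutine for $\alpha$) which solves every instance with $\alpha$ well-conditioned and $|\mathcal C|=g(k)\ge 1$ in $$O\bigl(g(k)^{k}\,(rk)^{(r-1)k}\,n^{r}\bigr)$$ steps, where each evaluation of $\alpha$ counts as one step. If instead all steps of a program that evaluates $\alpha$ within $a\,n^{c}$ steps are counted, the same algorithm takes $O\bigl(g(k)^{k}(rk)^{(r-1)k}n^{r}\cdot a\,n^{c}\bigr)$ steps. The algorithm and the constants in $O(\cdot)$ depend only on $r$ (they do not depend on $g$, $k$, $n$, $\alpha$, $a$, $c$, $\mathcal S$ or $\mathcal C$). Here $0^0=1$. -/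

import Mathlib

namespace PCH

/-! ### A unit-cost random access machine

Memory cells hold natural numbers; there are registers and arrays, each with a fixed name, and
arrays are addressed indirectly.  The arithmetic is addition and truncated subtraction.  Programs
are structured (sequence, branching, loop).  Every operation costs one step.  A program may call
one external subroutine on two lists stored in memory. -/

/-- Expressions: literals, registers, array cells, sums, truncated differences. -/
inductive Exp : Type
  | const (c : ℕ) : Exp
  | reg (x : ℕ) : Exp
  | get (a : ℕ) (e : Exp) : Exp
  | add (e f : Exp) : Exp
  | sub (e f : Exp) : Exp

/-- Programs. -/
inductive Prog : Type
  | skip : Prog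
  | assign (x : ℕ) (e : Exp) : Prog
  | store (a : ℕ) (e f : Exp) : Prog
  | seq (p q : Prog) : Prog
  | ite (e : Exp) (p q : Prog) : Prog
  | loop (e : Exp) (p : Prog) : Prog
  | query (x : ℕ) (a : ℕ) (e : Exp) (b : ℕ) (f : Exp) : Prog

/-- `arr a i` is cell `i` of array `a`. -/
structure State : Type where
  reg : ℕ → ℕ
  arr : ℕ → ℕ → ℕ

/-- The value of an expression. -/
def Exp.eval (σ : State) : Exp → ℕ
  | .const c => c
  | .reg x => σ.reg x
  | .get a e => σ.arr a (e.eval σ)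
  | .add e f => e.eval σ + f.eval σ
  | .sub e f => e.eval σ - f.eval σ

/-- The number of steps needed to evaluate an expression: one for each node. -/
def Exp.cost : Exp → ℕ
  | .const _ => 1
  | .reg _ => 1
  | .get _ e => e.cost + 1
  | .add e f => e.cost + f.cost + 1
  | .sub e f => e.cost + f.cost + 1

/-- Write `v` to register `x`. -/
def State.setReg (σ : State) (x v : ℕ) : State :=
  ⟨Function.update σ.reg x v, σ.arr⟩

/-- Write `v` to cell `i` of array `a`. -/
def State.setArr (σ : State) (a i v : ℕ) : State :=
  ⟨σ.reg, Function.update σ.arr a (Function.update (σ.arr a) i v)⟩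

/-- The list stored in array `a` from address `p` on: its length, then its entries. -/
def State.listAt (σ : State) (a p : ℕ) : List ℕ :=
  (List.range (σ.arr a p)).map fun i => σ.arr a (p + 1 + i)

/-- The behaviour of the external subroutine: `O v w y t` says that on the lists `v` and `w` it
returns `y` and that this is charged `t` steps. -/
abbrev Subroutine : Type := List ℕ → List ℕ → ℕ → ℕ → Prop

/-- `Exec O p σ σ' t`: started in `σ`, the program `p` halts in `σ'` after `t` steps. -/
inductive Exec (O : Subroutine) : Prog → State → State → ℕ → Prop
  | skip (σ : State) : Exec O .skip σ σ 1
  | assign (σ : State) (x : ℕ) (e : Exp) :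
      Exec O (.assign x e) σ (σ.setReg x (e.eval σ)) (e.cost + 1)
  | store (σ : State) (a : ℕ) (e f : Exp) :
      Exec O (.store a e f) σ (σ.setArr a (e.eval σ) (f.eval σ)) (e.cost + f.cost + 1)
  | seq {p q : Prog} {σ σ' σ'' : State} {t t' : ℕ} :
      Exec O p σ σ' t → Exec O q σ' σ'' t' → Exec O (.seq p q) σ σ'' (t + t')
  | ite_true {e : Exp} {p q : Prog} {σ σ' : State} {t : ℕ} :
      e.eval σ ≠ 0 → Exec O p σ σ' t → Exec O (.ite e p q) σ σ' (e.cost + 1 + t)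
  | ite_false {e : Exp} {p q : Prog} {σ σ' : State} {t : ℕ} :
      e.eval σ = 0 → Exec O q σ σ' t → Exec O (.ite e p q) σ σ' (e.cost + 1 + t)
  | loop_done {e : Exp} {p : Prog} {σ : State} :
      e.eval σ = 0 → Exec O (.loop e p) σ σ (e.cost + 1)
  | loop_step {e : Exp} {p : Prog} {σ σ' σ'' : State} {t t' : ℕ} :
      e.eval σ ≠ 0 → Exec O p σ σ' t → Exec O (.loop e p) σ' σ'' t' →
      Exec O (.loop e p) σ σ'' (e.cost + 1 + t + t')
  | query {σ : State} {x a b : ℕ} {e f : Exp} {y t : ℕ} :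
      O (σ.listAt a (e.eval σ)) (σ.listAt b (f.eval σ)) y t →
      Exec O (.query x a e b f) σ (σ.setReg x y) (e.cost + f.cost + 1 + t)

/-- The input word is in array `0`; every other cell is `0`. -/
def initState (w : List ℕ) : State :=
  ⟨fun _ => 0, fun a i => if a = 0 then w.getD i 0 else 0⟩

/-! ### Well-conditioned overlap functions

The universe with `n` elements is `Fin n`.  A function `α` on pairs of subsets is only constrained,
and only evaluated, on sets of size at most `r`.  The value `true` means conflict. -/

/-- The list `w` enumerates the set `s` (in any order, without repetition). -/
def Lists {n : ℕ} (w : List ℕ) (s : Finset (Fin n)) : Prop :=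
  w.Nodup ∧ w.toFinset = s.map Fin.valEmbedding

/-- The subroutine that evaluates `α` in one step.  It accepts only sets of size at most `r`. -/
def unitCost (r : ℕ) {n : ℕ} (α : Finset (Fin n) → Finset (Fin n) → Bool) : Subroutine :=
  fun v w y t => ∃ s s' : Finset (Fin n), s.card ≤ r ∧ s'.card ≤ r ∧ Lists v s ∧ Lists w s' ∧
    y = (α s s').toNat ∧ t = 1

/-- The subroutine given by a program `A` without subroutine calls: `A` is run on a fresh memory
that holds `n` and the two lists, each preceded by its length; the result is in register `0`.  All
steps of this run are charged. -/
def implementedBy (A : Prog) (n : ℕ) : Subroutine :=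
  fun v w y t => ∃ σ : State, y = σ.reg 0 ∧
    Exec (fun _ _ _ _ => False) A
      (initState (n :: (v.length :: v) ++ (w.length :: w))) σ t

/-- `α` is well-conditioned; the program `A` and the constants `a`, `c` are those of the polynomial
time bound on the evaluation of `α`. -/
structure WellConditioned (r : ℕ) {n : ℕ} (α : Finset (Fin n) → Finset (Fin n) → Bool)
    (A : Prog) (a c : ℕ) : Prop where
  /-- `α` is hereditary. -/
  hereditary : ∀ s t s' t' : Finset (Fin n), s.card ≤ r → t.card ≤ r → s' ⊆ s → t' ⊆ t →
    α s t = false → α s' t' = false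
  /-- Conflicting sets intersect. -/
  inter_nonempty : ∀ s t : Finset (Fin n), s.card ≤ r → t.card ≤ r →
    α s t = true → 1 ≤ (s ∩ t).card
  /-- Subsets of conflicting sets that do not conflict have lost an element of the overlap. -/
  sdiff_nonempty : ∀ s t s' t' : Finset (Fin n), s.card ≤ r → t.card ≤ r → s' ⊆ s → t' ⊆ t →
    α s t = true → α s' t' = false → ((s ∩ t) \ (s' ∩ t')).Nonempty
  /-- `A` computes `α` within `a * n ^ c` steps. -/
  poly_time : ∀ (s t : Finset (Fin n)) (v w : List ℕ), s.card ≤ r → t.card ≤ r →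
    Lists v s → Lists w t →
    ∃ τ : ℕ, τ ≤ a * n ^ c ∧ implementedBy A n v w (α s t).toNat τ

/-! ### Packing with predetermined cluster heads -/

/-- The union of the cluster heads. -/
def val {n : ℕ} (C : List (Finset (Fin n))) : Finset (Fin n) := C.toFinset.sup id

/-- An instance over the universe `Fin n`: a collection of distinct sets of size at most `r`, and a
collection of distinct non-empty cluster heads, both in the order in which they are listed. -/
structure Instance (r n : ℕ) : Type where
  k : ℕ
  S : List (Finset (Fin n))
  C : List (Finset (Fin n))
  nodup_S : S.Nodup
  nodup_C : C.Nodup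
  card_le : ∀ X ∈ S, X.card ≤ r
  head_nonempty : ∀ D ∈ C, D.Nonempty

/-- `K` is a `(k, α)`-set packing with predetermined cluster heads. -/
structure IsPacking {r n : ℕ} (α : Finset (Fin n) → Finset (Fin n) → Bool) (I : Instance r n)
    (K : Finset (Finset (Fin n))) : Prop where
  card : I.k ≤ K.card
  mem : ∀ X ∈ K, X ∈ I.S
  head : ∀ X ∈ K, ∃ D ∈ I.C, D ⊆ X
  disjoint_heads : ∀ X ∈ K, ∀ Y ∈ K, X ≠ Y → (X ∩ Y) ∩ val I.C = ∅
  no_conflict : ∀ X ∈ K, ∀ Y ∈ K, X ≠ Y → α X Y = false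

/-- The word formed by some lists, each preceded by its length. -/
def flatten (L : List (List ℕ)) : List ℕ := L.flatMap fun w => w.length :: w

/-- `w` is an input word for the instance `I`: the numbers `n`, `k`, `|S|`, `|C|`, then the sets of
`S`, then those of `C`. -/
def IsInput {r n : ℕ} (w : List ℕ) (I : Instance r n) : Prop :=
  ∃ LS LC : List (List ℕ), List.Forall₂ Lists LS I.S ∧ List.Forall₂ Lists LC I.C ∧
    w = n :: I.k :: I.S.length :: I.C.length :: (flatten LS ++ flatten LC)

/-- The output in the final state `σ` is right: register `0` holds `1` and the first `k` cells of
array `1` hold positions in `S` of sets that form a packing, or register `0` holds `0` and there is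
no packing. -/
def CorrectOutput {r n : ℕ} (α : Finset (Fin n) → Finset (Fin n) → Bool) (I : Instance r n)
    (σ : State) : Prop :=
  (σ.reg 0 = 1 ∧ (∀ i < I.k, σ.arr 1 i < I.S.length) ∧
      IsPacking α I ((Finset.range I.k).image fun i => I.S.getD (σ.arr 1 i) ∅)) ∨
    (σ.reg 0 = 0 ∧ ∀ K : Finset (Finset (Fin n)), ¬ IsPacking α I K)

/-- With the subroutine `O`, the program `P` solves the instance `I` (in each of its encodings)
within `T` steps. -/
def SolvesWithin {r n : ℕ} (P : Prog) (O : Subroutine)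
    (α : Finset (Fin n) → Finset (Fin n) → Bool) (I : Instance r n) (T : ℕ) : Prop :=
  ∀ w : List ℕ, IsInput w I →
    ∃ (σ : State) (t : ℕ), t ≤ T ∧ Exec O P (initState w) σ t ∧ CorrectOutput α I σ

end PCH

namespace PCH

/-! ### Execution with a time bound -/

/-! The algorithm is a bounded search tree, run without recursion. Two sets are compatible
(`Compat`) if they share no head element and do not conflict in either order. Fix a choice of `k`
heads and let `s` be a family of partial sets, at first the heads themselves. A greedy pass goes
through the entries and replaces each by a member of the collection that contains it and is
compatible with all other current entries. If the pass reaches the end, the result is a packing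
(`out_of_greedy`).

Suppose it stops at entry `f` although some packing `κ` extends `s`. Then `κ f` is incompatible with
a current entry `i`. That entry has already been replaced: the others still lie inside members of
`κ`, and heredity makes them compatible with `κ f`. The replacement was compatible with `s f`, so a
shared head element or condition (ii) yields an element of entry `i` that lies in `κ f` but not in
`s f` (`exists_mem_of_not_compat`). Hence one of at most `r * k` elements can be appended to `s f`
with `κ` still extending the family (`Solution.exists_step`). Heads are non-empty, so the total size
starts at `k` or more, and it stays at most `r * k` below `κ`; thus `(r - 1) * k` additions suffice
(`Solution.exists_digits`). A branch is therefore a sequence of `(r - 1) * k` digits in base `r *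
k`. An odometer runs through all of them, and each branch is replayed from the heads.

A greedy pass takes `O(k ^ 2 * n ^ r)` steps and a branch `O(k ^ 3 * n ^ r)`. The surplus `k ^ 3` is
absorbed because the order of the heads is irrelevant: only strictly increasing choices are
searched, at most `g ^ k / k!` of them (`card_adm_mul_le`), and `k ^ 3 ≤ 5 * k!`
(`cube_le_factorial`). Every other choice is rejected after `O(k)` steps. This is `O(n)`, since `k >
n` is excluded beforehand: the members of a packing contain distinct head elements. For the second
bound, only the subroutine calls become more expensive, each by a factor of at most `a * n ^ c`
(`Exec.implemented`). -/

@[simp] theorem State.setReg_reg (σ : State) (x v y : ℕ) :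
    (σ.setReg x v).reg y = if y = x then v else σ.reg y := by
  simp [State.setReg, Function.update_apply]

@[simp] theorem State.setReg_arr (σ : State) (x v : ℕ) : (σ.setReg x v).arr = σ.arr := rfl

@[simp] theorem State.setArr_reg (σ : State) (a i v : ℕ) : (σ.setArr a i v).reg = σ.reg := rfl

theorem State.setArr_arr_same (σ : State) (a i v j : ℕ) :
    (σ.setArr a i v).arr a j = if j = i then v else σ.arr a j := by
  simp [State.setArr, Function.update_apply]

theorem State.setArr_arr_ne (σ : State) {a b : ℕ} (i v : ℕ) (h : b ≠ a) :
    (σ.setArr a i v).arr b = σ.arr b := by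
  simp [State.setArr, h]

/-- `p` halts from `σ` within `T` steps in a state that satisfies `Q`. -/
def Runs (O : Subroutine) (p : Prog) (σ : State) (T : ℕ) (Q : State → Prop) : Prop :=
  ∃ (σ' : State) (t : ℕ), t ≤ T ∧ Exec O p σ σ' t ∧ Q σ'

variable {O : Subroutine} {σ : State} {Q : State → Prop}

theorem Runs.mono {p : Prog} {T T' : ℕ} {Q' : State → Prop} (h : Runs O p σ T Q) (hT : T ≤ T')
    (hQ : ∀ σ', Q σ' → Q' σ') : Runs O p σ T' Q' := by
  obtain ⟨σ', t, ht, he, hq⟩ := h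
  exact ⟨σ', t, ht.trans hT, he, hQ _ hq⟩

theorem Runs.le {p : Prog} {T T' : ℕ} (h : Runs O p σ T Q) (hT : T ≤ T') : Runs O p σ T' Q :=
  h.mono hT fun _ => id

/-- The number of steps of a program, where loops are not counted. -/
def Prog.scost : Prog → ℕ
  | .skip => 1
  | .assign _ e => e.cost + 1
  | .store _ e f => e.cost + f.cost + 1
  | .seq p q => p.scost + q.scost
  | .ite e p q => e.cost + 1 + (p.scost + q.scost)
  | .loop _ _ => 0
  | .query _ _ e _ f => e.cost + f.cost + 1 + 1

theorem Runs.skip (h : Q σ) : Runs O .skip σ 1 Q := ⟨σ, 1, le_rfl, .skip σ, h⟩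

theorem Runs.assign {x : ℕ} {e : Exp} (h : Q (σ.setReg x (e.eval σ))) :
    Runs O (.assign x e) σ (e.cost + 1) Q := ⟨_, _, le_rfl, .assign σ x e, h⟩

theorem Runs.store {a : ℕ} {e f : Exp} (h : Q (σ.setArr a (e.eval σ) (f.eval σ))) :
    Runs O (.store a e f) σ (e.cost + f.cost + 1) Q := ⟨_, _, le_rfl, .store σ a e f, h⟩

theorem Runs.seq {p q : Prog} {T T' : ℕ} (h : Runs O p σ T fun σ' => Runs O q σ' T' Q) :
    Runs O (.seq p q) σ (T + T') Q := by
  obtain ⟨σ', t, ht, he, σ'', t', ht', he', hq⟩ := h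
  exact ⟨σ'', t + t', add_le_add ht ht', .seq he he', hq⟩

/-- The bounds of the branches are added, not maximised. This costs a constant factor at most, and
an impossible branch may be charged `0`. -/
theorem Runs.ite {e : Exp} {p q : Prog} {T T' : ℕ} (h : e.eval σ ≠ 0 → Runs O p σ T Q)
    (h' : e.eval σ = 0 → Runs O q σ T' Q) :
    Runs O (.ite e p q) σ (e.cost + 1 + (T + T')) Q := by
  by_cases he : e.eval σ = 0
  · obtain ⟨σ', t, ht, hx, hq⟩ := h' he
    exact ⟨σ', _, by omega, .ite_false he hx, hq⟩
  · obtain ⟨σ', t, ht, hx, hq⟩ := h he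
    exact ⟨σ', _, by omega, .ite_true he hx, hq⟩

theorem Runs.query {x a b : ℕ} {e f : Exp} {y t : ℕ}
    (hO : O (σ.listAt a (e.eval σ)) (σ.listAt b (f.eval σ)) y t) (h : Q (σ.setReg x y)) :
    Runs O (.query x a e b f) σ (e.cost + f.cost + 1 + t) Q := ⟨_, _, le_rfl, .query hO, h⟩

/-- A loop that performs `N` rounds. -/
theorem Runs.loop {e : Exp} {p : Prog} (N : ℕ) (T : ℕ → ℕ) (J : ℕ → State → Prop) (h0 : J 0 σ)
    (hlt : ∀ i < N, ∀ σ', J i σ' → e.eval σ' ≠ 0)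
    (hN : ∀ σ', J N σ' → e.eval σ' = 0)
    (hbody : ∀ i < N, ∀ σ', J i σ' → Runs O p σ' (T i) (J (i + 1))) :
    Runs O (.loop e p) σ (∑ i ∈ Finset.range N, (e.cost + 1 + T i) + (e.cost + 1)) (J N) := by
  induction N generalizing σ T J with
  | zero => exact ⟨σ, _, by simp, .loop_done (hN σ h0), h0⟩
  | succ N ih =>
    obtain ⟨σ', t, ht, hx, hJ⟩ := hbody 0 (by omega) σ h0
    obtain ⟨σ'', t', ht', hx', hJ'⟩ := ih (σ := σ') (fun i => T (i + 1)) (fun i => J (i + 1)) hJ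
      (fun i hi => hlt (i + 1) (by omega)) hN (fun i hi => hbody (i + 1) (by omega))
    refine ⟨σ'', e.cost + 1 + t + t', ?_, .loop_step (hlt 0 (by omega) σ h0) hx hx', hJ'⟩
    rw [Finset.sum_range_succ']
    omega

/-- Counting loop: the register `x` runs from `0` to the value of `e`. -/
def forTo (x : ℕ) (e : Exp) (p : Prog) : Prog :=
  .seq (.assign x (.const 0))
    (.loop (.sub e (.reg x)) (.seq p (.assign x (.add (.reg x) (.const 1)))))

/-- The invariant must survive the update of the counter and must determine the value of `e`, which
is evaluated again in every round. The `7` pays for the test apart from `e`, and for the increment.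
-/
theorem Runs.forTo {x : ℕ} {e : Exp} {p : Prog} (N T : ℕ) (J : ℕ → State → Prop)
    (h0 : J 0 (σ.setReg x 0))
    (he : ∀ i ≤ N, ∀ σ', J i σ' → e.eval σ' = N)
    (hbody : ∀ i < N, ∀ σ', σ'.reg x = i → J i σ' →
      Runs O p σ' T fun σ'' => σ''.reg x = i ∧ J (i + 1) (σ''.setReg x (i + 1)))
    (hQ : ∀ σ', J N σ' → Q σ') :
    Runs O (PCH.forTo x e p) σ (N * (T + e.cost + 7) + e.cost + 5) Q := by
  refine Runs.le (T := 2 + (∑ i ∈ Finset.range N, ((Exp.sub e (.reg x)).cost + 1 + (T + 4)) +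
    ((Exp.sub e (.reg x)).cost + 1))) (Runs.seq (Runs.assign ?_)) ?_
  · refine Runs.mono (Runs.loop N (fun _ => T + 4) (fun i σ' => σ'.reg x = i ∧ J i σ')
      ⟨by simp [Exp.eval], h0⟩ ?_ ?_ ?_) le_rfl fun σ' h => hQ σ' h.2
    · rintro i hi σ' ⟨hx, hJ⟩
      simp [Exp.eval, he i hi.le σ' hJ, hx]
      omega
    · rintro σ' ⟨hx, hJ⟩
      simp [Exp.eval, he N le_rfl σ' hJ, hx]
    · rintro i hi σ' ⟨hx, hJ⟩
      refine Runs.seq (Runs.mono (hbody i hi σ' hx hJ) le_rfl ?_)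
      rintro σ'' ⟨hx', hJ'⟩
      refine Runs.assign ⟨by simp [Exp.eval, hx'], ?_⟩
      simpa [Exp.eval, hx'] using hJ'
  · simp [Exp.cost]
    have : N * (e.cost + 1 + 1 + 1 + (T + 4)) = N * (T + e.cost + 7) := by ring
    omega

/-! ### Expressions -/

/-- The multiple `c * e`. -/
def mulC : ℕ → Exp → Exp
  | 0, _ => .const 0
  | c + 1, e => .add (mulC c e) e

@[simp] theorem mulC_eval (c : ℕ) (e : Exp) (σ : State) :
    (mulC c e).eval σ = c * e.eval σ := by
  induction c with
  | zero => simp [mulC, Exp.eval]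
  | succ c ih => simp [mulC, Exp.eval, ih]; ring

attribute [simp] Exp.eval

/-- Truth of an expression. -/
def Holds (σ : State) (e : Exp) : Prop := e.eval σ ≠ 0

/-- Truncated subtraction is the only test available: `1 - e` negates, `f - e` is nonzero exactly
when `e < f`, and equality means that both differences vanish. A sum acts as a disjunction. -/
def notE (e : Exp) : Exp := .sub (.const 1) e
def andE (e f : Exp) : Exp := .sub (.const 1) (.add (notE e) (notE f))
def ltE (e f : Exp) : Exp := .sub f e
def eqE (e f : Exp) : Exp := notE (.add (.sub e f) (.sub f e))

/-- Disjunction over the numbers below `m`. -/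
def anyE : ℕ → (ℕ → Exp) → Exp
  | 0, _ => .const 0
  | m + 1, e => .add (anyE m e) (e m)

theorem holds_iff (e : Exp) : Holds σ e ↔ e.eval σ ≠ 0 := Iff.rfl

@[simp] theorem holds_notE (e : Exp) : Holds σ (notE e) ↔ ¬ Holds σ e := by
  simp [Holds, notE]; omega

@[simp] theorem holds_andE (e f : Exp) : Holds σ (andE e f) ↔ Holds σ e ∧ Holds σ f := by
  simp [Holds, andE, notE]; omega

@[simp] theorem holds_ltE (e f : Exp) : Holds σ (ltE e f) ↔ e.eval σ < f.eval σ := by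
  simp [Holds, ltE]; omega

@[simp] theorem holds_eqE (e f : Exp) : Holds σ (eqE e f) ↔ e.eval σ = f.eval σ := by
  simp [Holds, eqE, notE]; omega

@[simp] theorem holds_add (e f : Exp) : Holds σ (.add e f) ↔ Holds σ e ∨ Holds σ f := by
  simp [Holds]; omega

@[simp] theorem holds_anyE (m : ℕ) (e : ℕ → Exp) :
    Holds σ (anyE m e) ↔ ∃ q < m, Holds σ (e q) := by
  induction m with
  | zero => simp [Holds, anyE]
  | succ m ih => simp only [anyE, holds_add, ih, Nat.lt_succ_iff_lt_or_eq, or_and_right, exists_or,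
      exists_eq_left]

/-- The entry `q` of the list at address `p` of array `a`. -/
def entry (a : ℕ) (p : Exp) (q : Exp) : Exp := .get a (.add (.add p (.const 1)) q)

/-- `u` occurs in the list (of length at most `r`) at address `p` of array `a`. -/
def memE (r : ℕ) (u : Exp) (a : ℕ) (p : Exp) : Exp :=
  anyE r fun q => andE (ltE (.const q) (.get a p)) (eqE (entry a p (.const q)) u)

theorem State.mem_listAt {a p u : ℕ} :
    u ∈ σ.listAt a p ↔ ∃ q < σ.arr a p, σ.arr a (p + 1 + q) = u := by
  simp [State.listAt]

@[simp] theorem State.length_listAt (a p : ℕ) : (σ.listAt a p).length = σ.arr a p := by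
  simp [State.listAt]

theorem holds_memE {r : ℕ} {u : Exp} {a : ℕ} {p : Exp} (h : σ.arr a (p.eval σ) ≤ r) :
    Holds σ (memE r u a p) ↔ u.eval σ ∈ σ.listAt a (p.eval σ) := by
  simp only [memE, holds_anyE, holds_andE, holds_ltE, holds_eqE, State.mem_listAt, entry, Exp.eval]
  exact ⟨fun ⟨q, _, h1, h2⟩ => ⟨q, h1, h2⟩, fun ⟨q, h1, h2⟩ => ⟨q, by omega, h1, h2⟩⟩

/-- Some entry of the list at `p` in array `a` satisfies `P`. -/
def someE (r : ℕ) (a : ℕ) (p : Exp) (P : Exp → Exp) : Exp :=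
  anyE r fun q => andE (ltE (.const q) (.get a p)) (P (entry a p (.const q)))

theorem holds_someE {r : ℕ} {P : Exp → Exp} {R : ℕ → Prop} {a : ℕ} {p : Exp}
    (h : σ.arr a (p.eval σ) ≤ r) (hP : ∀ e : Exp, Holds σ (P e) ↔ R (e.eval σ)) :
    Holds σ (someE r a p P) ↔ ∃ u ∈ σ.listAt a (p.eval σ), R u := by
  simp only [someE, holds_anyE, holds_andE, holds_ltE, State.mem_listAt, entry, Exp.eval, hP]
  constructor
  · rintro ⟨q, _, h1, h2⟩
    exact ⟨_, ⟨q, h1, rfl⟩, h2⟩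
  · rintro ⟨_, ⟨q, h1, rfl⟩, h2⟩
    exact ⟨q, by omega, h1, h2⟩

/-! ### Copying lists -/

/-- Copy `m` cells. -/
def copyCells (a : ℕ) (e : Exp) (b : ℕ) (f : Exp) : ℕ → Prog
  | 0 => .skip
  | m + 1 => .seq (copyCells a e b f m)
      (.store b (.add f (.const m)) (.get a (.add e (.const m))))

/-- `e` has the same value in all states that differ from `σ` in array `b` only. -/
def Exp.StableOn (e : Exp) (σ : State) (b : ℕ) : Prop :=
  ∀ σ' : State, σ'.reg = σ.reg → (∀ c, c ≠ b → σ'.arr c = σ.arr c) → e.eval σ' = e.eval σ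

/-- The copy is unrolled, since it is only used for the fixed length `r + 1`. Both addresses are
evaluated anew for each cell, hence the stability under writes to `b`. -/
theorem Runs.copyCells {a b : ℕ} {e f : Exp} (hab : a ≠ b) (he : e.StableOn σ b)
    (hf : f.StableOn σ b) (m : ℕ)
    (hQ : ∀ σ' : State, σ'.reg = σ.reg → (∀ c, c ≠ b → σ'.arr c = σ.arr c) →
      (∀ p, σ'.arr b p = if f.eval σ ≤ p ∧ p < f.eval σ + m then σ.arr a (e.eval σ + (p - f.eval σ))
        else σ.arr b p) → Q σ') :
    Runs O (PCH.copyCells a e b f m) σ (PCH.copyCells a e b f m).scost Q := by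
  induction m generalizing Q with
  | zero => exact Runs.skip (hQ σ rfl (fun _ _ => rfl) fun p => by simp)
  | succ m ih =>
    refine Runs.seq (ih fun σ' h1 h2 h3 => Runs.store ?_)
    have ee : e.eval σ' = e.eval σ := he σ' h1 h2
    have ef : f.eval σ' = f.eval σ := hf σ' h1 h2
    refine hQ _ h1 (fun c hc => by rw [State.setArr_arr_ne _ _ _ hc, h2 c hc]) fun p => ?_
    simp only [State.setArr_arr_same, Exp.eval, ee, ef, h3, h2 a hab]
    by_cases hp : p = f.eval σ + m
    · subst hp; simp
    · rw [if_neg hp]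
      exact if_congr (by omega) rfl rfl

/-! ### Odometers -/

/-- The `m` digits of `v` in base `b`, followed by zeros. -/
def dig (b m v : ℕ) (i : ℕ) : ℕ := if i < m then v / b ^ i % b else 0

theorem dig_zero (b m : ℕ) : dig b m 0 = fun _ => 0 := by
  funext i; simp [dig]

/-- On overflow all digits return to zero, so a finished odometer leaves its array clean for the
next use. -/
theorem dig_pow (b m : ℕ) : dig b m (b ^ m) = fun _ => 0 := by
  funext i
  simp only [dig]
  split_ifs with h
  · rcases Nat.eq_zero_or_pos b with rfl | hb
    · simp [Nat.zero_pow (show 0 < m by omega)]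
    · rw [Nat.pow_div h.le hb, show m - i = (m - i - 1) + 1 by omega, pow_succ, Nat.mul_mod_left]
  · rfl

theorem dig_lt {b m v i : ℕ} (hb : 0 < b) : dig b m v i < b := by
  simp only [dig]; split_ifs
  · exact Nat.mod_lt _ hb
  · exact hb

/-- Every sequence of digits occurs. -/
theorem exists_dig (b : ℕ) (m : ℕ) (d : ℕ → ℕ) (hd : ∀ i < m, d i < b) :
    ∃ v < b ^ m, ∀ i < m, dig b m v i = d i := by
  induction m generalizing d with
  | zero => exact ⟨0, by simp, by simp⟩
  | succ m ih =>
    obtain ⟨v, hv, h⟩ := ih (fun i => d (i + 1)) fun i hi => hd _ (by omega)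
    have h0 := hd 0 (by omega)
    refine ⟨d 0 + b * v, ?_, fun i hi => ?_⟩
    · rw [pow_succ]; nlinarith
    · simp only [dig, if_pos hi]
      cases i with
      | zero => simp [Nat.mod_eq_of_lt h0]
      | succ i =>
        rw [pow_succ', ← Nat.div_div_eq_div_mul, Nat.add_mul_div_left _ _ (by omega),
          Nat.div_eq_of_lt h0, zero_add]
        have := h i (by omega)
        rwa [dig, if_pos (by omega)] at this

theorem dig_inj {b m v w : ℕ} (hv : v < b ^ m) (hw : w < b ^ m)
    (h : ∀ i < m, dig b m v i = dig b m w i) : v = w := by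
  induction m generalizing v w with
  | zero => simp at hv hw; omega
  | succ m ih =>
    have hb : 0 < b := by
      rcases Nat.eq_zero_or_pos b with rfl | hb
      · simp at hv
      · exact hb
    have h0 : v % b = w % b := by simpa [dig] using h 0 (by omega)
    have h1 : v / b = w / b := by
      refine ih (Nat.div_lt_of_lt_mul (by rwa [← pow_succ'])) (Nat.div_lt_of_lt_mul (by rwa [← pow_succ']))
        fun i hi => ?_
      have := h (i + 1) (by omega)
      simp only [dig, if_pos (show i + 1 < m + 1 by omega), pow_succ', ← Nat.div_div_eq_div_mul] at this
      simpa only [dig, if_pos hi] using this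
    rw [← Nat.div_add_mod v b, ← Nat.div_add_mod w b, h0, h1]

/-- Add one to the number whose digits are in array `a`; register `c` receives the carry. -/
def increment (a c x : ℕ) (eb em : Exp) : Prog :=
  .seq (.assign c (.const 1)) (forTo x em
    (.ite (.sub eb (.add (.get a (.reg x)) (.reg c)))
      (.seq (.store a (.reg x) (.add (.get a (.reg x)) (.reg c))) (.assign c (.const 0)))
      (.seq (.store a (.reg x) (.const 0)) (.assign c (.const 1)))))

/-- `σ'` differs from `σ` only in the registers `c`, `x` and in array `a`. -/
def SameBut (a c x : ℕ) (σ σ' : State) : Prop :=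
  (∀ y, y ≠ c → y ≠ x → σ'.reg y = σ.reg y) ∧ ∀ d, d ≠ a → σ'.arr d = σ.arr d

def incTime (eb em : Exp) (m : ℕ) : ℕ :=
  2 + (m * ((eb.cost + 5 + 1 + (8 + 5)) + em.cost + 7) + em.cost + 5)

/-- The carry into position `i` is `1` exactly when `b ^ i` divides `v + 1`, and `(v + 1) / b ^ i`
exceeds `v / b ^ i` by exactly this carry (`Nat.succ_div`). -/
theorem Runs.increment {a c x : ℕ} {eb em : Exp} {b m v : ℕ} (hcx : c ≠ x) (hb : 0 < b)
    (hv : v < b ^ m) (ha : σ.arr a = dig b m v)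
    (heb : ∀ σ', SameBut a c x σ σ' → eb.eval σ' = b)
    (hem : ∀ σ', SameBut a c x σ σ' → em.eval σ' = m)
    (hQ : ∀ σ', SameBut a c x σ σ' → σ'.arr a = dig b m (v + 1) →
      σ'.reg c = (if v + 1 = b ^ m then 1 else 0) → Q σ') :
    Runs O (PCH.increment a c x eb em) σ (incTime eb em m) Q := by
  refine Runs.le (Runs.seq (Runs.assign (Runs.forTo (N := m) (T := eb.cost + 5 + 1 + (8 + 5))
    (J := fun i σ' => SameBut a c x σ σ' ∧
      (∀ j, σ'.arr a j = if j < i then dig b m (v + 1) j else dig b m v j) ∧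
      σ'.reg c = (if b ^ i ∣ v + 1 then 1 else 0)) ?_ ?_ ?_ ?_)))
    (by simp only [incTime, Exp.cost]; omega)
  · refine ⟨⟨fun y h1 h2 => by simp [h1, h2], fun d _ => rfl⟩, fun j => by simp [ha], ?_⟩
    simp [hcx]
  · exact fun i hi σ' h => hem σ' h.1
  · rintro i hi σ' hx ⟨hs, hd, hc⟩
    have hdi : σ'.arr a i = v / b ^ i % b := by rw [hd]; simp [dig, hi]
    have hlt : v / b ^ i % b < b := Nat.mod_lt _ hb
    have hpos : 0 < b ^ i := Nat.pow_pos hb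
    have key : (v + 1) / b ^ i = v / b ^ i + (if b ^ i ∣ v + 1 then 1 else 0) := Nat.succ_div
    have key2 : dig b m (v + 1) i = (v / b ^ i % b + (if b ^ i ∣ v + 1 then 1 else 0)) % b := by
      simp only [dig, if_pos hi, key, Nat.add_mod, Nat.mod_mod]
    -- The carry moves on exactly when there is one and the new digit is zero.
    have key3 : b ^ (i + 1) ∣ v + 1 ↔ b ^ i ∣ v + 1 ∧
        (v / b ^ i % b + (if b ^ i ∣ v + 1 then 1 else 0)) % b = 0 := by
      by_cases hdv : b ^ i ∣ v + 1
      · have e1 : (v / b ^ i % b + 1) % b = (v + 1) / b ^ i % b := by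
          rw [key, if_pos hdv]; simp [Nat.add_mod]
        simp only [hdv, if_true, true_and, e1]
        rw [← Nat.dvd_iff_mod_eq_zero, pow_succ]
        exact (Nat.dvd_div_iff_mul_dvd hdv).symm
      · simp only [hdv, false_and, iff_false]
        exact fun h => hdv ((pow_dvd_pow b (by omega)).trans h)
    have eb' := heb σ' hs
    have arr_eq : ∀ (j w : ℕ), w = dig b m (v + 1) i → (σ'.setArr a i w).arr a j =
        if j < i + 1 then dig b m (v + 1) j else dig b m v j := by
      intro j w hw
      rw [State.setArr_arr_same, hd]
      by_cases hj : j = i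
      · subst hj; simp [hw]
      · rw [if_neg hj]; exact if_congr (by omega) rfl rfl
    refine Runs.le (Runs.ite (fun h => Runs.seq (Runs.store (Runs.assign ?_)))
      (fun h => Runs.seq (Runs.store (Runs.assign ?_)))) (by simp only [Exp.cost]; omega)
    · simp only [Exp.eval, eb', hx, hdi, hc] at h ⊢
      have hmod := Nat.mod_eq_of_lt (show v / b ^ i % b + (if b ^ i ∣ v + 1 then 1 else 0) < b by omega)
      refine ⟨by simp [hx, hcx.symm], ⟨fun y h1 h2 => by simp [h1, h2, hs.1], fun d hda => ?_⟩,
        fun j => ?_, ?_⟩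
      · simp only [State.setReg_arr]; rw [State.setArr_arr_ne _ _ _ hda, hs.2 d hda]
      · simp only [State.setReg_arr]; exact arr_eq _ _ (by rw [key2, hmod])
      · have : ¬ b ^ (i + 1) ∣ v + 1 := by
          rw [key3, hmod]; rintro ⟨h1, h2⟩; rw [if_pos h1] at h2; omega
        simp [hcx, this]
    · simp only [Exp.eval, eb', hx, hdi, hc] at h ⊢
      have hdv : b ^ i ∣ v + 1 := by
        by_contra hdv; rw [if_neg hdv] at h; omega
      rw [if_pos hdv] at h key2 key3
      have hmod : (v / b ^ i % b + 1) % b = 0 := by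
        rw [show v / b ^ i % b + 1 = b by omega, Nat.mod_self]
      refine ⟨by simp [hx, hcx.symm], ⟨fun y h1 h2 => by simp [h1, h2, hs.1], fun d hda => ?_⟩,
        fun j => ?_, ?_⟩
      · simp only [State.setReg_arr]; rw [State.setArr_arr_ne _ _ _ hda, hs.2 d hda]
      · simp only [State.setReg_arr]; exact arr_eq _ _ (by rw [key2, hmod])
      · have : b ^ (i + 1) ∣ v + 1 := key3.2 ⟨hdv, hmod⟩
        simp [hcx, this]
  · rintro σ' ⟨hs, hd, hc⟩
    refine hQ σ' hs (funext fun j => ?_) ?_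
    · rw [hd]; split_ifs with h
      · rfl
      · simp [dig, h]
    · rw [hc]
      -- As `0 < v + 1 ≤ b ^ m`, divisibility by `b ^ m` means equality: the final carry signals
      -- that the last number has been used.
      refine if_congr ⟨fun h => ?_, fun h => h ▸ dvd_rfl⟩ rfl rfl
      exact le_antisymm (by omega) (Nat.le_of_dvd (by omega) h)

/-- Run `p` for all digit sequences in array `a`. -/
def odometer (a c x : ℕ) (eb em : Exp) (p : Prog) : Prog :=
  .seq (.assign c (.const 0))
    (.loop (.sub (.const 1) (.reg c)) (.seq p (increment a c x eb em)))

/-- The bound `T v` depends on the number `v`, so that expensive rounds can be counted separately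
from cheap ones. The invariant has to ignore whatever `increment` changes. -/
theorem Runs.odometer {a c x : ℕ} {eb em : Exp} {p : Prog} {b m : ℕ} (T : ℕ → ℕ)
    (J : ℕ → State → Prop) (hcx : c ≠ x) (hb : 0 < b)
    (hJ : ∀ v σ₁ σ₂, J v σ₁ → SameBut a c x σ₁ σ₂ → J v σ₂)
    (heb : ∀ v σ', J v σ' → eb.eval σ' = b) (hem : ∀ v σ', J v σ' → em.eval σ' = m)
    (ha : σ.arr a = fun _ => 0) (h0 : J 0 σ)
    (hbody : ∀ v < b ^ m, ∀ σ', σ'.arr a = dig b m v → J v σ' →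
      Runs O p σ' (T v) fun σ'' => σ''.arr a = dig b m v ∧ J (v + 1) σ'')
    (hQ : ∀ σ', σ'.arr a = (fun _ => 0) → J (b ^ m) σ' → Q σ') :
    Runs O (PCH.odometer a c x eb em p) σ
      (∑ v ∈ Finset.range (b ^ m), (T v + incTime eb em m + 4) + 6) Q := by
  have hpos : 0 < b ^ m := Nat.pow_pos hb
  refine Runs.le (Runs.seq (Runs.assign (Runs.mono (Runs.loop (b ^ m)
    (fun v => T v + incTime eb em m)
    (fun v σ' => J v σ' ∧ σ'.arr a = dig b m v ∧ σ'.reg c = if v = b ^ m then 1 else 0)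
    ?_ ?_ ?_ ?_) le_rfl ?_))) (T' := _) ?_
  · refine ⟨hJ _ _ _ h0 ⟨fun y h1 h2 => by simp [h1], fun d _ => rfl⟩, by simp [ha, dig_zero], ?_⟩
    simp [hpos.ne]
  · rintro i hi σ' ⟨-, -, hc⟩
    simp [hc, hi.ne]
  · rintro σ' ⟨-, -, hc⟩
    simp [hc]
  · rintro v hv σ' ⟨hj, hd, -⟩
    refine Runs.seq (Runs.mono (hbody v hv σ' hd hj) le_rfl ?_)
    rintro σ'' ⟨hd', hj'⟩
    exact Runs.increment hcx hb hv hd' (fun τ hτ => heb _ _ (hJ _ _ _ hj' hτ))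
      (fun τ hτ => hem _ _ (hJ _ _ _ hj' hτ)) fun τ hτ h1 h2 => ⟨hJ _ _ _ hj' hτ, h1, h2⟩
  · rintro σ' ⟨hj, hd, -⟩
    exact hQ σ' (by rw [hd, dig_pow]) hj
  · simp only [Exp.cost]
    have : ∀ v ∈ Finset.range (b ^ m), 1 + 1 + 1 + 1 + (T v + incTime eb em m) =
      T v + incTime eb em m + 4 := fun v _ => by ring
    rw [Finset.sum_congr rfl this]
    omega

/-! ### The greedy procedure on lists -/

/-- The subset of `Fin n` formed by the entries of a list. -/
def toSet (n : ℕ) (w : List ℕ) : Finset (Fin n) := Finset.univ.filter fun x => (x : ℕ) ∈ w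

@[simp] theorem mem_toSet {n : ℕ} {w : List ℕ} {x : Fin n} : x ∈ toSet n w ↔ (x : ℕ) ∈ w := by
  simp [toSet]

theorem toSet_mono {n : ℕ} {v w : List ℕ} (h : v ⊆ w) : toSet n v ⊆ toSet n w :=
  fun x hx => by simp only [mem_toSet] at *; exact h hx

theorem card_toSet_le (n : ℕ) (w : List ℕ) : (toSet n w).card ≤ w.length := by
  calc (toSet n w).card = ((toSet n w).map Fin.valEmbedding).card := by simp
    _ ≤ w.toFinset.card := Finset.card_le_card fun x hx => by
        simp only [Finset.mem_map, mem_toSet, Fin.valEmbedding_apply] at hx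
        obtain ⟨y, hy, rfl⟩ := hx
        simpa using hy
    _ ≤ w.length := w.toFinset_card_le

theorem lists_iff {n : ℕ} {w : List ℕ} {s : Finset (Fin n)} :
    Lists w s ↔ w.Nodup ∧ (∀ u ∈ w, u < n) ∧ toSet n w = s := by
  constructor
  · rintro ⟨h1, h2⟩
    refine ⟨h1, fun u hu => ?_, ?_⟩
    · rw [← List.mem_toFinset, h2] at hu
      simp only [Finset.mem_map, Fin.valEmbedding_apply] at hu
      obtain ⟨y, _, rfl⟩ := hu
      exact y.2
    · ext x
      rw [mem_toSet, ← List.mem_toFinset, h2]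
      simp [Fin.val_inj]
  · rintro ⟨h1, h2, rfl⟩
    refine ⟨h1, ?_⟩
    ext u
    simp only [List.mem_toFinset, Finset.mem_map, mem_toSet, Fin.valEmbedding_apply]
    exact ⟨fun h => ⟨⟨u, h2 u h⟩, h, rfl⟩, by rintro ⟨y, hy, rfl⟩; exact hy⟩

/-- An instance whose sets and cluster heads are given by lists. -/
structure Ctx where
  r : ℕ
  n : ℕ
  k : ℕ
  α : Finset (Fin n) → Finset (Fin n) → Bool
  LS : List (List ℕ)
  LC : List (List ℕ)

/-- Families of lists, indexed by the positions of a packing. -/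
abbrev Fam : Type := ℕ → List ℕ

namespace Ctx

variable (c : Ctx)

/-- The list represents a set of size at most `r`. -/
def Ok (w : List ℕ) : Prop := w.Nodup ∧ (∀ u ∈ w, u < c.n) ∧ w.length ≤ c.r

structure Valid : Prop where
  r_pos : 0 < c.r
  ok : ∀ w ∈ c.LS, c.Ok w
  nodup : ∀ w ∈ c.LC, w.Nodup
  lt : ∀ w ∈ c.LC, ∀ u ∈ w, u < c.n
  ne_nil : ∀ w ∈ c.LC, w ≠ []
  hereditary : ∀ s t s' t' : Finset (Fin c.n), s.card ≤ c.r → t.card ≤ c.r → s' ⊆ s → t' ⊆ t →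
    c.α s t = false → c.α s' t' = false
  sdiff_nonempty : ∀ s t s' t' : Finset (Fin c.n), s.card ≤ c.r → t.card ≤ c.r → s' ⊆ s →
    t' ⊆ t → c.α s t = true → c.α s' t' = false → ((s ∩ t) \ (s' ∩ t')).Nonempty

def InHead (u : ℕ) : Prop := ∃ w ∈ c.LC, u ∈ w

/-- The two sets may be in the same packing. -/
def Compat (v w : List ℕ) : Prop :=
  (∀ u ∈ w, u ∈ v → ¬ c.InHead u) ∧ c.α (toSet c.n v) (toSet c.n w) = false ∧
    c.α (toSet c.n w) (toSet c.n v) = false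

variable {c}

theorem Compat.symm {v w : List ℕ} (h : c.Compat v w) : c.Compat w v :=
  ⟨fun u hu hu' => h.1 u hu' hu, h.2.2, h.2.1⟩

theorem Ok.card_le {w : List ℕ} (h : c.Ok w) : (toSet c.n w).card ≤ c.r :=
  (card_toSet_le _ _).trans h.2.2

/-- Heredity, applied in both orders because `α` need not be symmetric. -/
theorem Compat.subset (hc : c.Valid) {v w w' : List ℕ} (h : c.Compat v w) (hv : c.Ok v)
    (hw : c.Ok w) (hs : w' ⊆ w) : c.Compat v w' :=
  ⟨fun u hu hu' => h.1 u (hs hu) hu',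
    hc.hereditary _ _ _ _ hv.card_le hw.card_le subset_rfl (toSet_mono hs) h.2.1,
    hc.hereditary _ _ _ _ hw.card_le hv.card_le (toSet_mono hs) subset_rfl h.2.2⟩

/-- If `v` is compatible with a part of `w` but not with `w`, then the rest of `w` meets `v`. -/
theorem exists_mem_of_not_compat (hc : c.Valid) {v w w' : List ℕ} (hv : c.Ok v) (hw : c.Ok w)
    (hs : w' ⊆ w) (h : ¬ c.Compat v w) (h' : c.Compat v w') : ∃ u ∈ v, u ∈ w ∧ u ∉ w' := by
  -- Incompatibility has three possible causes: a common head element, a conflict of `v` with `w`,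
  -- or a conflict of `w` with `v`. In the last two, condition (ii) yields a lost element of the
  -- overlap.
  by_cases h1 : ∃ u ∈ w, u ∈ v ∧ c.InHead u
  · obtain ⟨u, hu, hu', hu''⟩ := h1
    exact ⟨u, hu', hu, fun hh => h'.1 u hh hu' hu''⟩
  · push Not at h1
    by_cases h2 : c.α (toSet c.n v) (toSet c.n w) = false
    · have h3 : c.α (toSet c.n w) (toSet c.n v) = true := by
        by_contra h3
        exact h ⟨h1, h2, by simpa using h3⟩
      obtain ⟨x, hx⟩ := hc.sdiff_nonempty _ _ _ _ hw.card_le hv.card_le (toSet_mono hs)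
        subset_rfl h3 h'.2.2
      simp only [Finset.mem_sdiff, Finset.mem_inter, mem_toSet] at hx
      exact ⟨x, hx.1.2, hx.1.1, fun hh => hx.2 ⟨hh, hx.1.2⟩⟩
    · obtain ⟨x, hx⟩ := hc.sdiff_nonempty _ _ _ _ hv.card_le hw.card_le subset_rfl
        (toSet_mono hs) (by simpa using h2) h'.2.1
      simp only [Finset.mem_sdiff, Finset.mem_inter, mem_toSet] at hx
      exact ⟨x, hx.1.1, hx.1.2, fun hh => hx.2 ⟨hx.1.1, hh⟩⟩

variable (c)

/-- The list `v` may replace entry `j` of the family `t`. -/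
def Good (s t : Fam) (j : ℕ) (v : List ℕ) : Prop :=
  s j ⊆ v ∧ ∀ l < c.k, l ≠ j → c.Compat v (t l)

open Classical in
/-- The last of the first `m` sets that may replace entry `j`. -/
noncomputable def pick (s t : Fam) (j : ℕ) : ℕ → Option ℕ
  | 0 => none
  | m + 1 => if c.Good s t j (c.LS.getD m []) then some m else pick s t j m

theorem pick_eq_none {s t : Fam} {j : ℕ} : ∀ {m : ℕ},
    c.pick s t j m = none ↔ ∀ i < m, ¬ c.Good s t j (c.LS.getD i [])
  | 0 => by simp [pick]
  | m + 1 => by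
    rw [pick]
    split_ifs with h
    · simp only [false_iff]
      exact fun h' => h' m (by omega) h
    · rw [pick_eq_none]
      exact ⟨fun h' i hi => (Nat.lt_succ_iff_lt_or_eq.1 hi).elim (h' i) fun e => e ▸ h,
        fun h' i hi => h' i (by omega)⟩

theorem pick_eq_some {s t : Fam} {j m' : ℕ} : ∀ {m : ℕ},
    c.pick s t j m = some m' → m' < m ∧ c.Good s t j (c.LS.getD m' [])
  | 0 => by simp [pick]
  | m + 1 => by
    rw [pick]
    split_ifs with h
    · rintro ⟨⟩; exact ⟨by omega, h⟩
    · intro h'; have := pick_eq_some h'; exact ⟨by omega, this.2⟩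

/-- The greedy replacement of the first `j` entries of `s`.  The first component is `0` if all of
them have been replaced, and `f + 1` if entry `f` could not be replaced. -/
noncomputable def greedy (s : Fam) : ℕ → ℕ × Fam
  | 0 => (0, s)
  | j + 1 =>
    if (greedy s j).1 = 0 then
      match c.pick s (greedy s j).2 j c.LS.length with
      | none => (j + 1, (greedy s j).2)
      | some m => (0, Function.update (greedy s j).2 j (c.LS.getD m []))
    else greedy s j

/-- The first `j` entries of `s` have been replaced, with result `t`. -/
structure Replaced (s t : Fam) (j : ℕ) : Prop where
  mem : ∀ l < j, t l ∈ c.LS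
  subset : ∀ l < j, s l ⊆ t l
  eq : ∀ l, j ≤ l → t l = s l
  compat : ∀ l < j, ∀ l' < c.k, l ≠ l' → c.Compat (t l) (t l')

/-- After a failure at `f` nothing changes any more, so the final family is still the one at the
moment of failure. In `Replaced`, compatibility also covers the entries not yet replaced; this is
what relates the replacements to `s f`. -/
theorem greedy_spec (s : Fam) (j : ℕ) (hj : j ≤ c.k) :
    ((c.greedy s j).1 = 0 ∧ c.Replaced s (c.greedy s j).2 j) ∨
    ∃ f < j, (c.greedy s j).1 = f + 1 ∧ c.Replaced s (c.greedy s j).2 f ∧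
      ∀ w ∈ c.LS, ¬ c.Good s (c.greedy s j).2 f w := by
  induction j with
  | zero => exact Or.inl ⟨rfl, by simp, by simp, fun _ _ => rfl, by simp⟩
  | succ j ih =>
    rcases ih (by omega) with ⟨h0, h⟩ | ⟨f, hf, h1, h2, h3⟩
    · simp only [greedy, h0, if_true]
      rcases hp : c.pick s (c.greedy s j).2 j c.LS.length with _ | m
      · refine Or.inr ⟨j, by omega, rfl, h, fun w hw hg => ?_⟩
        rw [pick_eq_none] at hp
        obtain ⟨i, hi, rfl⟩ := List.getElem_of_mem hw
        exact hp i hi (by rwa [List.getD_eq_getElem _ _ hi])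
      · obtain ⟨hm, hg⟩ := c.pick_eq_some hp
        refine Or.inl ⟨rfl, fun l hl => ?_, fun l hl => ?_, fun l hl => ?_, fun l hl l' hl' hne => ?_⟩
        · rcases Nat.lt_succ_iff_lt_or_eq.1 hl with h' | rfl
          · simpa [h'.ne] using h.mem l h'
          · simp [List.getElem?_eq_getElem hm]
        · rcases Nat.lt_succ_iff_lt_or_eq.1 hl with h' | rfl
          · simpa [h'.ne] using h.subset l h'
          · simpa using hg.1
        · simpa [show l ≠ j by omega] using h.eq l (by omega)
        · rcases Nat.lt_succ_iff_lt_or_eq.1 hl with h' | rfl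
          · simp only [Function.update_apply, h'.ne, if_false]
            split_ifs with h''
            · exact (hg.2 l (by omega) h'.ne).symm
            · exact h.compat l h' l' hl' hne
          · simp only [Function.update_apply, if_true, hne.symm, if_false]
            exact hg.2 l' hl' hne.symm
    · refine Or.inr ⟨f, by omega, ?_⟩
      simp only [greedy, h1, Nat.add_eq_zero_iff, one_ne_zero, and_false, if_false]
      exact ⟨trivial, h2, h3⟩

/-- Append to entry `f` of `s` the element of the lists in `t` with number `e`. -/
def extend (s t : Fam) (f e : ℕ) : Fam :=
  -- The digit `e = r * i + q` names element `q` of list `i`. The guards make meaningless digits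
  -- harmless.
  if e % c.r < (t (e / c.r)).length ∧ (s f).length < c.r ∧
      (t (e / c.r)).getD (e % c.r) 0 ∉ s f then
    Function.update s f (s f ++ [(t (e / c.r)).getD (e % c.r) 0])
  else s

noncomputable def step (s : Fam) (e : ℕ) : Fam :=
  if (c.greedy s c.k).1 = 0 then s
  else c.extend s (c.greedy s c.k).2 ((c.greedy s c.k).1 - 1) e

noncomputable def iter (s : Fam) (e : ℕ → ℕ) : ℕ → Fam
  | 0 => s
  | t + 1 => c.step (iter s e t) (e t)

/-- The first digit is split off instead of the last, as the induction in `Solution.exists_digits`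
requires. -/
theorem iter_succ' (s : Fam) (e : ℕ → ℕ) (t : ℕ) :
    c.iter s e (t + 1) = c.iter (c.step s (e 0)) (fun i => e (i + 1)) t := by
  induction t with
  | zero => rfl
  | succ t ih => rw [iter, ih, iter]

theorem iter_congr (s : Fam) {e e' : ℕ → ℕ} {t : ℕ} (h : ∀ i < t, e i = e' i) :
    c.iter s e t = c.iter s e' t := by
  induction t with
  | zero => rfl
  | succ t ih => rw [iter, iter, ih fun i hi => h i (by omega), h t (by omega)]

variable {c}

/-! ### Invariants of the branching step -/

theorem subset_extend (s t : Fam) (f e l : ℕ) : s l ⊆ c.extend s t f e l := by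
  rw [extend]
  split_ifs with h
  · by_cases hl : l = f
    · subst hl; simp
    · simp [hl]
  · simp

theorem subset_step (s : Fam) (e l : ℕ) : s l ⊆ c.step s e l := by
  rw [step]
  split_ifs
  · simp
  · exact subset_extend _ _ _ _ _

theorem subset_iter (s : Fam) (e : ℕ → ℕ) (t l : ℕ) : s l ⊆ c.iter s e t l := by
  induction t with
  | zero => simp [iter]
  | succ t ih => exact List.Subset.trans ih (subset_step _ _ _)

theorem Replaced.ok (hc : c.Valid) {s t : Fam} {j : ℕ} (h : c.Replaced s t j)
    (hs : ∀ l < c.k, c.Ok (s l)) : ∀ l < c.k, c.Ok (t l) := fun l hl => by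
  rcases lt_or_ge l j with h' | h'
  · exact hc.ok _ (h.mem l h')
  · rw [h.eq l h']; exact hs l hl

theorem greedy_ok (hc : c.Valid) {s : Fam} (hs : ∀ l < c.k, c.Ok (s l)) {j : ℕ} (hj : j ≤ c.k) :
    ∀ l < c.k, c.Ok ((c.greedy s j).2 l) := by
  rcases c.greedy_spec s j hj with ⟨-, h⟩ | ⟨f, -, -, h, -⟩ <;> exact h.ok hc hs

/-- The guards in `extend` keep the length and the absence of repetitions; the bound on `e / r`
ensures that the new element comes from one of the `k` lists of the pass. -/
theorem step_ok (hc : c.Valid) {s : Fam} (hs : ∀ l < c.k, c.Ok (s l)) {e : ℕ}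
    (he : e / c.r < c.k) : ∀ l < c.k, c.Ok (c.step s e l) := fun l hl => by
  rw [step]
  split_ifs with h
  · exact hs l hl
  · rw [extend]
    split_ifs with h'
    · rw [Function.update_apply]
      split_ifs with hlf
      · subst hlf
        obtain ⟨h1, h2, h3⟩ := hs _ hl
        refine ⟨?_, fun u hu => ?_, by simp; omega⟩
        · rw [List.nodup_append]
          refine ⟨h1, by simp, ?_⟩
          intro a ha b hb hab
          rw [List.mem_singleton] at hb
          subst hab; subst hb
          exact h'.2.2 ha
        · rcases List.mem_append.1 hu with hu | hu
          · exact h2 u hu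
          · rw [List.mem_singleton] at hu
            subst hu
            refine (greedy_ok hc hs le_rfl _ he).2.1 _ ?_
            rw [List.getD_eq_getElem _ _ h'.1]
            exact List.getElem_mem _
      · exact hs l hl
    · exact hs l hl

theorem iter_ok (hc : c.Valid) {s : Fam} (hs : ∀ l < c.k, c.Ok (s l)) {e : ℕ → ℕ}
    (he : ∀ i, e i / c.r < c.k) (t : ℕ) : ∀ l < c.k, c.Ok (c.iter s e t l) := by
  induction t with
  | zero => exact hs
  | succ t ih => exact step_ok hc ih (he t)

/-- The family `κ` is a packing that extends `s`. -/
structure Solution (c : Ctx) (s κ : Fam) : Prop where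
  mem : ∀ l < c.k, κ l ∈ c.LS
  subset : ∀ l < c.k, s l ⊆ κ l
  compat : ∀ l < c.k, ∀ l' < c.k, l ≠ l' → c.Compat (κ l) (κ l')

/-- The blocking entry `t i` precedes `f`, for an entry not yet replaced is a part of `κ i` and
cannot clash with `κ f`. As `t i` is compatible with `s f` but not with `κ f`, it contains an
element of `κ f` outside `s f`. Its position in `t i` is the digit. -/
theorem Solution.exists_step (hc : c.Valid) {s κ : Fam} (h : c.Solution s κ)
    (hs : ∀ l < c.k, (s l).Nodup) (hg : (c.greedy s c.k).1 ≠ 0) :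
    ∃ e < c.r * c.k, c.Solution (c.step s e) κ ∧ (∀ l < c.k, (c.step s e l).Nodup) ∧
      ∑ l ∈ Finset.range c.k, (c.step s e l).length =
        ∑ l ∈ Finset.range c.k, (s l).length + 1 := by
  rcases c.greedy_spec s c.k le_rfl with ⟨h0, -⟩ | ⟨f, hf, h1, h2, h3⟩
  · exact absurd h0 hg
  set t := (c.greedy s c.k).2 with ht
  have hκ : ∀ l < c.k, c.Ok (κ l) := fun l hl => hc.ok _ (h.mem l hl)
  -- Otherwise `κ f` itself would have been eligible.
  obtain ⟨i, hi, hif, hnc⟩ : ∃ i < c.k, i ≠ f ∧ ¬ c.Compat (κ f) (t i) := by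
    by_contra hcon
    push Not at hcon
    exact h3 _ (h.mem f hf) ⟨h.subset f hf, hcon⟩
  have hlt : i < f := by
    by_contra hge
    rw [h2.eq i (by omega)] at hnc
    exact hnc ((h.compat f hf i hi hif.symm).subset hc (hκ f hf) (hκ i hi) (h.subset i hi))
  have hti : c.Ok (t i) := hc.ok _ (h2.mem i hlt)
  have hcf : c.Compat (t i) (s f) := by
    have := h2.compat i hlt f hf hif
    rwa [h2.eq f le_rfl] at this
  obtain ⟨u, hu1, hu2, hu3⟩ := exists_mem_of_not_compat hc hti (hκ f hf) (h.subset f hf)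
    (fun hh => hnc hh.symm) hcf
  obtain ⟨q, hq, rfl⟩ := List.getElem_of_mem hu1
  have hqr : q < c.r := hq.trans_le hti.2.2
  have e1 : (c.r * i + q) % c.r = q := by rw [Nat.mul_add_mod, Nat.mod_eq_of_lt hqr]
  have e2 : (c.r * i + q) / c.r = i := by
    rw [Nat.mul_add_div hc.r_pos, Nat.div_eq_of_lt hqr, add_zero]
  have hnd : (s f ++ [(t i)[q]]).Nodup := by
    rw [List.nodup_append]
    refine ⟨hs f hf, by simp, fun a ha b hb hab => ?_⟩
    rw [List.mem_singleton] at hb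
    subst hab; subst hb
    exact hu3 ha
  have hsub : s f ++ [(t i)[q]] ⊆ κ f := by
    intro x hx
    rcases List.mem_append.1 hx with hx | hx
    · exact h.subset f hf hx
    · rw [List.mem_singleton] at hx; subst hx; exact hu2
  -- The extended list is still inside `κ f`, which has at most `r` elements, so there is room.
  have hlen : (s f).length < c.r := by
    have := (hnd.subperm hsub).length_le
    have := (hκ f hf).2.2
    simp at *
    omega
  have hstep : c.step s (c.r * i + q) = Function.update s f (s f ++ [(t i)[q]]) := by
    rw [step, if_neg hg, ← ht, h1, extend, e1, e2, Nat.add_sub_cancel, List.getD_eq_getElem _ _ hq,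
      if_pos ⟨hq, hlen, hu3⟩]
  refine ⟨c.r * i + q, ?_, ?_⟩
  · calc c.r * i + q < c.r * i + c.r := by omega
      _ = c.r * (i + 1) := by ring
      _ ≤ c.r * c.k := Nat.mul_le_mul_left _ (by omega)
  · rw [hstep]
    refine ⟨⟨h.mem, fun l hl => ?_, h.compat⟩, fun l hl => ?_, ?_⟩
    · by_cases hl' : l = f
      · subst hl'; simpa using hsub
      · simpa [hl'] using h.subset l hl
    · by_cases hl' : l = f
      · subst hl'; simpa using hnd
      · simpa [hl'] using hs l hl
    · have hmem : f ∈ Finset.range c.k := by simpa using hf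
      rw [← Finset.add_sum_erase _ _ hmem, ← Finset.add_sum_erase _ (fun l => (s l).length) hmem]
      have : ∀ l ∈ (Finset.range c.k).erase f,
          (Function.update s f (s f ++ [(t i)[q]]) l).length = (s l).length := fun l hl => by
        rw [Function.update_of_ne (Finset.ne_of_mem_erase hl)]
      rw [Finset.sum_congr rfl this]
      simp
      omega

/-- Suitable digits guide the greedy procedure to a packing. -/
theorem Solution.exists_digits (hc : c.Valid) (hk : 0 < c.k) {κ : Fam} (d : ℕ) {s : Fam} (h : c.Solution s κ)
    (hs : ∀ l < c.k, (s l).Nodup)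
    (hd : c.r * c.k ≤ ∑ l ∈ Finset.range c.k, (s l).length + d) :
    ∃ e : ℕ → ℕ, (∀ i < d, e i < c.r * c.k) ∧ ∃ t ≤ d, (c.greedy (c.iter s e t) c.k).1 = 0 := by
  induction d generalizing s with
  | zero =>
    by_cases hg : (c.greedy s c.k).1 = 0
    · exact ⟨fun _ => 0, by simp, 0, le_rfl, hg⟩
    · obtain ⟨e, -, h1, h2, h3⟩ := h.exists_step hc hs hg
      -- With no digits left, one more addition would push the total size beyond the bound `r * k`
      -- imposed by `κ`.
      have : ∑ l ∈ Finset.range c.k, (c.step s e l).length ≤ ∑ l ∈ Finset.range c.k, c.r :=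
        Finset.sum_le_sum fun l hl => by
          have hl := Finset.mem_range.1 hl
          exact ((h2 l hl).subperm (h1.subset l hl)).length_le.trans (hc.ok _ (h.mem l hl)).2.2
      rw [h3, Finset.sum_const, Finset.card_range, smul_eq_mul, mul_comm] at this
      omega
  | succ d ih =>
    by_cases hg : (c.greedy s c.k).1 = 0
    · exact ⟨fun _ => 0, fun i _ => Nat.mul_pos hc.r_pos hk, 0, by omega, hg⟩
    · obtain ⟨e, he, h1, h2, h3⟩ := h.exists_step hc hs hg
      obtain ⟨e', he', t, ht, h4⟩ := ih h1 h2 (by rw [h3]; omega)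
      refine ⟨fun i => if i = 0 then e else e' (i - 1), fun i hi => ?_, t + 1, by omega, ?_⟩
      · dsimp only
        split_ifs with h0
        · exact he
        · exact he' _ (by omega)
      · rw [iter_succ']
        simpa using h4

/-- The indices describe a packing. -/
def Out (c : Ctx) (idx : ℕ → ℕ) : Prop :=
  ∀ i < c.k, idx i < c.LS.length ∧ (∃ w ∈ c.LC, w ⊆ c.LS.getD (idx i) []) ∧
    ∀ j < c.k, i ≠ j → c.Compat (c.LS.getD (idx i) []) (c.LS.getD (idx j) [])

/-- The cluster heads with the given indices. -/
def headFam (c : Ctx) (d : ℕ → ℕ) : Fam := fun l => c.LC.getD (d l) []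

/-- The sequence is strictly increasing, and the heads have at most `r` elements. -/
def Adm (c : Ctx) (d : ℕ → ℕ) : Prop :=
  (∀ i < c.k, (c.LC.getD (d i) []).length ≤ c.r) ∧ ∀ i, i + 1 < c.k → d i < d (i + 1)

/-- Soundness holds for all digits, good or bad: lists only grow, so each replacement still contains
its head. -/
theorem out_of_greedy {d e : ℕ → ℕ} (hd : ∀ i < c.k, d i < c.LC.length) (t : ℕ)
    (hg : (c.greedy (c.iter (c.headFam d) e t) c.k).1 = 0) {idx : ℕ → ℕ}
    (hidx : ∀ l < c.k, idx l < c.LS.length ∧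
      c.LS.getD (idx l) [] = (c.greedy (c.iter (c.headFam d) e t) c.k).2 l) : c.Out idx := by
  rcases c.greedy_spec (c.iter (c.headFam d) e t) c.k le_rfl with ⟨-, h⟩ | ⟨f, -, h1, -⟩
  · refine fun i hi => ⟨(hidx i hi).1, ⟨c.headFam d i, ?_, ?_⟩, fun j hj hij => ?_⟩
    · rw [headFam, List.getD_eq_getElem _ _ (hd i hi)]
      exact List.getElem_mem _
    · rw [(hidx i hi).2]
      exact List.Subset.trans (subset_iter _ _ _ _) (h.subset i hi)
    · rw [(hidx i hi).2, (hidx j hj).2]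
      exact h.compat i hi j hj hij
  · omega

end Ctx

/-! ### The program -/

/-- Address of set number `e` of the instance. -/
def setPtr (e : Exp) : Exp := .get 2 e

/-- Address of entry `e` in a table of lists of length at most `r`. -/
def tabPtr (r : ℕ) (e : Exp) : Exp := mulC (r + 1) e

/-- Use of the arrays: `0` input, `1` output positions, `2` addresses of all sets and heads, `3`
marks of head elements, `4` working table of the greedy pass, `5` choice of heads, `6` digits, `7`
partial family. A table row has `r + 1` cells, the first for the length. Register `0` is the answer.
-/
def numK : Exp := .get 0 (.const 1)
def numS : Exp := .get 0 (.const 2)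
def numC : Exp := .get 0 (.const 3)

/-- Address of the head with index `e`. -/
def headPtr (e : Exp) : Exp := setPtr (.add numS e)

/-- Compare set `m` (register 14) with entry `l` (register 16) of the table. -/
def checkBody (r : ℕ) : Prog :=
  .ite (eqE (.reg 16) (.reg 12)) .skip
    (.seq (.assign 15 (.add (.reg 15) (someE r 4 (tabPtr r (.reg 16)) fun u =>
        andE (.get 3 u) (memE r u 0 (setPtr (.reg 14))))))
    (.seq (.query 17 0 (setPtr (.reg 14)) 4 (tabPtr r (.reg 16)))
    (.seq (.assign 15 (.add (.reg 15) (.reg 17)))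
    (.seq (.query 17 4 (tabPtr r (.reg 16)) 0 (setPtr (.reg 14)))
      (.assign 15 (.add (.reg 15) (.reg 17)))))))

/-- Register 15 adds up all obstacles to placing the set in register 14 at the entry in register 12;
register 13 records that some set had none. -/
def scanBody (r : ℕ) : Prog :=
  .seq (.assign 15 (someE r 7 (tabPtr r (.reg 12)) fun u => notE (memE r u 0 (setPtr (.reg 14)))))
  (.seq (forTo 16 numK (checkBody r))
    (.ite (.reg 15) .skip (.seq (.assign 13 (.const 1)) (.store 1 (.reg 12) (.reg 14)))))

def scan (r : ℕ) : Prog := .seq (.assign 13 (.const 0)) (forTo 14 numS (scanBody r))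

def greedyBody (r : ℕ) : Prog :=
  .ite (.reg 11) .skip (.seq (scan r)
    (.ite (.reg 13)
      (copyCells 0 (setPtr (.get 1 (.reg 12))) 4 (tabPtr r (.reg 12)) (r + 1))
      (.assign 11 (.add (.reg 12) (.const 1)))))

def copyRow (r : ℕ) : Prog := copyCells 7 (tabPtr r (.reg 12)) 4 (tabPtr r (.reg 12)) (r + 1)

def greedyProg (r : ℕ) : Prog :=
  .seq (.assign 11 (.const 0)) (.seq (forTo 12 numK (copyRow r)) (forTo 12 numK (greedyBody r)))

/-! ### Correctness of the greedy procedure -/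

namespace Ctx

/-- The memory holds the instance, the addresses of its sets, and the membership in heads. -/
structure Env (c : Ctx) (σ : State) : Prop where
  n : σ.arr 0 0 = c.n
  k : σ.arr 0 1 = c.k
  S : σ.arr 0 2 = c.LS.length
  C : σ.arr 0 3 = c.LC.length
  sets : ∀ i < c.LS.length, σ.listAt 0 (σ.arr 2 i) = c.LS.getD i []
  heads : ∀ i < c.LC.length, σ.listAt 0 (σ.arr 2 (c.LS.length + i)) = c.LC.getD i []
  inHead : ∀ u, σ.arr 3 u ≠ 0 ↔ c.InHead u

/-- Array `a` is a table of the lists `t l`. -/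
def Tab (c : Ctx) (σ : State) (a : ℕ) (t : Fam) : Prop :=
  ∀ l < c.k, σ.listAt a ((c.r + 1) * l) = t l

end Ctx

theorem State.listAt_congr {σ σ' : State} {a : ℕ} (h : σ'.arr a = σ.arr a) (p : ℕ) :
    σ'.listAt a p = σ.listAt a p := by simp [State.listAt, h]

open Ctx

variable {c : Ctx}

theorem Ctx.Env.congr {σ σ' : State} (h : c.Env σ) (h0 : σ'.arr 0 = σ.arr 0)
    (h2 : σ'.arr 2 = σ.arr 2) (h3 : σ'.arr 3 = σ.arr 3) : c.Env σ' := by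
  refine ⟨?_, ?_, ?_, ?_, fun i hi => ?_, fun i hi => ?_, fun u => ?_⟩
  · rw [h0, h.n]
  · rw [h0, h.k]
  · rw [h0, h.S]
  · rw [h0, h.C]
  · rw [State.listAt_congr h0, h2, h.sets i hi]
  · rw [State.listAt_congr h0, h2, h.heads i hi]
  · rw [h3, h.inHead u]

theorem Ctx.Tab.congr {σ σ' : State} {a : ℕ} {t : Fam} (h : c.Tab σ a t)
    (ha : σ'.arr a = σ.arr a) : c.Tab σ' a t :=
  fun l hl => by rw [State.listAt_congr ha, h l hl]

theorem Ctx.Env.len_set {σ : State} (h : c.Env σ) {i : ℕ} (hi : i < c.LS.length) :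
    σ.arr 0 (σ.arr 2 i) = (c.LS.getD i []).length := by
  rw [← h.sets i hi, State.length_listAt]

theorem Ctx.Tab.len {σ : State} {a : ℕ} {t : Fam} (h : c.Tab σ a t) {l : ℕ} (hl : l < c.k) :
    σ.arr a ((c.r + 1) * l) = (t l).length := by
  rw [← h l hl, State.length_listAt]

theorem Ctx.Valid.ok_getD (hc : c.Valid) {i : ℕ} (hi : i < c.LS.length) :
    c.Ok (c.LS.getD i []) := by
  rw [List.getD_eq_getElem _ _ hi]
  exact hc.ok _ (List.getElem_mem _)

theorem unitCost_ok {v w : List ℕ} (hv : c.Ok v) (hw : c.Ok w) :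
    unitCost c.r c.α v w (c.α (toSet c.n v) (toSet c.n w)).toNat 1 :=
  ⟨_, _, hv.card_le, hw.card_le, lists_iff.2 ⟨hv.1, hv.2.1, rfl⟩, lists_iff.2 ⟨hw.1, hw.2.1, rfl⟩,
    rfl, rfl⟩

/-- All three obstacles of `Compat` are added to register 15, so it is zero at the end exactly when
it was zero before and none of them is present. -/
theorem runs_checkBody (hc : c.Valid) {σ : State} {t : Fam} (hE : c.Env σ) (hT : c.Tab σ 4 t)
    (ht : ∀ l < c.k, c.Ok (t l)) {l m : ℕ} (h16 : σ.reg 16 = l) (hl : l < c.k)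
    (h14 : σ.reg 14 = m) (hm : m < c.LS.length) :
    Runs (unitCost c.r c.α) (checkBody c.r) σ (checkBody c.r).scost fun σ' =>
      σ'.arr = σ.arr ∧ (∀ y < 17, y ≠ 15 → σ'.reg y = σ.reg y) ∧
      (σ'.reg 15 = 0 ↔ σ.reg 15 = 0 ∧ (l ≠ σ.reg 12 → c.Compat (c.LS.getD m []) (t l))) := by
  have hw := hc.ok_getD hm
  have hv := ht l hl
  have hset : σ.listAt 0 (σ.arr 2 m) = c.LS.getD m [] := hE.sets m hm
  have htab : σ.listAt 4 ((c.r + 1) * l) = t l := hT l hl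
  have hlen4 : σ.arr 4 ((tabPtr c.r (.reg 16)).eval σ) ≤ c.r := by
    simp only [tabPtr, mulC_eval, Exp.eval, h16, hT.len hl]; exact hv.2.2
  have hlen0 : σ.arr 0 ((setPtr (.reg 14)).eval σ) ≤ c.r := by
    simp only [setPtr, Exp.eval, h14, hE.len_set hm]; exact hw.2.2
  have hclash : Holds σ (someE c.r 4 (tabPtr c.r (.reg 16)) fun u =>
      andE (.get 3 u) (memE c.r u 0 (setPtr (.reg 14)))) ↔
      ∃ u ∈ t l, c.InHead u ∧ u ∈ c.LS.getD m [] := by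
    rw [holds_someE (R := fun u => c.InHead u ∧ u ∈ c.LS.getD m []) hlen4]
    · simp only [tabPtr, mulC_eval, Exp.eval, h16, htab]
    · intro e
      rw [holds_andE, holds_memE hlen0]
      simp only [setPtr, Exp.eval, h14, hset, holds_iff, hE.inHead]
  have hq : ∀ τ : State, τ.arr = σ.arr → τ.reg 14 = m → τ.reg 16 = l →
      τ.listAt 0 ((setPtr (.reg 14)).eval τ) = c.LS.getD m [] ∧
      τ.listAt 4 ((tabPtr c.r (.reg 16)).eval τ) = t l := by
    intro τ h1 h2 h3
    simp only [tabPtr, setPtr, mulC_eval, Exp.eval, h2, h3, h1]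
    rw [State.listAt_congr (congrFun h1 0), State.listAt_congr (congrFun h1 4)]
    exact ⟨hset, htab⟩
  refine Runs.ite (fun h => Runs.skip ⟨rfl, fun _ _ _ => rfl, ?_⟩) fun h => ?_
  · rw [← holds_iff, holds_eqE] at h
    simp only [Exp.eval, h16] at h
    simp [h]
  -- In this branch the tested entry differs from the one to be replaced.
  have hne : l ≠ σ.reg 12 := by
    intro hh
    refine absurd h ((holds_iff _).1 ?_)
    simp [h16, hh]
  refine Runs.seq (Runs.assign (Runs.seq (Runs.query (y := (c.α (toSet c.n (c.LS.getD m []))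
    (toSet c.n (t l))).toNat) ?_ (Runs.seq (Runs.assign (Runs.seq (Runs.query
    (y := (c.α (toSet c.n (t l)) (toSet c.n (c.LS.getD m []))).toNat) ?_ (Runs.assign ?_))))))))
  · obtain ⟨e1, e2⟩ := hq (σ.setReg 15 (Exp.eval σ (.add (.reg 15) (someE c.r 4
      (tabPtr c.r (.reg 16)) fun u => andE (.get 3 u) (memE c.r u 0 (setPtr (.reg 14)))))))
      rfl (by simp [h14]) (by simp [h16])
    rw [e1, e2]
    exact unitCost_ok hw hv
  · rw [(hq _ ?_ ?_ ?_).1, (hq _ ?_ ?_ ?_).2]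
    · exact unitCost_ok hv hw
    all_goals first | rfl | simp [h14, h16]
  · refine ⟨rfl, fun y h1 h2 => ?_, ?_⟩
    · simp [h2, show y ≠ 17 by omega]
    · have h3 := not_congr hclash
      rw [holds_iff, not_not] at h3
      simp only [State.setReg_reg, Exp.eval, if_true, if_false, Nat.reduceEqDiff,
        Nat.add_eq_zero_iff, h3, Bool.toNat_eq_zero, ne_eq, hne, not_false_iff, true_implies,
        Compat]
      constructor
      · rintro ⟨⟨⟨h4, h5⟩, h6⟩, h7⟩
        exact ⟨h4, fun u hu hu' hh => h5 ⟨u, hu, hh, hu'⟩, h6, h7⟩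
      · rintro ⟨h4, h5, h6, h7⟩
        exact ⟨⟨⟨h4, fun ⟨u, hu, hh, hu'⟩ => h5 u hu hu' hh⟩, h6⟩, h7⟩

def checkTime (r k : ℕ) : ℕ := k * ((checkBody r).scost + 9) + 7

theorem runs_check (hc : c.Valid) {σ : State} {t : Fam} (hE : c.Env σ) (hT : c.Tab σ 4 t)
    (ht : ∀ l < c.k, c.Ok (t l)) {m : ℕ} (h14 : σ.reg 14 = m) (hm : m < c.LS.length) :
    Runs (unitCost c.r c.α) (forTo 16 numK (checkBody c.r)) σ (checkTime c.r c.k) fun σ' =>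
      σ'.arr = σ.arr ∧ (∀ y < 15, σ'.reg y = σ.reg y) ∧
      (σ'.reg 15 = 0 ↔ σ.reg 15 = 0 ∧
        ∀ l < c.k, l ≠ σ.reg 12 → c.Compat (c.LS.getD m []) (t l)) := by
  refine Runs.forTo c.k _ (fun i σ' => σ'.arr = σ.arr ∧ (∀ y < 15, σ'.reg y = σ.reg y) ∧
      (σ'.reg 15 = 0 ↔ σ.reg 15 = 0 ∧
        ∀ l < i, l ≠ σ.reg 12 → c.Compat (c.LS.getD m []) (t l))) ?_ ?_ ?_ fun σ' h => h
  · exact ⟨rfl, fun y hy => by simp [show y ≠ 16 by omega], by simp⟩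
  · rintro i - σ' ⟨h1, -⟩
    simp [numK, h1, hE.k]
  · rintro i hi σ' hx ⟨h1, h2, h3⟩
    refine Runs.mono (runs_checkBody hc (hE.congr (by rw [h1]) (by rw [h1]) (by rw [h1]))
      (hT.congr (by rw [h1])) ht hx hi (by rw [h2 14 (by omega), h14]) hm) le_rfl ?_
    rintro σ'' ⟨h4, h5, h6⟩
    refine ⟨by rw [h5 16 (by omega) (by omega), hx], by simp [h4, h1], fun y hy => ?_, ?_⟩
    · simp [show y ≠ 16 by omega, h5 y (by omega) (by omega), h2 y hy]
    · simp only [State.setReg_reg, Nat.reduceEqDiff, if_false, h6, h3, h2 12 (by omega)]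
      constructor
      · rintro ⟨⟨h7, h8⟩, h9⟩
        refine ⟨h7, fun l hl => ?_⟩
        rcases Nat.lt_succ_iff_lt_or_eq.1 hl with hl | rfl
        · exact h8 l hl
        · exact h9
      · rintro ⟨h7, h8⟩
        exact ⟨⟨h7, fun l hl => h8 l (by omega)⟩, h8 i (by omega)⟩

theorem runs_scanBody (hc : c.Valid) {σ : State} {s t : Fam} (hE : c.Env σ) (hS : c.Tab σ 7 s)
    (hT : c.Tab σ 4 t) (hs : ∀ l < c.k, c.Ok (s l)) (ht : ∀ l < c.k, c.Ok (t l)) {m : ℕ}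
    (h14 : σ.reg 14 = m) (hm : m < c.LS.length) {j : ℕ} (h12 : σ.reg 12 = j) (hj : j < c.k) :
    Runs (unitCost c.r c.α) (scanBody c.r) σ ((scanBody c.r).scost + checkTime c.r c.k) fun σ' =>
      (∀ a, a ≠ 1 → σ'.arr a = σ.arr a) ∧ (∀ y < 13, σ'.reg y = σ.reg y) ∧ σ'.reg 14 = m ∧
      (c.Good s t j (c.LS.getD m []) → σ'.reg 13 = 1 ∧ σ'.arr 1 = Function.update (σ.arr 1) j m) ∧
      (¬ c.Good s t j (c.LS.getD m []) → σ'.reg 13 = σ.reg 13 ∧ σ'.arr 1 = σ.arr 1) := by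
  have hw := hc.ok_getD hm
  have hlen7 : σ.arr 7 ((tabPtr c.r (.reg 12)).eval σ) ≤ c.r := by
    simp only [tabPtr, mulC_eval, Exp.eval, h12, hS.len hj]; exact (hs j hj).2.2
  have hlen0 : σ.arr 0 ((setPtr (.reg 14)).eval σ) ≤ c.r := by
    simp only [setPtr, Exp.eval, h14, hE.len_set hm]; exact hw.2.2
  have hsub : Holds σ (someE c.r 7 (tabPtr c.r (.reg 12)) fun u =>
      notE (memE c.r u 0 (setPtr (.reg 14)))) ↔ ¬ s j ⊆ c.LS.getD m [] := by
    rw [holds_someE (R := fun u => u ∉ c.LS.getD m []) hlen7]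
    · simp only [tabPtr, mulC_eval, Exp.eval, h12, hS j hj, List.subset_def]
      push Not; rfl
    · intro e
      rw [holds_notE, holds_memE hlen0]
      simp only [setPtr, Exp.eval, h14, hE.sets m hm]
  refine Runs.le (Runs.seq (Runs.assign (Runs.seq (Runs.mono (runs_check (σ := σ.setReg 15 _) hc (t := t) (m := m)
    (hE.congr rfl rfl rfl) (hT.congr rfl) ht (by simp [h14]) hm) le_rfl ?_))))
    (T' := _) (T := _ + (_ + (Prog.ite (.reg 15) .skip
      (.seq (.assign 13 (.const 1)) (.store 1 (.reg 12) (.reg 14)))).scost)) ?_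
  · rintro σ' ⟨h1, h2, h3⟩
    have h3' : σ'.reg 15 = 0 ↔ c.Good s t j (c.LS.getD m []) := by
      rw [h3]
      have h4 := not_congr hsub
      rw [holds_iff, not_not, not_not] at h4
      simp only [State.setReg_reg, if_true, Nat.reduceEqDiff, if_false, h4, h12, Good]
    refine Runs.ite (fun h => Runs.skip ?_) (fun h => Runs.seq (Runs.assign (Runs.store ?_)))
    · simp only [Exp.eval, ne_eq, h3'] at h
      refine ⟨fun a _ => by rw [h1]; rfl, fun y hy => ?_, ?_, fun h' => absurd h' h, fun _ => ?_⟩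
      · rw [h2 y (by omega)]; simp [show y ≠ 15 by omega]
      · rw [h2 14 (by omega)]; simp [h14]
      · rw [h2 13 (by omega), h1]; simp
    · simp only [Exp.eval, h3'] at h
      refine ⟨fun a ha => ?_, fun y hy => ?_, ?_, fun _ => ⟨?_, ?_⟩, fun h' => absurd h h'⟩
      · rw [State.setArr_arr_ne _ _ _ ha]; simp [h1]
      · simp [show y ≠ 13 by omega, show y ≠ 15 by omega, h2 y (by omega)]
      · simp [h2 14 (by omega), h14]
      · simp
      · funext i
        rw [State.setArr_arr_same]
        simp [h1, h2 12 (by omega), h2 14 (by omega), h12, h14, Function.update_apply]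
  · simp only [scanBody, Prog.scost]; omega

def scanTime (r k N : ℕ) : ℕ :=
  2 + (N * ((scanBody r).scost + checkTime r k + 9) + 7)

/-- Every suitable set overwrites the recorded position, so the last one survives, in agreement with
`pick`. -/
theorem runs_scan (hc : c.Valid) {σ : State} {s t : Fam} (hE : c.Env σ) (hS : c.Tab σ 7 s)
    (hT : c.Tab σ 4 t) (hs : ∀ l < c.k, c.Ok (s l)) (ht : ∀ l < c.k, c.Ok (t l))
    {j : ℕ} (h12 : σ.reg 12 = j) (hj : j < c.k) :
    Runs (unitCost c.r c.α) (scan c.r) σ (scanTime c.r c.k c.LS.length) fun σ' =>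
      (∀ a, a ≠ 1 → σ'.arr a = σ.arr a) ∧ (∀ y < 13, σ'.reg y = σ.reg y) ∧
      (∀ i, i ≠ j → σ'.arr 1 i = σ.arr 1 i) ∧
      ((c.pick s t j c.LS.length = none ∧ σ'.reg 13 = 0) ∨
        (c.pick s t j c.LS.length = some (σ'.arr 1 j) ∧ σ'.reg 13 ≠ 0)) := by
  refine Runs.seq (Runs.assign (Runs.forTo c.LS.length _ (fun i σ' =>
      (∀ a, a ≠ 1 → σ'.arr a = σ.arr a) ∧ (∀ y < 13, σ'.reg y = σ.reg y) ∧
      (∀ i, i ≠ j → σ'.arr 1 i = σ.arr 1 i) ∧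
      ((c.pick s t j i = none ∧ σ'.reg 13 = 0) ∨
        (c.pick s t j i = some (σ'.arr 1 j) ∧ σ'.reg 13 ≠ 0))) ?_ ?_ ?_ fun σ' h => h))
  · exact ⟨fun _ _ => rfl, fun y hy => by simp [show y ≠ 14 by omega, show y ≠ 13 by omega],
      fun _ _ => rfl, by simp [pick]⟩
  · rintro i - σ' ⟨h1, -⟩
    simp [numS, h1 0, hE.S]
  · rintro m hm σ' hx ⟨h1, h2, h3, h4⟩
    refine Runs.mono (runs_scanBody hc (hE.congr (h1 _ (by omega)) (h1 _ (by omega))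
      (h1 _ (by omega))) (hS.congr (h1 _ (by omega))) (hT.congr (h1 _ (by omega))) hs ht hx hm
      (by rw [h2 12 (by omega), h12]) hj) le_rfl ?_
    rintro σ'' ⟨h5, h6, h7, h8, h9⟩
    refine ⟨h7, fun a ha => ?_, fun y hy => ?_, fun i hi => ?_, ?_⟩
    · simp [h5 a ha, h1 a ha]
    · simp [show y ≠ 14 by omega, h6 y hy, h2 y hy]
    · by_cases hg : c.Good s t j (c.LS.getD m [])
      · simp [(h8 hg).2, hi, h3 i hi]
      · simp [(h9 hg).2, h3 i hi]
    · rw [pick]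
      by_cases hg : c.Good s t j (c.LS.getD m [])
      · rw [if_pos hg]
        exact Or.inr ⟨by simp [(h8 hg).2], by simp [(h8 hg).1]⟩
      · rw [if_neg hg]
        simpa [(h9 hg).1, (h9 hg).2] using h4

/-- Copying a list into a row of a table. -/
theorem State.listAt_copy {σ σ' : State} {r a b p j : ℕ} (hlen : σ.arr a p ≤ r)
    (h : ∀ q, σ'.arr b q = if (r + 1) * j ≤ q ∧ q < (r + 1) * j + (r + 1) then
      σ.arr a (p + (q - (r + 1) * j)) else σ.arr b q) (l : ℕ)
    (hl : l ≠ j → σ.arr b ((r + 1) * l) ≤ r) :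
    σ'.listAt b ((r + 1) * l) = if l = j then σ.listAt a p else σ.listAt b ((r + 1) * l) := by
  split_ifs with hlj
  · subst hlj
    have h0 : σ'.arr b ((r + 1) * l) = σ.arr a p := by rw [h, if_pos (by omega)]; simp
    simp only [State.listAt, h0]
    refine List.map_congr_left fun i hi => ?_
    rw [List.mem_range] at hi
    rw [h, if_pos (by omega)]
    congr 1; omega
  · have hle := hl hlj
    have hdis : (r + 1) * l + (r + 1) ≤ (r + 1) * j ∨ (r + 1) * j + (r + 1) ≤ (r + 1) * l := by
      rcases lt_or_gt_of_ne hlj with h' | h'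
      · left; exact Nat.mul_le_mul_left (r + 1) h'
      · right; exact Nat.mul_le_mul_left (r + 1) h'
    have h0 : σ'.arr b ((r + 1) * l) = σ.arr b ((r + 1) * l) := by rw [h, if_neg (by omega)]
    simp only [State.listAt, h0]
    refine List.map_congr_left fun i hi => ?_
    rw [List.mem_range] at hi
    rw [h, if_neg (by omega)]

/-- Copy the list at address `e` of array `a` into a row of the table in array `b`. -/
theorem runs_copyCells_row {O : Subroutine} {σ : State} {a b x r p j : ℕ} {e : Exp} (hab : a ≠ b)
    (he : e.StableOn σ b) (hp : e.eval σ = p) (hx : σ.reg x = j) (hlen : σ.arr a p ≤ r)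
    {Q : State → Prop}
    (hQ : ∀ σ' : State, σ'.reg = σ.reg → (∀ d, d ≠ b → σ'.arr d = σ.arr d) →
      (∀ l, (l ≠ j → σ.arr b ((r + 1) * l) ≤ r) → σ'.listAt b ((r + 1) * l) =
        if l = j then σ.listAt a p else σ.listAt b ((r + 1) * l)) → Q σ') :
    Runs O (copyCells a e b (tabPtr r (.reg x)) (r + 1)) σ
      (copyCells a e b (tabPtr r (.reg x)) (r + 1)).scost Q := by
  refine Runs.copyCells hab he (fun σ' h1 _ => by simp [tabPtr, h1]) _ fun σ' h1 h2 h3 => ?_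
  simp only [tabPtr, mulC_eval, Exp.eval, hx, hp] at h3
  exact hQ σ' h1 h2 (State.listAt_copy hlen h3)

/-- Nothing is assumed about the rows from `j` on: array 4 may hold remains of an earlier pass. -/
theorem runs_copyRow {σ : State} {s : Fam} (hS : c.Tab σ 7 s) (hs : ∀ l < c.k, c.Ok (s l))
    {j : ℕ} (h12 : σ.reg 12 = j) (hj : j < c.k) (O : Subroutine)
    (ht : ∀ l < j, σ.listAt 4 ((c.r + 1) * l) = s l) :
    Runs O (copyRow c.r) σ (copyRow c.r).scost fun σ' => σ'.reg = σ.reg ∧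
      (∀ a, a ≠ 4 → σ'.arr a = σ.arr a) ∧ ∀ l < j + 1, σ'.listAt 4 ((c.r + 1) * l) = s l := by
  refine runs_copyCells_row (p := (c.r + 1) * j) (by omega) (fun σ' h1 _ => by simp [tabPtr, h1])
    (by simp [tabPtr, h12]) h12 ?_ fun σ' h1 h2 h3 => ⟨h1, h2, fun l hl => ?_⟩
  · rw [hS.len hj]; exact (hs j hj).2.2
  · rw [h3 l fun hne => ?_]
    · split_ifs with hlj
      · subst hlj; exact hS l hj
      · exact ht l (by omega)
    · rw [← State.length_listAt, ht l (by omega)]; exact (hs l (by omega)).2.2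

def greedyTime (r k N : ℕ) : ℕ :=
  2 + ((k * ((copyRow r).scost + 9) + 7) +
    (k * ((greedyBody r).scost + scanTime r k N + 9) + 7))

theorem runs_greedyBody (hc : c.Valid) {σ : State} {s : Fam} (hE : c.Env σ) (hS : c.Tab σ 7 s)
    (hs : ∀ l < c.k, c.Ok (s l)) {j : ℕ} (hj : j < c.k) (h12 : σ.reg 12 = j)
    (hT : c.Tab σ 4 (c.greedy s j).2) (h11 : σ.reg 11 = (c.greedy s j).1)
    (hidx : (c.greedy s j).1 = 0 → ∀ l < j, σ.arr 1 l < c.LS.length ∧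
        c.LS.getD (σ.arr 1 l) [] = (c.greedy s j).2 l) :
    Runs (unitCost c.r c.α) (greedyBody c.r) σ
      ((greedyBody c.r).scost + scanTime c.r c.k c.LS.length) fun σ' =>
      (∀ a, a ≠ 1 → a ≠ 4 → σ'.arr a = σ.arr a) ∧ (∀ y < 13, y ≠ 11 → σ'.reg y = σ.reg y) ∧
      c.Tab σ' 4 (c.greedy s (j + 1)).2 ∧ σ'.reg 11 = (c.greedy s (j + 1)).1 ∧
      ((c.greedy s (j + 1)).1 = 0 → ∀ l < j + 1, σ'.arr 1 l < c.LS.length ∧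
        c.LS.getD (σ'.arr 1 l) [] = (c.greedy s (j + 1)).2 l) := by
  have hok := greedy_ok hc hs hj.le
  refine Runs.le (Runs.ite (T := 1) (T' := scanTime c.r c.k c.LS.length +
    (Prog.ite (.reg 13)
      (copyCells 0 (setPtr (.get 1 (.reg 12))) 4 (tabPtr c.r (.reg 12)) (c.r + 1))
      (.assign 11 (.add (.reg 12) (.const 1)))).scost) (fun h => Runs.skip ?_) fun h => ?_)
    (by simp only [greedyBody, Prog.scost]; omega)
  · simp only [Exp.eval, h11] at h
    rw [greedy, if_neg h]
    exact ⟨fun _ _ _ => rfl, fun _ _ _ => rfl, hT, h11, fun h' => absurd h' h⟩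
  · simp only [Exp.eval, h11] at h
    refine Runs.seq (Runs.mono (runs_scan hc hE hS hT hs hok h12 hj) le_rfl ?_)
    rintro σ' ⟨h1, h2, h3, h4⟩
    have h12' : σ'.reg 12 = j := by rw [h2 12 (by omega), h12]
    refine Runs.ite (fun h5 => ?_) fun h5 => Runs.assign ?_
    · obtain ⟨h6, -⟩ := h4.resolve_left fun h6 => h5 h6.2
      have hm := (c.pick_eq_some h6).1
      have hE' : c.Env σ' := hE.congr (h1 _ (by omega)) (h1 _ (by omega)) (h1 _ (by omega))
      have hg : c.greedy s (j + 1) =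
          (0, Function.update (c.greedy s j).2 j (c.LS.getD (σ'.arr 1 j) [])) := by
        simp only [greedy, h, if_true, h6]
      refine runs_copyCells_row (p := σ'.arr 2 (σ'.arr 1 j)) (by omega)
        (fun τ h7 h8 => by simp [setPtr, h7, h8]) (by simp [setPtr, h12']) h12' ?_
        fun τ h7 h8 h9 => ?_
      · rw [hE'.len_set hm]; exact (hc.ok_getD hm).2.2
      · rw [hg]
        refine ⟨fun a ha ha' => by rw [h8 a ha', h1 a ha], fun y hy _ => by rw [h7, h2 y hy],
          fun l hl => ?_, ?_, fun _ l hl => ?_⟩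
        · rw [h9 l fun _ => ?_, hE'.sets _ hm]; dsimp only; rw [Function.update_apply]
          · refine if_congr Iff.rfl rfl ?_
            rw [State.listAt_congr (h1 4 (by omega)), hT l hl]
          · rw [h1 4 (by omega), hT.len hl]; exact (hok l hl).2.2
        · rw [h7, h2 11 (by omega), h11, h]
        · rw [h8 1 (by omega)]
          by_cases hlj : l = j
          · subst hlj; simp [hm]
          · simpa [hlj, h3 l hlj] using hidx h l (by omega)
    · simp only [Exp.eval] at h5
      obtain ⟨h6, -⟩ := h4.resolve_right fun h6 => h6.2 h5
      have hg : c.greedy s (j + 1) = (j + 1, (c.greedy s j).2) := by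
        simp only [greedy, h, if_true, h6]
      rw [hg]
      refine ⟨fun a ha _ => h1 a ha, fun y hy hy' => by simp [hy', h2 y hy],
        hT.congr (h1 4 (by omega)), by simp [h12'], fun h7 => by simp at h7⟩

theorem runs_greedy (hc : c.Valid) {σ : State} {s : Fam} (hE : c.Env σ) (hS : c.Tab σ 7 s)
    (hs : ∀ l < c.k, c.Ok (s l)) :
    Runs (unitCost c.r c.α) (greedyProg c.r) σ (greedyTime c.r c.k c.LS.length) fun σ' =>
      (∀ a, a ≠ 1 → a ≠ 4 → σ'.arr a = σ.arr a) ∧ (∀ y < 11, σ'.reg y = σ.reg y) ∧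
      c.Tab σ' 4 (c.greedy s c.k).2 ∧ σ'.reg 11 = (c.greedy s c.k).1 ∧
      ((c.greedy s c.k).1 = 0 → ∀ l < c.k, σ'.arr 1 l < c.LS.length ∧
        c.LS.getD (σ'.arr 1 l) [] = (c.greedy s c.k).2 l) := by
  refine Runs.seq (Runs.assign (Runs.seq (Runs.forTo c.k _ (fun j σ' =>
    (∀ a, a ≠ 4 → σ'.arr a = σ.arr a) ∧ (∀ y < 11, σ'.reg y = σ.reg y) ∧ σ'.reg 11 = 0 ∧
    ∀ l < j, σ'.listAt 4 ((c.r + 1) * l) = s l) ?_ ?_ ?_ ?_)))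
  · exact ⟨fun _ _ => rfl, fun y hy => by simp [show y ≠ 12 by omega, show y ≠ 11 by omega],
      by simp, by simp⟩
  · rintro i - σ' ⟨h1, -⟩
    simp [numK, h1 0, hE.k]
  · rintro j hj σ' hx ⟨h1, h2, h3, h4⟩
    refine Runs.mono (runs_copyRow (hS.congr (h1 7 (by omega))) hs hx hj _ h4) le_rfl ?_
    rintro σ'' ⟨h5, h6, h7⟩
    refine ⟨by rw [h5, hx], fun a ha => ?_, fun y hy => ?_, ?_, h7⟩
    · simp [h6 a ha, h1 a ha]
    · simp [show y ≠ 12 by omega, h5, h2 y hy]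
    · simp [h5, h3]
  rintro σ₁ ⟨h1, h2, h3, h4⟩
  refine Runs.forTo c.k _ (fun j σ' =>
      (∀ a, a ≠ 1 → a ≠ 4 → σ'.arr a = σ.arr a) ∧ (∀ y < 11, σ'.reg y = σ.reg y) ∧
      c.Tab σ' 4 (c.greedy s j).2 ∧ σ'.reg 11 = (c.greedy s j).1 ∧
      ((c.greedy s j).1 = 0 → ∀ l < j, σ'.arr 1 l < c.LS.length ∧
        c.LS.getD (σ'.arr 1 l) [] = (c.greedy s j).2 l)) ?_ ?_ ?_ fun σ' h => h
  · exact ⟨fun a _ ha => by simp [h1 a ha], fun y hy => by simp [show y ≠ 12 by omega, h2 y hy],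
      h4, h3, by simp⟩
  · rintro i - σ' ⟨h5, -⟩
    simp [numK, h5 0, hE.k]
  · rintro j hj σ' hx ⟨h5, h6, h7, h8, h9⟩
    refine Runs.mono (runs_greedyBody hc (hE.congr (h5 _ (by omega) (by omega))
      (h5 _ (by omega) (by omega)) (h5 _ (by omega) (by omega)))
      (hS.congr (h5 _ (by omega) (by omega))) hs hj hx h7 h8 h9) le_rfl ?_
    rintro σ'' ⟨h10, h11, h12, h13, h14⟩
    refine ⟨by rw [h11 12 (by omega) (by omega), hx], fun a ha ha' => ?_, fun y hy => ?_,
      h12.congr rfl, by simpa using h13, h14⟩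
    · simp [h10 a ha ha', h5 a ha ha']
    · simp [show y ≠ 12 by omega, h11 y (by omega) (by omega), h6 y hy]

/-! ### Rounds of the greedy procedure -/

/-- The row of the entry that could not be replaced. -/
def failPtr (r : ℕ) : Exp := tabPtr r (.sub (.reg 11) (.const 1))

/-- Append register 15 to the entry that could not be replaced. -/
def extendProg (r : ℕ) : Prog :=
  .ite (andE (ltE (.reg 13) (.get 4 (tabPtr r (.reg 14))))
      (andE (ltE (.get 7 (failPtr r)) (.const r)) (notE (memE r (.reg 15) 7 (failPtr r)))))
    (.seq (.store 7 (.add (.add (failPtr r) (.const 1)) (.get 7 (failPtr r))) (.reg 15))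
      (.store 7 (failPtr r) (.add (.get 7 (failPtr r)) (.const 1))))
    .skip

/-- Divide register 13 by `r`; the quotient is in register 14, the remainder in register 13. -/
def divide (r : ℕ) : Prog :=
  -- The loop condition is nonzero exactly when register 13 is at least `r`, provided `r` is
  -- positive.
  .seq (.assign 14 (.const 0)) (.loop (.sub (.reg 13) (.const (r - 1)))
    (.seq (.assign 13 (.sub (.reg 13) (.const r))) (.assign 14 (.add (.reg 14) (.const 1)))))

def round (r : ℕ) : Prog :=
  .seq (greedyProg r) (.ite (.reg 11)
    (.seq (.assign 13 (.get 6 (.reg 10))) (.seq (divide r)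
      (.seq (.assign 15 (entry 4 (tabPtr r (.reg 14)) (.reg 13))) (extendProg r))))
    (.assign 0 (.const 1)))

def roundBody (r : ℕ) : Prog := .ite (.reg 0) .skip (round r)

/-- One round more than there are digits: the last pass tests the family after all additions. On
failure it reads one digit past the end, which is `0`. -/
def rounds (r : ℕ) : Prog :=
  forTo 10 (.add (mulC (r - 1) numK) (.const 1)) (roundBody r)

/-- Copy a head into the table of array 7. -/
def initBody (r : ℕ) : Prog :=
  copyCells 0 (headPtr (.get 5 (.reg 8))) 7 (tabPtr r (.reg 8)) (r + 1)

def run (r : ℕ) : Prog := .seq (forTo 8 numK (initBody r)) (rounds r)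

theorem State.getD_listAt {σ : State} {a p q : ℕ} (hq : q < σ.arr a p) :
    (σ.listAt a p).getD q 0 = σ.arr a (p + 1 + q) := by
  simp [State.listAt, hq]

/-- Appending to a row of a table. -/
theorem State.listAt_push {σ σ' : State} {r a j u : ℕ} (hlen : σ.arr a ((r + 1) * j) < r)
    (h : ∀ q, σ'.arr a q = if q = (r + 1) * j then σ.arr a ((r + 1) * j) + 1 else
      if q = (r + 1) * j + 1 + σ.arr a ((r + 1) * j) then u else σ.arr a q) (l : ℕ)
    (hl : l ≠ j → σ.arr a ((r + 1) * l) ≤ r) :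
    σ'.listAt a ((r + 1) * l) =
      if l = j then σ.listAt a ((r + 1) * j) ++ [u] else σ.listAt a ((r + 1) * l) := by
  split_ifs with hlj
  · subst hlj
    have h0 : σ'.arr a ((r + 1) * l) = σ.arr a ((r + 1) * l) + 1 := by rw [h, if_pos rfl]
    simp only [State.listAt, h0, List.range_succ, List.map_append, List.map_cons, List.map_nil]
    congr 1
    · refine List.map_congr_left fun i hi => ?_
      rw [List.mem_range] at hi
      rw [h, if_neg (by omega), if_neg (by omega)]
    · rw [h, if_neg (by omega), if_pos rfl]
  · have hle := hl hlj
    have hdis : (r + 1) * l + (r + 1) ≤ (r + 1) * j ∨ (r + 1) * j + (r + 1) ≤ (r + 1) * l := by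
      rcases lt_or_gt_of_ne hlj with h' | h'
      · left; exact Nat.mul_le_mul_left (r + 1) h'
      · right; exact Nat.mul_le_mul_left (r + 1) h'
    have h0 : σ'.arr a ((r + 1) * l) = σ.arr a ((r + 1) * l) := by
      rw [h, if_neg (by omega), if_neg (by omega)]
    simp only [State.listAt, h0]
    refine List.map_congr_left fun i hi => ?_
    rw [List.mem_range] at hi
    rw [h, if_neg (by omega), if_neg (by omega)]

theorem runs_extendProg {O : Subroutine} {σ : State} {s t : Fam} (hT : c.Tab σ 4 t)
    (hS : c.Tab σ 7 s) (hs : ∀ l < c.k, c.Ok (s l)) {f e : ℕ}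
    (h11 : σ.reg 11 = f + 1) (hf : f < c.k) (h13 : σ.reg 13 = e % c.r) (h14 : σ.reg 14 = e / c.r)
    (he : e / c.r < c.k) (h15 : σ.reg 15 = σ.arr 4 ((c.r + 1) * (e / c.r) + 1 + e % c.r)) :
    Runs O (extendProg c.r) σ (extendProg c.r).scost fun σ' =>
      σ'.reg = σ.reg ∧ (∀ a, a ≠ 7 → σ'.arr a = σ.arr a) ∧ c.Tab σ' 7 (c.extend s t f e) := by
  have hlen := hS.len hf
  have hfp : ∀ τ : State, τ.reg = σ.reg → (failPtr c.r).eval τ = (c.r + 1) * f := fun τ hτ => by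
    simp [failPtr, tabPtr, hτ, h11]
  have hfσ := hfp σ rfl
  have hcond : Holds σ (andE (ltE (.reg 13) (.get 4 (tabPtr c.r (.reg 14))))
      (andE (ltE (.get 7 (failPtr c.r)) (.const c.r)) (notE (memE c.r (.reg 15) 7 (failPtr c.r))))) ↔
      (e % c.r < (t (e / c.r)).length ∧ (s f).length < c.r ∧
        (t (e / c.r)).getD (e % c.r) 0 ∉ s f) := by
    rw [holds_andE, holds_andE, holds_notE, holds_ltE, holds_ltE, holds_memE (by
      rw [hfσ, hlen]; exact (hs f hf).2.2)]
    simp only [Exp.eval, tabPtr, mulC_eval, h13, h14, hT.len he, hfσ, hlen, hS f hf, h15]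
    refine and_congr_right fun hq => and_congr_right fun _ => not_congr ?_
    rw [← hT _ he, State.getD_listAt (by rwa [hT.len he])]
  refine Runs.ite (fun h => Runs.seq (Runs.store (Runs.store ?_))) (fun h => Runs.skip ?_)
  · have hh := hcond.1 h
    refine ⟨rfl, fun a ha => by rw [State.setArr_arr_ne _ _ _ ha, State.setArr_arr_ne _ _ _ ha],
      fun l hl => ?_⟩
    rw [extend, if_pos hh, State.listAt_push (σ := σ) (j := f) (u := σ.reg 15)]
    · rw [Function.update_apply, hS f hf, hS l hl, h15, ← State.getD_listAt (by
        rw [hT.len he]; exact hh.1), hT _ he]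
    · rw [hlen]; exact hh.2.1
    · intro q
      have h2 := hfp (σ.setArr 7 ((c.r + 1) * f + 1 + (s f).length) (σ.reg 15)) rfl
      simp only [Exp.eval, hfσ, hlen, h2, State.setArr_arr_same,
        show (c.r + 1) * f ≠ (c.r + 1) * f + 1 + (s f).length by omega, if_false]
    · intro _; rw [hS.len hl]; exact (hs l hl).2.2
  · have hh := (not_congr hcond).1 (by rw [holds_iff, not_not]; exact h)
    exact ⟨rfl, fun _ _ => rfl, by rwa [extend, if_neg hh]⟩

def divideTime (k : ℕ) : ℕ := 2 + (k * 12 + 4)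

/-- Division is repeated subtraction; it takes `e / r < k` rounds, which is cheap next to a greedy
pass. -/
theorem runs_divide {O : Subroutine} {σ : State} {r k e : ℕ} (hr : 0 < r) (h13 : σ.reg 13 = e)
    (he : e / r < k) :
    Runs O (divide r) σ (divideTime k) fun σ' => σ'.arr = σ.arr ∧ (∀ y < 13, σ'.reg y = σ.reg y) ∧
      σ'.reg 13 = e % r ∧ σ'.reg 14 = e / r := by
  refine Runs.le (Runs.seq (Runs.assign (Runs.mono (Runs.loop (e / r) (fun _ => 8) (fun i σ' =>
    σ'.arr = σ.arr ∧ (∀ y < 13, σ'.reg y = σ.reg y) ∧ σ'.reg 13 = e - r * i ∧ σ'.reg 14 = i)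
    ?_ ?_ ?_ ?_) le_rfl ?_))) (T' := _) ?_
  · exact ⟨rfl, fun y hy => by simp [show y ≠ 14 by omega], by simp [h13], by simp⟩
  · rintro i hi σ' ⟨-, -, h1, -⟩
    have : r * (i + 1) ≤ e := (Nat.mul_le_mul_left r hi).trans (Nat.mul_div_le e r)
    rw [mul_add] at this
    simp only [Exp.eval, h1]
    omega
  · rintro σ' ⟨-, -, h1, -⟩
    have h2 := Nat.div_add_mod e r
    have h3 := Nat.mod_lt e hr
    simp only [Exp.eval, h1]
    omega
  · rintro i hi σ' ⟨h1, h2, h3, h4⟩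
    refine Runs.le (Runs.seq (Runs.assign (Runs.assign
      ⟨h1, fun y hy => ?_, ?_, by simp [h4]⟩))) (by simp [Exp.cost])
    · simp [show y ≠ 13 by omega, show y ≠ 14 by omega, h2 y hy]
    · simp [h3, mul_add, Nat.sub_sub]
  · rintro σ' ⟨h1, h2, h3, h4⟩
    exact ⟨h1, h2, by rw [h3]; have := Nat.div_add_mod e r; omega, h4⟩
  · simp [divideTime, Exp.cost]
    omega

def roundTime (r k N : ℕ) : ℕ := (roundBody r).scost + greedyTime r k N + divideTime k

theorem runs_round (hc : c.Valid) {σ : State} {s : Fam} (hE : c.Env σ) (hS : c.Tab σ 7 s)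
    (hs : ∀ l < c.k, c.Ok (s l)) {e : ℕ} (he : σ.arr 6 (σ.reg 10) = e) (hek : e / c.r < c.k)
    (h0 : σ.reg 0 = 0) :
    Runs (unitCost c.r c.α) (round c.r) σ
      ((round c.r).scost + greedyTime c.r c.k c.LS.length + divideTime c.k) fun σ' =>
      (∀ a, a ≠ 1 → a ≠ 4 → a ≠ 7 → σ'.arr a = σ.arr a) ∧
      (∀ y < 11, y ≠ 0 → σ'.reg y = σ.reg y) ∧
      (((c.greedy s c.k).1 = 0 ∧ σ'.reg 0 = 1 ∧ ∀ l < c.k, σ'.arr 1 l < c.LS.length ∧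
        c.LS.getD (σ'.arr 1 l) [] = (c.greedy s c.k).2 l) ∨
      ((c.greedy s c.k).1 ≠ 0 ∧ σ'.reg 0 = 0 ∧ c.Tab σ' 7 (c.step s e))) := by
  refine Runs.le (Runs.seq (Runs.mono (runs_greedy hc hE hS hs) le_rfl ?_))
    (T' := _) (T := _ + ((Exp.reg 11).cost + 1 + (((Exp.get 6 (.reg 10)).cost + 1 + (divideTime c.k
      + ((Prog.assign 15 (entry 4 (tabPtr c.r (.reg 14)) (.reg 13))).scost +
        (extendProg c.r).scost))) +
      (Prog.assign 0 (.const 1)).scost))) ?_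
  · rintro σ₁ ⟨h1, h2, h3, h4, h5⟩
    refine Runs.ite (fun h => Runs.seq (Runs.assign (Runs.seq (Runs.mono
      (runs_divide (e := e) hc.r_pos ?_ hek) le_rfl ?_)))) (fun h => Runs.assign ?_)
    · simp [h1 6, h2 10, he]
    · rintro σ₂ ⟨h6, h7, h8, h9⟩
      simp only [Exp.eval, h4] at h
      obtain ⟨f, hf, hf1⟩ : ∃ f < c.k, (c.greedy s c.k).1 = f + 1 := by
        rcases c.greedy_spec s c.k le_rfl with ⟨h0, -⟩ | ⟨f, hf, h1, -⟩
        · exact absurd h0 h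
        · exact ⟨f, hf, h1⟩
      have harr : ∀ a, a ≠ 1 → a ≠ 4 → σ₂.arr a = σ.arr a := fun a ha ha' => by
        rw [h6]; simp [h1 a ha ha']
      refine Runs.seq (Runs.assign (Runs.mono (runs_extendProg (t := (c.greedy s c.k).2) (s := s)
        (f := f) (e := e) (h3.congr (by simp [h6])) (hS.congr ?_) hs ?_ hf ?_ ?_ hek ?_) le_rfl ?_))
      · simp [harr 7]
      · simp [h7 11, h4, hf1]
      · simp [h8]
      · simp [h9]
      · simp [entry, tabPtr, h8, h9]
      · rintro σ₃ ⟨h10, h11, h12⟩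
        refine ⟨fun a ha ha' ha'' => ?_, fun y hy hy' => ?_, Or.inr ⟨h, ?_, ?_⟩⟩
        · rw [h11 a ha'', State.setReg_arr, harr a ha ha']
        · rw [h10]
          simp [show y ≠ 15 by omega, h7 y (by omega), show y ≠ 13 by omega, h2 y hy]
        · rw [h10]
          simp [h7 0, h2 0, h0]
        · rwa [step, if_neg h, hf1, Nat.add_sub_cancel]
    · simp only [Exp.eval, h4] at h
      exact ⟨fun a ha ha' _ => by simp [h1 a ha ha'], fun y hy hy' => by simp [hy', h2 y hy],
        Or.inl ⟨h, by simp, h5 h⟩⟩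
  · simp only [round, divide, Prog.scost]
    omega

/-- The program has found a packing. -/
def Ctx.Found (c : Ctx) (σ : State) : Prop := σ.reg 0 = 1 ∧ c.Out (σ.arr 1)

theorem Ctx.Found.congr {σ σ' : State} (h : c.Found σ) (h0 : σ'.reg 0 = σ.reg 0)
    (h1 : σ'.arr 1 = σ.arr 1) : c.Found σ' := ⟨by rw [h0, h.1], by rw [h1]; exact h.2⟩

/-- The number of digits that guide the greedy procedure. -/
def Ctx.digits (c : Ctx) : ℕ := (c.r - 1) * c.k

def roundsTime (r k N : ℕ) : ℕ :=
  ((r - 1) * k + 1) * (roundTime r k N + (Exp.add (mulC (r - 1) numK) (.const 1)).cost + 7) +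
    (Exp.add (mulC (r - 1) numK) (.const 1)).cost + 5

/-- Success is permanent: once register 0 is set, all later rounds are skipped and the output array
stays untouched. Without success, every prefix of the digits has led to a failed pass. -/
theorem runs_rounds (hc : c.Valid) {σ : State} (hE : c.Env σ) {d e : ℕ → ℕ}
    (hd : ∀ i < c.k, d i < c.LC.length) (hok : ∀ l < c.k, c.Ok (c.headFam d l))
    (he : σ.arr 6 = e) (hek : ∀ i, e i / c.r < c.k) (hS : c.Tab σ 7 (c.headFam d))
    (hfound : c.Found σ ∨ σ.reg 0 = 0) :
    Runs (unitCost c.r c.α) (rounds c.r) σ (roundsTime c.r c.k c.LS.length) fun σ' =>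
      (∀ a, a ≠ 1 → a ≠ 4 → a ≠ 7 → σ'.arr a = σ.arr a) ∧
      (∀ y < 10, y ≠ 0 → σ'.reg y = σ.reg y) ∧
      (c.Found σ' ∨ (σ.reg 0 = 0 ∧ σ'.reg 0 = 0 ∧
        ∀ t ≤ c.digits, (c.greedy (c.iter (c.headFam d) e t) c.k).1 ≠ 0)) := by
  refine Runs.forTo (c.digits + 1) _ (fun i σ' =>
      (∀ a, a ≠ 1 → a ≠ 4 → a ≠ 7 → σ'.arr a = σ.arr a) ∧
      (∀ y < 10, y ≠ 0 → σ'.reg y = σ.reg y) ∧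
      (c.Found σ' ∨ (σ.reg 0 = 0 ∧ σ'.reg 0 = 0 ∧ c.Tab σ' 7 (c.iter (c.headFam d) e i) ∧
        ∀ t < i, (c.greedy (c.iter (c.headFam d) e t) c.k).1 ≠ 0))) ?_ ?_ ?_ ?_
  · refine ⟨fun _ _ _ _ => rfl, fun y hy _ => by simp [show y ≠ 10 by omega], ?_⟩
    exact hfound.imp (fun h => h.congr (by simp) rfl) fun h => ⟨h, by simpa using h, hS, by simp⟩
  · rintro i - σ' ⟨h1, -⟩
    simp [numK, h1 0, hE.k, digits]
  · rintro i hi σ' hx ⟨h1, h2, h3⟩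
    refine Runs.le (Runs.ite (T' := (round c.r).scost + greedyTime c.r c.k c.LS.length +
      divideTime c.k) (fun h => Runs.skip ?_) fun h => ?_) (T' := roundTime _ _ _) ?_
    · have hF : c.Found σ' := h3.resolve_right fun h' => h h'.2.1
      exact ⟨hx, h1, fun y hy hy' => by simp [show y ≠ 10 by omega, h2 y hy hy'],
        Or.inl (hF.congr (by simp) rfl)⟩
    · simp only [Exp.eval] at h
      obtain ⟨hz, -, h4, h5⟩ := h3.resolve_left fun h' => by have := h'.1; omega
      refine Runs.mono (runs_round (e := e i) hc (hE.congr (h1 _ (by omega) (by omega) (by omega))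
        (h1 _ (by omega) (by omega) (by omega)) (h1 _ (by omega) (by omega) (by omega))) h4
        (iter_ok hc hok hek i) (by rw [h1 6 (by omega) (by omega) (by omega), he, hx]) (hek i) h)
        le_rfl ?_
      rintro σ'' ⟨h6, h7, h8⟩
      refine ⟨by rw [h7 10 (by omega) (by omega), hx], fun a ha ha' ha'' => ?_,
        fun y hy hy' => ?_, ?_⟩
      · simp [h6 a ha ha' ha'', h1 a ha ha' ha'']
      · simp [show y ≠ 10 by omega, h7 y (by omega) hy', h2 y hy hy']
      · rcases h8 with ⟨h9, h10, h11⟩ | ⟨h9, h10, h11⟩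
        · exact Or.inl ⟨by simpa using h10, out_of_greedy hd i h9 h11⟩
        · refine Or.inr ⟨hz, by simpa using h10, h11, fun t ht => ?_⟩
          rcases Nat.lt_succ_iff_lt_or_eq.1 ht with ht | rfl
          · exact h5 t ht
          · exact h9
    · simp only [roundTime, roundBody, Prog.scost]; omega
  · rintro σ' ⟨h1, h2, h3⟩
    exact ⟨h1, h2, h3.imp id fun h => ⟨h.1, h.2.1, fun t ht => h.2.2.2 t (by omega)⟩⟩

def runTime (r k N : ℕ) : ℕ := (k * ((initBody r).scost + 9) + 7) + roundsTime r k N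

theorem Ctx.Adm.ok (hc : c.Valid) {d : ℕ → ℕ} (h : c.Adm d) (hd : ∀ i < c.k, d i < c.LC.length) :
    ∀ l < c.k, c.Ok (c.headFam d l) := fun l hl => by
  have hmem : c.headFam d l ∈ c.LC := by
    rw [headFam, List.getD_eq_getElem _ _ (hd l hl)]
    exact List.getElem_mem _
  exact ⟨hc.nodup _ hmem, hc.lt _ hmem, h.1 l hl⟩

theorem runs_run (hc : c.Valid) {σ : State} (hE : c.Env σ) {d e : ℕ → ℕ}
    (hd : ∀ i < c.k, d i < c.LC.length) (hadm : c.Adm d) (hd5 : σ.arr 5 = d)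
    (he : σ.arr 6 = e) (hek : ∀ i, e i / c.r < c.k) (hfound : c.Found σ ∨ σ.reg 0 = 0) :
    Runs (unitCost c.r c.α) (run c.r) σ (runTime c.r c.k c.LS.length) fun σ' =>
      (∀ a, a ≠ 1 → a ≠ 4 → a ≠ 7 → σ'.arr a = σ.arr a) ∧
      (∀ y < 8, y ≠ 0 → σ'.reg y = σ.reg y) ∧
      (c.Found σ' ∨ (σ.reg 0 = 0 ∧ σ'.reg 0 = 0 ∧
        ∀ t ≤ c.digits, (c.greedy (c.iter (c.headFam d) e t) c.k).1 ≠ 0)) := by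
  have hok := hadm.ok hc hd
  refine Runs.seq (Runs.forTo c.k _ (fun j σ' =>
    (∀ a, a ≠ 7 → σ'.arr a = σ.arr a) ∧ (∀ y < 8, σ'.reg y = σ.reg y) ∧
    ∀ l < j, σ'.listAt 7 ((c.r + 1) * l) = c.headFam d l) ?_ ?_ ?_ ?_)
  · exact ⟨fun _ _ => rfl, fun y hy => by simp [show y ≠ 8 by omega], by simp⟩
  · rintro i - σ' ⟨h1, -⟩
    simp [numK, h1 0, hE.k]
  · rintro j hj σ' hx ⟨h1, h2, h3⟩
    have hE' : c.Env σ' := hE.congr (h1 _ (by omega)) (h1 _ (by omega)) (h1 _ (by omega))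
    have hl := hE'.heads _ (hd j hj)
    refine runs_copyCells_row (p := σ'.arr 2 (c.LS.length + d j)) (by omega)
      (fun τ h7 h8 => by simp [headPtr, setPtr, numS, h7, h8])
      (by simp [headPtr, setPtr, numS, hE'.S, hx, h1 5, hd5]) hx ?_ fun τ h7 h8 h9 => ?_
    · rw [← State.length_listAt, hl]; exact (hok j hj).2.2
    · refine ⟨by rw [h7, hx], fun a ha => by simp [h8 a ha, h1 a ha], fun y hy => ?_,
        fun l hlj => ?_⟩
      · simp [show y ≠ 8 by omega, h7, h2 y hy]
      · refine (h9 l fun hne => ?_).trans ?_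
        rotate_left
        · split_ifs with h
          · rw [hl, h]; rfl
          · exact h3 l (by omega)
        · rw [← State.length_listAt, h3 l (by omega)]; exact (hok l (by omega)).2.2
  · rintro σ' ⟨h1, h2, h3⟩
    refine Runs.mono (runs_rounds hc (hE.congr (h1 _ (by omega)) (h1 _ (by omega))
      (h1 _ (by omega))) hd hok (by rw [h1 6 (by omega), he]) hek h3
      (hfound.imp (fun h => h.congr (h2 0 (by omega)) (h1 1 (by omega)))
        fun h => by rw [h2 0 (by omega), h])) le_rfl ?_
    rintro σ'' ⟨h4, h5, h6⟩
    exact ⟨fun a ha ha' ha'' => by rw [h4 a ha ha' ha'', h1 a ha''],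
      fun y hy hy' => by rw [h5 y (by omega) hy', h2 y hy],
      h6.imp id fun h => ⟨by rw [← h2 0 (by omega), h.1], h.2⟩⟩

/-! ### Enumeration of heads and digits -/

def search (r : ℕ) : Prog := odometer 6 6 7 (mulC r numK) (mulC (r - 1) numK) (run r)

/-- Register 5 is `0` if and only if the choice of heads is admissible. -/
def headCheckBody (r : ℕ) : Prog :=
  .assign 5 (.add (.reg 5) (.add (ltE (.const r) (.get 0 (headPtr (.get 5 (.reg 4)))))
    (andE (ltE (.add (.reg 4) (.const 1)) numK)
      (notE (ltE (.get 5 (.reg 4)) (.get 5 (.add (.reg 4) (.const 1))))))))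

def headCheck (r : ℕ) : Prog := .seq (.assign 5 (.const 0)) (forTo 4 numK (headCheckBody r))

/-- Inadmissible choices are discarded before the costly search; this is what gains the factor `k!`.
-/
def tryHeads (r : ℕ) : Prog := .seq (headCheck r) (.ite (.reg 5) .skip (search r))

def searchHeads (r : ℕ) : Prog := odometer 5 2 3 numC numK (tryHeads r)

/-- No packing extends the choice of heads. -/
def Ctx.NoSolution (c : Ctx) (d : ℕ → ℕ) : Prop := ∀ κ : Fam, ¬ c.Solution (c.headFam d) κ

/-- Completeness: a solution would supply digits that lead to a successful pass, and the odometer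
visits every digit sequence. -/
theorem Ctx.noSolution_of_forall (hc : c.Valid) (hk : 0 < c.k) {d : ℕ → ℕ}
    (hd : ∀ i < c.k, d i < c.LC.length)
    (h : ∀ v < (c.r * c.k) ^ c.digits, ∀ t ≤ c.digits,
      (c.greedy (c.iter (c.headFam d) (dig (c.r * c.k) c.digits v) t) c.k).1 ≠ 0) :
    c.NoSolution d := by
  intro κ hκ
  have hmem : ∀ l < c.k, c.headFam d l ∈ c.LC := fun l hl => by
    rw [headFam, List.getD_eq_getElem _ _ (hd l hl)]
    exact List.getElem_mem _
  obtain ⟨e, he, t, ht, hg⟩ := hκ.exists_digits hc hk c.digits (fun l hl => hc.nodup _ (hmem l hl)) (by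
    have h1 : ∑ l ∈ Finset.range c.k, 1 ≤ ∑ l ∈ Finset.range c.k, (c.headFam d l).length :=
      Finset.sum_le_sum fun l hl =>
        List.length_pos_of_ne_nil (hc.ne_nil _ (hmem l (Finset.mem_range.1 hl)))
    simp only [Finset.sum_const, Finset.card_range, smul_eq_mul, mul_one] at h1
    -- The heads account for at least `k` of the at most `r * k` elements, which leaves `digits`
    -- additions.
    have h2 : c.r * c.k = c.k + c.digits := by
      obtain ⟨r', hr'⟩ := Nat.exists_eq_succ_of_ne_zero hc.r_pos.ne'
      rw [digits, hr']; simp; ring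
    omega)
  obtain ⟨v, hv, hve⟩ := exists_dig _ _ e he
  refine h v hv t ht ?_
  rwa [c.iter_congr _ fun i hi => hve i (by omega)]

def searchTime (r k N : ℕ) : ℕ :=
  ((r * k) ^ ((r - 1) * k)) * (runTime r k N +
    incTime (mulC r numK) (mulC (r - 1) numK) ((r - 1) * k) + 4) + 6

theorem runs_search (hc : c.Valid) (hk : 0 < c.k) {σ : State} (hE : c.Env σ) {d : ℕ → ℕ}
    (hd : ∀ i < c.k, d i < c.LC.length) (hadm : c.Adm d) (hd5 : σ.arr 5 = d)
    (h6 : σ.arr 6 = fun _ => 0) (hfound : c.Found σ ∨ σ.reg 0 = 0) :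
    Runs (unitCost c.r c.α) (search c.r) σ (searchTime c.r c.k c.LS.length) fun σ' =>
      (∀ a, a ≠ 1 → a ≠ 4 → a ≠ 7 → σ'.arr a = σ.arr a) ∧
      (∀ y < 6, y ≠ 0 → σ'.reg y = σ.reg y) ∧
      (c.Found σ' ∨ (σ.reg 0 = 0 ∧ σ'.reg 0 = 0 ∧ c.NoSolution d)) := by
  have hpos : 0 < c.r * c.k := Nat.mul_pos hc.r_pos hk
  refine Runs.le (Runs.odometer (b := c.r * c.k) (m := c.digits)
    (fun _ => runTime c.r c.k c.LS.length) (fun v σ' =>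
      (∀ a, a ≠ 1 → a ≠ 4 → a ≠ 6 → a ≠ 7 → σ'.arr a = σ.arr a) ∧
      (∀ y < 6, y ≠ 0 → σ'.reg y = σ.reg y) ∧
      (c.Found σ' ∨ (σ.reg 0 = 0 ∧ σ'.reg 0 = 0 ∧ ∀ v' < v, ∀ t ≤ c.digits,
        (c.greedy (c.iter (c.headFam d) (dig (c.r * c.k) c.digits v') t) c.k).1 ≠ 0)))
    (by omega) hpos ?_ ?_ ?_ h6 ?_ ?_ ?_) ?_
  · rintro v σ₁ σ₂ ⟨h1, h2, h3⟩ ⟨h4, h5⟩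
    refine ⟨fun a ha1 ha2 ha3 ha4 => by rw [h5 a ha3, h1 a ha1 ha2 ha3 ha4],
      fun y hy hy' => by rw [h4 y (by omega) (by omega), h2 y hy hy'], ?_⟩
    have h0 := h4 0 (by omega) (by omega)
    exact h3.imp (fun h => h.congr h0 (h5 1 (by omega))) fun h => ⟨h.1, by rw [h0, h.2.1], h.2.2⟩
  · rintro v σ' ⟨h1, -⟩
    simp [numK, h1 0, hE.k]
  · rintro v σ' ⟨h1, -⟩
    simp [numK, h1 0, hE.k, digits]
  · exact ⟨fun _ _ _ _ _ => rfl, fun _ _ _ => rfl, hfound.imp id fun h => ⟨h, h, by simp⟩⟩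
  · rintro v hv σ' h6' ⟨h1, h2, h3⟩
    refine Runs.mono (runs_run hc (hE.congr (h1 _ (by omega) (by omega) (by omega) (by omega))
      (h1 _ (by omega) (by omega) (by omega) (by omega))
      (h1 _ (by omega) (by omega) (by omega) (by omega))) hd hadm
      (by rw [h1 5 (by omega) (by omega) (by omega) (by omega), hd5]) h6'
      (fun i => Nat.div_lt_of_lt_mul (dig_lt hpos)) (h3.imp id fun h => h.2.1)) le_rfl ?_
    rintro σ'' ⟨h4, h5, h7⟩
    refine ⟨by rw [h4 6 (by omega) (by omega) (by omega), h6'],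
      fun a ha1 ha2 ha3 ha4 => by rw [h4 a ha1 ha2 ha4, h1 a ha1 ha2 ha3 ha4],
      fun y hy hy' => by rw [h5 y (by omega) hy', h2 y hy hy'], ?_⟩
    rcases h7 with h7 | ⟨hz, h7, h8⟩
    · exact Or.inl h7
    · have h3 := h3.resolve_left fun h => by have := h.1; omega
      refine Or.inr ⟨h3.1, h7, fun v' hv' => ?_⟩
      rcases Nat.lt_succ_iff_lt_or_eq.1 hv' with hv' | rfl
      · exact h3.2.2 v' hv'
      · exact h8
  · rintro σ' h6' ⟨h1, h2, h3⟩
    refine ⟨fun a ha1 ha2 ha4 => ?_, h2, h3.imp id fun h =>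
      ⟨h.1, h.2.1, c.noSolution_of_forall hc hk hd h.2.2⟩⟩
    by_cases ha : a = 6
    · subst ha; rw [h6', h6]
    · exact h1 a ha1 ha2 ha ha4
  · simp [searchTime, digits]

def headCheckTime (r k : ℕ) : ℕ := 2 + (k * ((headCheckBody r).scost + 9) + 7)

theorem runs_headCheck {O : Subroutine} {σ : State} (hE : c.Env σ) {d : ℕ → ℕ}
    (hd : ∀ i < c.k, d i < c.LC.length) (hd5 : σ.arr 5 = d) :
    Runs O (headCheck c.r) σ (headCheckTime c.r c.k) fun σ' =>
      σ'.arr = σ.arr ∧ (∀ y < 4, σ'.reg y = σ.reg y) ∧ (σ'.reg 5 = 0 ↔ c.Adm d) := by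
  refine Runs.seq (Runs.assign (Runs.forTo c.k _ (fun j σ' =>
    σ'.arr = σ.arr ∧ (∀ y < 4, σ'.reg y = σ.reg y) ∧
    (σ'.reg 5 = 0 ↔ ∀ i < j, (c.LC.getD (d i) []).length ≤ c.r ∧ (i + 1 < c.k → d i < d (i + 1))))
    ?_ ?_ ?_ ?_))
  · exact ⟨rfl, fun y hy => by simp [show y ≠ 4 by omega, show y ≠ 5 by omega], by simp⟩
  · rintro i - σ' ⟨h1, -⟩
    simp [numK, h1, hE.k]
  · rintro i hi σ' hx ⟨h1, h2, h3⟩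
    have hl : σ'.arr 0 (σ'.arr 2 (c.LS.length + d i)) = (c.LC.getD (d i) []).length := by
      rw [h1, ← State.length_listAt, hE.heads _ (hd i hi)]
    have key : Holds σ' (.add (ltE (.const c.r) (.get 0 (headPtr (.get 5 (.reg 4)))))
        (andE (ltE (.add (.reg 4) (.const 1)) numK)
        (notE (ltE (.get 5 (.reg 4)) (.get 5 (.add (.reg 4) (.const 1))))))) ↔
        ¬ ((c.LC.getD (d i) []).length ≤ c.r ∧ (i + 1 < c.k → d i < d (i + 1))) := by
      rw [holds_add, holds_andE, holds_notE, holds_ltE, holds_ltE, holds_ltE]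
      simp only [Exp.eval, headPtr, setPtr, numS, numK, hx]
      rw [show σ'.arr 5 i = d i by rw [h1, hd5], show σ'.arr 5 (i + 1) = d (i + 1) by rw [h1, hd5],
        show σ'.arr 0 2 = c.LS.length by rw [h1, hE.S], show σ'.arr 0 1 = c.k by rw [h1, hE.k], hl]
      rw [not_and_or, Classical.not_imp, not_le]
    rw [holds_iff, ne_eq, not_iff_not] at key
    refine Runs.assign ⟨by simp [hx], h1, fun y hy => ?_, ?_⟩
    · simp [show y ≠ 4 by omega, show y ≠ 5 by omega, h2 y hy]
    · rw [State.setReg_reg, if_neg (by omega), State.setReg_reg, if_pos rfl]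
      rw [show Exp.eval σ' (.add (.reg 5) (.add (ltE (.const c.r) (.get 0 (headPtr (.get 5 (.reg 4)))))
        (andE (ltE (.add (.reg 4) (.const 1)) numK)
        (notE (ltE (.get 5 (.reg 4)) (.get 5 (.add (.reg 4) (.const 1)))))))) = σ'.reg 5 + _ from rfl,
        Nat.add_eq_zero_iff, key, h3]
      constructor
      · rintro ⟨h4, h5⟩ l hl
        rcases Nat.lt_succ_iff_lt_or_eq.1 hl with hl | rfl
        · exact h4 l hl
        · exact h5
      · exact fun h4 => ⟨fun l hl => h4 l (by omega), h4 i (by omega)⟩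
  · rintro σ' ⟨h1, h2, h3⟩
    refine ⟨h1, h2, h3.trans ⟨fun h => ⟨fun i hi => (h i hi).1, fun i hi => (h i (by omega)).2 hi⟩,
      fun h i hi => ⟨h.1 i hi, h.2 i⟩⟩⟩

open Classical in
noncomputable def tryTime (c : Ctx) (d : ℕ → ℕ) : ℕ :=
  headCheckTime c.r c.k + 4 + if c.Adm d then searchTime c.r c.k c.LS.length else 0

theorem runs_tryHeads (hc : c.Valid) (hk : 0 < c.k) {σ : State} (hE : c.Env σ) {d : ℕ → ℕ}
    (hd : ∀ i < c.k, d i < c.LC.length) (hd5 : σ.arr 5 = d)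
    (h6 : σ.arr 6 = fun _ => 0) (hfound : c.Found σ ∨ σ.reg 0 = 0) :
    Runs (unitCost c.r c.α) (tryHeads c.r) σ (tryTime c d) fun σ' =>
      (∀ a, a ≠ 1 → a ≠ 4 → a ≠ 7 → σ'.arr a = σ.arr a) ∧
      (c.Found σ' ∨ (σ.reg 0 = 0 ∧ σ'.reg 0 = 0 ∧ (c.Adm d → c.NoSolution d))) := by
  rw [tryTime, add_assoc]
  refine Runs.seq (Runs.mono (runs_headCheck hE hd hd5) le_rfl ?_)
  rintro σ' ⟨h1, h2, h3⟩
  have h0 := h2 0 (by omega)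
  have hf' : c.Found σ' ∨ σ'.reg 0 = 0 :=
    hfound.imp (fun h => h.congr h0 (by rw [h1])) fun h => by rw [h0, h]
  by_cases hadm : c.Adm d
  · rw [if_pos hadm]
    refine Runs.le (Runs.ite (T := 1) (fun h => absurd (h3.2 hadm) h) fun _ => Runs.mono
      (runs_search hc hk (hE.congr (by rw [h1]) (by rw [h1]) (by rw [h1])) hd hadm
      (by rw [h1, hd5]) (by rw [h1, h6]) hf') le_rfl ?_) (by simp only [Exp.cost]; omega)
    rintro σ'' ⟨h4, -, h5⟩
    exact ⟨fun a ha ha' ha'' => by rw [h4 a ha ha' ha'', h1], h5.imp id fun h =>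
      ⟨by rw [← h0, h.1], h.2.1, fun _ => h.2.2⟩⟩
  · rw [if_neg hadm]
    refine Runs.le (Runs.ite (T' := 1) (fun h => Runs.skip ?_)
      fun h => absurd (h3.1 h) hadm) (by simp only [Exp.cost]; omega)
    exact ⟨fun a _ _ _ => by rw [h1], hf'.imp id fun h => ⟨by rw [← h0, h], h, fun h' => absurd h' hadm⟩⟩

noncomputable def searchHeadsTime (c : Ctx) : ℕ :=
  ∑ v ∈ Finset.range (c.LC.length ^ c.k),
    (tryTime c (dig c.LC.length c.k v) + incTime numC numK c.k + 4) + 6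

theorem runs_searchHeads (hc : c.Valid) (hk : 0 < c.k) (hC : 0 < c.LC.length) {σ : State}
    (hE : c.Env σ) (h5 : σ.arr 5 = fun _ => 0) (h6 : σ.arr 6 = fun _ => 0) (h0 : σ.reg 0 = 0) :
    Runs (unitCost c.r c.α) (searchHeads c.r) σ (searchHeadsTime c) fun σ' =>
      c.Found σ' ∨ (σ'.reg 0 = 0 ∧ ∀ d : ℕ → ℕ, (∀ i < c.k, d i < c.LC.length) → c.Adm d →
        c.NoSolution d) := by
  refine Runs.odometer (b := c.LC.length) (m := c.k) _ (fun v σ' =>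
      (∀ a, a ≠ 1 → a ≠ 4 → a ≠ 5 → a ≠ 7 → σ'.arr a = σ.arr a) ∧
      (c.Found σ' ∨ (σ'.reg 0 = 0 ∧ ∀ v' < v, c.Adm (dig c.LC.length c.k v') →
        c.NoSolution (dig c.LC.length c.k v'))))
    (by omega) hC ?_ ?_ ?_ h5 ?_ ?_ ?_
  · rintro v σ₁ σ₂ ⟨h1, h3⟩ ⟨h4, h5⟩
    refine ⟨fun a ha1 ha2 ha3 ha4 => by rw [h5 a ha3, h1 a ha1 ha2 ha3 ha4], ?_⟩
    have h0 := h4 0 (by omega) (by omega)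
    exact h3.imp (fun h => h.congr h0 (h5 1 (by omega))) fun h => ⟨by rw [h0, h.1], h.2⟩
  · rintro v σ' ⟨h1, -⟩
    simp [numC, h1 0, hE.C]
  · rintro v σ' ⟨h1, -⟩
    simp [numK, h1 0, hE.k]
  · exact ⟨fun _ _ _ _ _ => rfl, Or.inr ⟨h0, by simp⟩⟩
  · rintro v hv σ' h5' ⟨h1, h3⟩
    refine Runs.mono (runs_tryHeads hc hk
      (hE.congr (h1 _ (by omega) (by omega) (by omega) (by omega))
      (h1 _ (by omega) (by omega) (by omega) (by omega))
      (h1 _ (by omega) (by omega) (by omega) (by omega))) (fun i _ => dig_lt hC) h5'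
      (by rw [h1 6 (by omega) (by omega) (by omega) (by omega), h6]) (h3.imp id And.left)) le_rfl ?_
    rintro σ'' ⟨h4, h7⟩
    refine ⟨by rw [h4 5 (by omega) (by omega) (by omega), h5'],
      fun a ha1 ha2 ha3 ha4 => by rw [h4 a ha1 ha2 ha4, h1 a ha1 ha2 ha3 ha4], ?_⟩
    rcases h7 with h7 | ⟨hz, h7, h8⟩
    · exact Or.inl h7
    · have h3 := h3.resolve_left fun h => by have := h.1; omega
      refine Or.inr ⟨h7, fun v' hv' => ?_⟩
      rcases Nat.lt_succ_iff_lt_or_eq.1 hv' with hv' | rfl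
      · exact h3.2 v' hv'
      · exact h8
  · rintro σ' - ⟨h1, h3⟩
    refine h3.imp id fun h => ⟨h.1, fun d hd hadm => ?_⟩
    -- The odometer's sequence agrees with `d` only below `k`, but nothing else is looked at.
    obtain ⟨v, hv, hvd⟩ := exists_dig _ _ d hd
    have hA : c.Adm (dig c.LC.length c.k v) :=
      ⟨fun i hi => by rw [hvd i hi]; exact hadm.1 i hi,
        fun i hi => by rw [hvd i (by omega), hvd (i + 1) hi]; exact hadm.2 i hi⟩
    intro κ hκ
    exact h.2 v hv hA κ ⟨hκ.mem, fun l hl => by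
      have := hκ.subset l hl
      rwa [headFam, ← hvd l hl] at this, hκ.compat⟩

/-! ### Reading the input -/

/-- Store the addresses of all sets and heads in array 2. -/
def pointersBody : Prog :=
  .seq (.store 2 (.reg 3) (.reg 2))
    (.assign 2 (.add (.add (.reg 2) (.get 0 (.reg 2))) (.const 1)))

def pointers : Prog :=
  .seq (.assign 2 (.const 4)) (forTo 3 (.add numS numC) pointersBody)

/-- Mark the elements of the heads in array 3. -/
def markEntry : Prog := .store 3 (entry 0 (headPtr (.reg 3)) (.reg 4)) (.const 1)

def markHead : Prog := forTo 4 (.get 0 (headPtr (.reg 3))) markEntry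

def mark : Prog := forTo 3 numC markHead

/-- For `k = 0` the allowed time does not depend on `g`, so the heads must not be read. For `k > n`
there is no packing, and the test ensures that later terms linear in `k` are at most `n`. -/
def solve (r : ℕ) : Prog :=
  .ite numK
    (.ite (.sub numK (.get 0 (.const 0))) .skip (.seq pointers (.seq mark (searchHeads r))))
    (.assign 0 (.const 1))

/-- The input word. -/
def Ctx.word (c : Ctx) : List ℕ :=
  c.n :: c.k :: c.LS.length :: c.LC.length :: flatten (c.LS ++ c.LC)

/-- Address of list number `i`. -/
def Ctx.offset (c : Ctx) (i : ℕ) : ℕ := 4 + (flatten ((c.LS ++ c.LC).take i)).length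

theorem flatten_append (L L' : List (List ℕ)) : flatten (L ++ L') = flatten L ++ flatten L' := by
  simp [flatten]

theorem initState_arr_zero (w : List ℕ) (i : ℕ) : (initState w).arr 0 i = w.getD i 0 := by
  simp [initState]

theorem initState_arr_ne (w : List ℕ) {a : ℕ} (ha : a ≠ 0) : (initState w).arr a = fun _ => 0 := by
  funext i; simp [initState, ha]

/-- The word is cut into its four leading numbers, the lists before list `i`, that list with its
length, and the rest. -/
theorem Ctx.word_get (c : Ctx) {i : ℕ} (hi : i < (c.LS ++ c.LC).length) (j : ℕ) :
    (initState c.word).arr 0 (c.offset i + j) =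
      (((c.LS ++ c.LC)[i].length :: (c.LS ++ c.LC)[i]) ++
        flatten ((c.LS ++ c.LC).drop (i + 1))).getD j 0 := by
  rw [initState_arr_zero, offset]
  have h : c.word = [c.n, c.k, c.LS.length, c.LC.length] ++
      (flatten ((c.LS ++ c.LC).take i) ++ (((c.LS ++ c.LC)[i].length :: (c.LS ++ c.LC)[i]) ++
        flatten ((c.LS ++ c.LC).drop (i + 1)))) := by
    have h1 : flatten ([(c.LS ++ c.LC)[i]]) =
        (c.LS ++ c.LC)[i].length :: (c.LS ++ c.LC)[i] := by simp [flatten]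
    rw [← h1, ← flatten_append, ← flatten_append, List.singleton_append,
      ← List.drop_eq_getElem_cons hi, List.take_append_drop]
    rfl
  rw [h, List.getD_append_right _ _ _ _ (by simp; omega),
    List.getD_append_right _ _ _ _ (by simp; omega)]
  congr 1
  simp
  omega

theorem Ctx.listAt_offset (c : Ctx) {i : ℕ} (hi : i < (c.LS ++ c.LC).length) :
    (initState c.word).listAt 0 (c.offset i) = (c.LS ++ c.LC)[i] := by
  have h0 := c.word_get hi 0
  rw [add_zero] at h0
  refine List.ext_getElem ?_ fun q h1 h2 => ?_
  · rw [State.length_listAt, h0]; simp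
  · simp only [State.listAt, List.getElem_map, List.getElem_range]
    rw [add_assoc, c.word_get hi, add_comm 1 q]
    simp only [List.cons_append, List.getD_cons_succ]
    rw [List.getD_append _ _ _ _ h2, List.getD_eq_getElem _ _ h2]

theorem Ctx.offset_succ (c : Ctx) {i : ℕ} (hi : i < (c.LS ++ c.LC).length) :
    c.offset (i + 1) = c.offset i + (initState c.word).arr 0 (c.offset i) + 1 := by
  have h0 := c.word_get hi 0
  rw [add_zero] at h0
  rw [h0, offset, offset, List.take_succ_eq_append_getElem hi, flatten_append]
  simp [flatten]
  omega

def pointersTime (N : ℕ) : ℕ := 2 + (N * (pointersBody.scost + 12) + 10)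

theorem runs_pointers {O : Subroutine} (c : Ctx) :
    Runs O pointers (initState c.word) (pointersTime (c.LS.length + c.LC.length)) fun σ' =>
      (∀ a, a ≠ 2 → σ'.arr a = (initState c.word).arr a) ∧ σ'.reg 0 = 0 ∧
      ∀ i < c.LS.length + c.LC.length, σ'.arr 2 i = c.offset i := by
  refine Runs.seq (Runs.assign (Runs.forTo (c.LS.length + c.LC.length) _ (fun i σ' =>
    (∀ a, a ≠ 2 → σ'.arr a = (initState c.word).arr a) ∧ σ'.reg 0 = 0 ∧ σ'.reg 2 = c.offset i ∧
      ∀ j < i, σ'.arr 2 j = c.offset j) ?_ ?_ ?_ ?_))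
  · exact ⟨fun _ _ => rfl, rfl, by simp [offset, flatten], by simp⟩
  · rintro i - σ' ⟨h1, -⟩
    simp only [Exp.eval, numS, numC, h1 0 (by omega), initState_arr_zero, word]
    rfl
  · rintro i hi σ' hx ⟨h1, h2, h3, h4⟩
    refine Runs.seq (Runs.store (Runs.assign ⟨by simpa using hx, fun a ha => ?_, by simpa using h2,
      ?_, fun j hj => ?_⟩))
    · simp only [State.setReg_arr]
      rw [State.setArr_arr_ne _ _ _ ha, h1 a ha]
    · rw [c.offset_succ (by simpa using hi)]
      simp only [State.setReg_reg, State.setArr_reg, Exp.eval, h3]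
      rw [State.setArr_arr_ne _ _ _ (by omega), h1 0 (by omega)]
      simp
    · simp only [State.setReg_arr, Exp.eval]
      rw [State.setArr_arr_same, hx, h3]
      split_ifs with h
      · rw [h]
      · exact h4 j (by omega)
  · rintro σ' ⟨h1, h2, -, h4⟩
    exact ⟨h1, h2, h4⟩

def markHeadTime (n : ℕ) : ℕ :=
  n * (markEntry.scost + (Exp.get 0 (headPtr (.reg 3))).cost + 7) +
    (Exp.get 0 (headPtr (.reg 3))).cost + 5

theorem runs_markHead {O : Subroutine} {σ : State} {i n : ℕ} {w : List ℕ} (h3 : σ.reg 3 = i)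
    (hw : σ.listAt 0 (σ.arr 2 (σ.arr 0 2 + i)) = w) (hn : w.length ≤ n) :
    Runs O markHead σ (markHeadTime n) fun σ' =>
      (∀ a, a ≠ 3 → σ'.arr a = σ.arr a) ∧ (∀ y < 4, σ'.reg y = σ.reg y) ∧
      ∀ u, σ'.arr 3 u ≠ 0 ↔ σ.arr 3 u ≠ 0 ∨ u ∈ w := by
  have hlen : σ.arr 0 (σ.arr 2 (σ.arr 0 2 + i)) = w.length := by
    rw [← hw, State.length_listAt]
  refine Runs.le (Runs.forTo w.length markEntry.scost (fun q σ' =>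
    (∀ a, a ≠ 3 → σ'.arr a = σ.arr a) ∧ (∀ y < 4, σ'.reg y = σ.reg y) ∧
      ∀ u, σ'.arr 3 u ≠ 0 ↔ σ.arr 3 u ≠ 0 ∨ ∃ p < q,
        σ.arr 0 (σ.arr 2 (σ.arr 0 2 + i) + 1 + p) = u) ?_ ?_ ?_ ?_) ?_
  · exact ⟨fun _ _ => rfl, fun y hy => by simp [show y ≠ 4 by omega], by simp⟩
  · rintro q - σ' ⟨h1, h2, -⟩
    simp [headPtr, setPtr, numS, h1 0, h1 2, h2 3, h3, hlen]
  · rintro q hq σ' hx ⟨h1, h2, h4⟩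
    refine Runs.store ⟨by simpa using hx, fun a ha => ?_, fun y hy => ?_, fun u => ?_⟩
    · rw [State.setReg_arr, State.setArr_arr_ne _ _ _ ha, h1 a ha]
    · simp [show y ≠ 4 by omega, h2 y hy]
    · simp only [State.setReg_arr, State.setArr_arr_same, Exp.eval, entry, headPtr, setPtr, numS,
        h1 0 (by omega), h1 2 (by omega), h2 3 (by omega), h3, hx, Nat.lt_succ_iff_lt_or_eq,
        or_and_right, exists_or, exists_eq_left]
      rw [← or_assoc, ← h4 u]
      split_ifs with h
      · simp [h]
      · exact ⟨Or.inl, fun h' => h'.resolve_right fun h'' => h h''.symm⟩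
  · rintro σ' ⟨h1, h2, h4⟩
    refine ⟨h1, h2, fun u => ?_⟩
    rw [h4, ← hlen, ← hw, State.mem_listAt]
  · rw [markHeadTime]
    gcongr

def markTime (n N : ℕ) : ℕ := N * (markHeadTime n + 9) + 7

theorem runs_mark {O : Subroutine} (hc : c.Valid) {σ : State}
    (h0 : σ.arr 0 = (initState c.word).arr 0) (h3 : σ.arr 3 = fun _ => 0)
    (h2 : ∀ i < c.LS.length + c.LC.length, σ.arr 2 i = c.offset i) :
    Runs O mark σ (markTime c.n c.LC.length) fun σ' => c.Env σ' ∧ σ'.reg 0 = σ.reg 0 ∧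
      ∀ a, a ≠ 3 → σ'.arr a = σ.arr a := by
  have e0 : ∀ i, σ.arr 0 i = c.word.getD i 0 := fun i => by rw [h0, initState_arr_zero]
  have hS : ∀ i < c.LS.length, σ.listAt 0 (σ.arr 2 i) = c.LS.getD i [] := fun i hi => by
    have := c.listAt_offset (i := i) (by simp; omega)
    rw [State.listAt_congr h0, h2 i (by omega), this, List.getElem_append_left hi,
      List.getD_eq_getElem _ _ hi]
  have hC : ∀ i < c.LC.length, σ.listAt 0 (σ.arr 2 (c.LS.length + i)) = c.LC.getD i [] :=
    fun i hi => by
      have := c.listAt_offset (i := c.LS.length + i) (by simp; omega)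
      rw [State.listAt_congr h0, h2 _ (by omega), this, List.getElem_append_right (by omega),
        List.getD_eq_getElem _ _ hi]
      simp
  refine Runs.forTo c.LC.length _ (fun i σ' => (∀ a, a ≠ 3 → σ'.arr a = σ.arr a) ∧
    σ'.reg 0 = σ.reg 0 ∧ ∀ u, σ'.arr 3 u ≠ 0 ↔ ∃ j < i, u ∈ c.LC.getD j []) ?_ ?_ ?_ ?_
  · exact ⟨fun _ _ => rfl, by simp, by simp [h3]⟩
  · rintro i - σ' ⟨h1, -⟩
    simp only [numC, Exp.eval, h1 0 (by omega), e0]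
    rfl
  · rintro i hi σ' hx ⟨h4, h5, h6⟩
    have hmem : c.LC.getD i [] ∈ c.LC := by
      rw [List.getD_eq_getElem _ _ hi]; exact List.getElem_mem _
    -- Heads may have more than `r` elements, but never more than `n`.
    have hlen : (c.LC.getD i []).length ≤ c.n := by
      have hsub : c.LC.getD i [] ⊆ List.range c.n := fun u hu =>
        List.mem_range.2 (hc.lt _ hmem u hu)
      simpa using ((hc.nodup _ hmem).subperm hsub).length_le
    refine Runs.mono (runs_markHead (w := c.LC.getD i []) hx ?_ hlen) le_rfl ?_
    · rw [State.listAt_congr (h4 0 (by omega)), h4 0 (by omega), h4 2 (by omega), ← hC i hi]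
      rw [e0 2]; rfl
    · rintro σ'' ⟨h7, h8, h9⟩
      refine ⟨by rw [h8 3 (by omega), hx], fun a ha => ?_, ?_, fun u => ?_⟩
      · rw [State.setReg_arr, h7 a ha, h4 a ha]
      · simp [h8 0, h5]
      · rw [State.setReg_arr, h9, h6]
        simp only [Nat.lt_succ_iff_lt_or_eq, or_and_right, exists_or, exists_eq_left]
  · rintro σ' ⟨h4, h5, h6⟩
    refine ⟨⟨?_, ?_, ?_, ?_, fun i hi => ?_, fun i hi => ?_, fun u => ?_⟩, h5, h4⟩
    · rw [h4 0 (by omega), e0]; rfl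
    · rw [h4 0 (by omega), e0]; rfl
    · rw [h4 0 (by omega), e0]; rfl
    · rw [h4 0 (by omega), e0]; rfl
    · rw [State.listAt_congr (h4 0 (by omega)), h4 2 (by omega), hS i hi]
    · rw [State.listAt_congr (h4 0 (by omega)), h4 2 (by omega), hC i hi]
    · rw [h6, InHead]
      constructor
      · rintro ⟨j, hj, hu⟩
        refine ⟨_, ?_, hu⟩
        rw [List.getD_eq_getElem _ _ hj]; exact List.getElem_mem _
      · rintro ⟨w, hw, hu⟩
        obtain ⟨j, hj, rfl⟩ := List.getElem_of_mem hw
        exact ⟨j, hj, by rwa [List.getD_eq_getElem _ _ hj]⟩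

open Classical in
noncomputable def solveTime (c : Ctx) : ℕ :=
  13 + if 0 < c.k ∧ c.k ≤ c.n then pointersTime (c.LS.length + c.LC.length) +
    (markTime c.n c.LC.length + searchHeadsTime c) else 0

theorem runs_solve (hc : c.Valid) (hC : 0 < c.LC.length) :
    Runs (unitCost c.r c.α) (solve c.r) (initState c.word) (solveTime c) fun σ =>
      c.Found σ ∨ (σ.reg 0 = 0 ∧ (c.k ≤ c.n → ∀ d : ℕ → ℕ, (∀ i < c.k, d i < c.LC.length) →
        c.Adm d → c.NoSolution d)) := by
  have hK : numK.eval (initState c.word) = c.k := by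
    simp only [numK, Exp.eval, initState_arr_zero]; rfl
  have hN : (Exp.get 0 (.const 0)).eval (initState c.word) = c.n := by
    simp only [Exp.eval, initState_arr_zero]; rfl
  by_cases hk : c.k = 0
  · refine Runs.le (Runs.ite (T := 0) (fun h => absurd (hK.trans hk) h) fun _ =>
      Runs.assign (Or.inl ⟨by simp, fun i hi => by omega⟩)) ?_
    simp [solveTime, Exp.cost, numK]; omega
  by_cases hn : c.n < c.k
  · refine Runs.le (Runs.ite (T' := 0) (fun _ => Runs.ite (T' := 0) (fun _ => Runs.skip
      (Or.inr ⟨rfl, fun h => by omega⟩)) fun h => ?_) fun h => absurd (hK.symm.trans h) hk) ?_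
    · rw [Exp.eval, hK, hN] at h; omega
    · simp [solveTime, Exp.cost, numK]; omega
  · refine Runs.le (Runs.ite (T' := 0) (fun _ => Runs.ite (T := 0) (fun h => ?_) fun _ => Runs.seq
      (Runs.mono (runs_pointers c) le_rfl ?_)) fun h => absurd (hK.symm.trans h) hk)
      (T := _ + 1 + (_ + 1 + (0 + (_ + (markTime c.n c.LC.length + searchHeadsTime c))) + 0)) ?_
    · rw [Exp.eval, hK, hN] at h; omega
    · rintro σ₁ ⟨h1, h2, h3⟩
      refine Runs.seq (Runs.mono (runs_mark hc (h1 0 (by omega)) ?_ h3) le_rfl ?_)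
      · rw [h1 3 (by omega), initState_arr_ne _ (by omega)]
      · rintro σ₂ ⟨h4, h5, h6⟩
        refine Runs.mono (runs_searchHeads hc (by omega) hC h4 ?_ ?_ (by rw [h5, h2])) le_rfl ?_
        · rw [h6 5 (by omega), h1 5 (by omega), initState_arr_ne _ (by omega)]
        · rw [h6 6 (by omega), h1 6 (by omega), initState_arr_ne _ (by omega)]
        · exact fun σ' h => h.imp id fun h => ⟨h.1, fun _ => h.2⟩
    · rw [solveTime, if_pos ⟨by omega, by omega⟩]
      simp [Exp.cost, numK]; omega

/-! ### The running time -/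

theorem exists_checkTime (r : ℕ) : ∃ C, ∀ k, 1 ≤ k → checkTime r k ≤ C * k := by
  refine ⟨(checkBody r).scost + 16, fun k hk => ?_⟩
  rw [checkTime]
  nlinarith

/-- `N` is a positive upper bound for the number `M` of sets, which may be zero; additive constants
can then be absorbed into `k * N`. -/
theorem exists_scanTime (r : ℕ) : ∃ C, ∀ k N M, 1 ≤ k → 1 ≤ N → M ≤ N →
    scanTime r k M ≤ C * (k * N) := by
  obtain ⟨C, hC⟩ := exists_checkTime r
  refine ⟨(scanBody r).scost + C + 18, fun k N M hk hN hM => ?_⟩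
  calc scanTime r k M ≤ 2 + (N * ((scanBody r).scost + C * k + 9) + 7) := by
        rw [scanTime]; gcongr; exact hC k hk
    _ ≤ 9 * (k * N) + N * ((scanBody r).scost * k + C * k + 9 * k) := by
        have h1 : 1 ≤ k * N := Nat.mul_pos hk hN
        have h2 : N * ((scanBody r).scost + C * k + 9) ≤
            N * ((scanBody r).scost * k + C * k + 9 * k) := by
          gcongr
          · exact Nat.le_mul_of_pos_right _ hk
          · omega
        omega
    _ = ((scanBody r).scost + C + 18) * (k * N) := by ring

theorem exists_greedyTime (r : ℕ) : ∃ C, ∀ k N M, 1 ≤ k → 1 ≤ N → M ≤ N →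
    greedyTime r k M ≤ C * (k ^ 2 * N) := by
  obtain ⟨C, hC⟩ := exists_scanTime r
  refine ⟨(copyRow r).scost + (greedyBody r).scost + C + 34, fun k N M hk hN hM => ?_⟩
  have h1 : 1 ≤ k * N := Nat.mul_pos hk hN
  have hk2 : k ≤ k * (k * N) := Nat.le_mul_of_pos_right _ h1
  calc greedyTime r k M ≤ 2 + ((k * ((copyRow r).scost + 9) + 7) +
        (k * ((greedyBody r).scost + C * (k * N) + 9) + 7)) := by
        rw [greedyTime]; gcongr; exact hC k N M hk hN hM
    _ = 16 + k * ((copyRow r).scost + (greedyBody r).scost + 18) + C * (k * (k * N)) := by ring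
    _ ≤ 16 * (k * (k * N)) + (k * (k * N)) * ((copyRow r).scost + (greedyBody r).scost + 18) +
        C * (k * (k * N)) := by
        gcongr
        omega
    _ = _ := by ring

/-- At most `r * k` rounds, each dominated by a greedy pass of order `k ^ 2 * N`. -/
theorem exists_runTime (r : ℕ) (hr : 1 ≤ r) : ∃ C, ∀ k N M, 1 ≤ k → 1 ≤ N → M ≤ N →
    runTime r k M ≤ C * (k ^ 3 * N) := by
  obtain ⟨C, hC⟩ := exists_greedyTime r
  set a := (Exp.add (mulC (r - 1) numK) (.const 1)).cost with ha
  refine ⟨(initBody r).scost + 16 + a + 5 + r * ((roundBody r).scost + C + 18 + a + 7),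
    fun k N M hk hN hM => ?_⟩
  have h1 : 1 ≤ k ^ 2 * N := Nat.mul_pos (by positivity) hN
  have h2 : k ≤ k ^ 2 * N := by nlinarith [Nat.le_mul_of_pos_right (k ^ 2) hN]
  have h3 : k ^ 2 * N ≤ k ^ 3 * N := by gcongr; omega
  have hround : roundTime r k M ≤ ((roundBody r).scost + C + 18) * (k ^ 2 * N) := by
    calc roundTime r k M ≤ (roundBody r).scost + C * (k ^ 2 * N) + (2 + (k * 12 + 4)) := by
          rw [roundTime, divideTime]; gcongr; exact hC k N M hk hN hM
      _ ≤ (roundBody r).scost * (k ^ 2 * N) + C * (k ^ 2 * N) + 18 * (k ^ 2 * N) := by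
          have := Nat.le_mul_of_pos_right (roundBody r).scost h1
          omega
      _ = _ := by ring
  have hnum : (r - 1) * k + 1 ≤ r * k := by
    obtain ⟨r', rfl⟩ := Nat.exists_eq_add_of_le' hr
    simp only [Nat.add_sub_cancel]; nlinarith
  calc runTime r k M ≤ (k * ((initBody r).scost + 9) + 7) +
        (r * k * (((roundBody r).scost + C + 18) * (k ^ 2 * N) + a + 7) + a + 5) := by
        rw [runTime, roundsTime, ← ha]; gcongr
    _ ≤ (k ^ 3 * N) * ((initBody r).scost + 9) + 7 * (k ^ 3 * N) +
        (r * k * (((roundBody r).scost + C + 18) * (k ^ 2 * N) + a * (k ^ 2 * N) +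
          7 * (k ^ 2 * N)) + a * (k ^ 3 * N) + 5 * (k ^ 3 * N)) := by
        have h4 : a ≤ a * (k ^ 2 * N) := Nat.le_mul_of_pos_right _ h1
        have h5 : a ≤ a * (k ^ 3 * N) := Nat.le_mul_of_pos_right _ (by omega)
        gcongr <;> omega
    _ = _ := by ring

theorem incTime_le (eb em : Exp) (m K : ℕ) (hm : m ≤ K) (hK : 1 ≤ K) :
    incTime eb em m ≤ (eb.cost + 2 * em.cost + 33) * K := by
  rw [incTime]
  calc _ ≤ 2 + (K * (eb.cost + 5 + 1 + (8 + 5) + em.cost + 7) + em.cost + 5) := by gcongr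
    _ ≤ 7 * K + em.cost * K + K * (eb.cost + 5 + 1 + (8 + 5) + em.cost + 7) := by
        have := Nat.le_mul_of_pos_right em.cost hK
        omega
    _ = _ := by ring

theorem exists_searchTime (r : ℕ) (hr : 1 ≤ r) : ∃ C, ∀ k N M, 1 ≤ k → 1 ≤ N → M ≤ N →
    searchTime r k M ≤ C * ((r * k) ^ ((r - 1) * k) * (k ^ 3 * N)) := by
  obtain ⟨C, hC⟩ := exists_runTime r hr
  set b := ((mulC r numK).cost + 2 * (mulC (r - 1) numK).cost + 33) with hb
  refine ⟨C + b * r + 10, fun k N M hk hN hM => ?_⟩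
  have hpos : 1 ≤ (r * k) ^ ((r - 1) * k) := Nat.pow_pos (Nat.mul_pos hr hk)
  have h1 : 1 ≤ k ^ 3 * N := Nat.mul_pos (by positivity) hN
  have h2 : k ≤ k ^ 3 * N := by
    calc k = k ^ 1 * 1 := by ring
      _ ≤ k ^ 3 * N := by gcongr; omega
  have h3 : 1 ≤ (r * k) ^ ((r - 1) * k) * (k ^ 3 * N) := Nat.mul_pos hpos h1
  have h4 : incTime (mulC r numK) (mulC (r - 1) numK) ((r - 1) * k) ≤ b * (r * (k ^ 3 * N)) := by
    refine incTime_le _ _ _ _ ?_ (Nat.mul_pos hr h1)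
    exact Nat.mul_le_mul (by omega) h2
  calc searchTime r k M ≤ ((r * k) ^ ((r - 1) * k)) * (C * (k ^ 3 * N) + b * (r * (k ^ 3 * N)) +
        4 * (k ^ 3 * N)) + 6 * ((r * k) ^ ((r - 1) * k) * (k ^ 3 * N)) := by
        rw [searchTime]
        gcongr
        · exact hC k N M hk hN hM
        · omega
        · omega
    _ = _ := by ring

/-- The constant `5` is forced to be at least `27 / 6` by `k = 3`; from there on `(k + 1) ^ 2 ≤ k ^
3` carries the induction. -/
theorem cube_le_factorial (k : ℕ) : k ^ 3 ≤ 5 * k.factorial := by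
  rcases lt_or_ge k 3 with hk | hk
  · interval_cases k <;> decide
  · induction k, hk using Nat.le_induction with
    | base => decide
    | succ k hk ih =>
      rw [Nat.factorial_succ]
      have h : (k + 1) ^ 2 ≤ k ^ 3 := by nlinarith [mul_self_nonneg k, Nat.mul_le_mul hk hk]
      calc (k + 1) ^ 3 = (k + 1) * (k + 1) ^ 2 := by ring
        _ ≤ (k + 1) * (5 * k.factorial) := by gcongr; exact h.trans ih
        _ = _ := by ring

theorem Ctx.Adm.strictMono {c : Ctx} {d : ℕ → ℕ} (h : c.Adm d) :
    StrictMono fun i : Fin c.k => d i := by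
  have key : ∀ j < c.k, ∀ i < j, d i < d j := by
    intro j
    induction j with
    | zero => simp
    | succ j ih =>
      intro hj i hi
      have h1 := h.2 j hj
      rcases Nat.lt_succ_iff_lt_or_eq.1 hi with hi | rfl
      · exact (ih (by omega) i hi).trans h1
      · exact h1
  exact fun i j hij => key j j.2 i hij

open Classical in
-- A strictly increasing sequence is determined by its set of values, so there are at most `g.choose
-- k` of them, and `k!` times this number is the falling factorial.
theorem Ctx.card_adm_mul_le (c : Ctx) :
    ((Finset.range (c.LC.length ^ c.k)).filter fun v => c.Adm (dig c.LC.length c.k v)).card *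
      c.k.factorial ≤ c.LC.length ^ c.k := by
  set g := c.LC.length
  have h1 : ((Finset.range (g ^ c.k)).filter fun v => c.Adm (dig g c.k v)).card ≤
      ((Finset.range g).powersetCard c.k).card := by
    refine Finset.card_le_card_of_injOn
      (fun v => Finset.univ.image fun i : Fin c.k => dig g c.k v i) ?_ ?_
    · intro v hv
      simp only [Finset.coe_filter, Finset.mem_range, Set.mem_ofPred_eq] at hv
      simp only [Finset.mem_coe, Finset.mem_powersetCard]
      refine ⟨fun x hx => ?_, ?_⟩
      · obtain ⟨i, -, rfl⟩ := Finset.mem_image.1 hx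
        refine Finset.mem_range.2 (dig_lt ?_)
        rcases Nat.eq_zero_or_pos g with h0 | h0
        · rw [h0, Nat.zero_pow (by have := i.2; omega)] at hv
          exact absurd hv.1 (by omega)
        · exact h0
      · rw [Finset.card_image_of_injective _ hv.2.strictMono.injective]; simp
    · intro v hv w hw h
      simp only [Finset.coe_filter, Finset.mem_range, Set.mem_ofPred_eq] at hv hw
      -- Strictly monotone maps with the same range coincide.
      have h2 : (fun i : Fin c.k => dig g c.k v i) = fun i : Fin c.k => dig g c.k w i := by
        refine (StrictMono.range_inj hv.2.strictMono hw.2.strictMono).1 ?_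
        have := congrArg (fun s : Finset ℕ => (s : Set ℕ)) h
        simpa using this
      exact dig_inj hv.1 hw.1 fun i hi => congrFun h2 ⟨i, hi⟩
  rw [Finset.card_powersetCard, Finset.card_range] at h1
  calc _ ≤ g.choose c.k * c.k.factorial := by gcongr
    _ = g.descFactorial c.k := by rw [Nat.descFactorial_eq_factorial_mul_choose, mul_comm]
    _ ≤ g ^ c.k := Nat.descFactorial_le_pow _ _

/-- The main time bound. -/
theorem exists_solveTime (r : ℕ) (hr : 1 ≤ r) : ∃ B, ∀ c : Ctx, c.r = r → 0 < c.LC.length →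
    0 < c.n → c.LS.length ≤ (r + 1) * c.n ^ r →
    solveTime c ≤ B * (c.LC.length ^ c.k * (r * c.k) ^ ((r - 1) * c.k) * c.n ^ r) := by
  classical
  obtain ⟨C, hC⟩ := exists_searchTime r hr
  set p := pointersBody.scost with hp
  set m := markEntry.scost + 2 * (Exp.get 0 (headPtr (.reg 3))).cost + 12 with hm
  set h := (headCheckBody r).scost + 18 with hh
  set b := numC.cost + 2 * numK.cost + 33 with hb
  refine ⟨13 + (12 + (p + 12) * (r + 2)) + (m + 16) + (h + 8 + b + 6) + C * 5 * (r + 1),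
    fun c hcr hg hn hS => ?_⟩
  set g := c.LC.length with hgdef
  have hD : 1 ≤ c.n ^ r := Nat.pow_pos hn
  have hnD : c.n ≤ c.n ^ r := Nat.le_self_pow (by omega) _
  have hG : 1 ≤ g ^ c.k := Nat.pow_pos hg
  have hM : 1 ≤ (r * c.k) ^ ((r - 1) * c.k) := by
    rcases Nat.eq_zero_or_pos c.k with hk | hk
    · simp [hk]
    · exact Nat.pow_pos (Nat.mul_pos hr hk)
  set G := g ^ c.k with hGdef
  set R := (r * c.k) ^ ((r - 1) * c.k) with hR
  set D := c.n ^ r with hDdef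
  have hX : 1 ≤ G * R * D := Nat.mul_pos (Nat.mul_pos hG hM) hD
  have hGD : G * D ≤ G * R * D := by
    calc G * D = G * 1 * D := by ring
      _ ≤ G * R * D := by gcongr
  have hDX : D ≤ G * D := Nat.le_mul_of_pos_left _ hG
  have hGX : G ≤ G * D := Nat.le_mul_of_pos_right _ hD
  rw [solveTime]
  by_cases hk : 0 < c.k ∧ c.k ≤ c.n
  swap
  · rw [if_neg hk]
    have : 13 * 1 ≤ (13 + (12 + (p + 12) * (r + 2)) + (m + 16) + (h + 8 + b + 6) + C * 5 * (r + 1)) *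
      (G * R * D) := Nat.mul_le_mul (by omega) hX
    omega
  rw [if_pos hk]
  obtain ⟨hk1, hkn⟩ := hk
  -- Reading all heads fits into the bound only because `k` is positive.
  have hgG : g ≤ G := Nat.le_self_pow (by omega) _
  have e1 : pointersTime (c.LS.length + g) ≤ (12 + (p + 12) * (r + 2)) * (G * R * D) := by
    calc pointersTime (c.LS.length + g) ≤ 12 * (G * D) + ((r + 1) * (G * D) + G * D) * (p + 12) := by
          rw [pointersTime, ← hp]
          have : (c.LS.length + g) * (p + 12) ≤ ((r + 1) * (G * D) + G * D) * (p + 12) := by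
            gcongr
            · exact hS.trans (Nat.mul_le_mul_left _ hDX)
            · omega
          omega
      _ = (12 + (p + 12) * (r + 2)) * (G * D) := by ring
      _ ≤ _ := Nat.mul_le_mul_left _ hGD
  have e2 : markTime c.n g ≤ (m + 16) * (G * R * D) := by
    calc markTime c.n g ≤ G * (m * D + 9 * D) + 7 * (G * D) := by
          have h1 : markHeadTime c.n ≤ m * D := by
            rw [markHeadTime, hm]
            nlinarith [Nat.zero_le (markEntry.scost), Nat.zero_le (Exp.get 0 (headPtr (.reg 3))).cost]
          rw [markTime]
          gcongr
          · omega
          · omega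
      _ = (m + 16) * (G * D) := by ring
      _ ≤ _ := Nat.mul_le_mul_left _ hGD
  have e3 : searchHeadsTime c ≤ (h + 8 + b + 6 + C * 5 * (r + 1)) * (G * R * D) := by
    have h1 : headCheckTime r c.k ≤ h * D := by
      calc headCheckTime r c.k ≤ h * c.k := by rw [headCheckTime, hh]; nlinarith
        -- Here `k ≤ n ≤ n ^ r` is needed.
        _ ≤ h * D := by gcongr; omega
    have h2 : incTime numC numK c.k ≤ b * D := incTime_le _ _ _ _ (by omega) hD
    have h3 : searchTime r c.k c.LS.length ≤ C * (R * (c.k ^ 3 * ((r + 1) * D))) :=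
      hC c.k ((r + 1) * D) c.LS.length hk1 (Nat.mul_pos (by omega) hD) hS
    set A := ((Finset.range G).filter fun v => c.Adm (dig g c.k v)).card with hA
    -- The polynomial cost of a branch is paid for by the scarcity of increasing sequences.
    have h4 : A * c.k ^ 3 ≤ 5 * G := by
      calc A * c.k ^ 3 ≤ A * (5 * c.k.factorial) := by gcongr; exact cube_le_factorial _
        _ = 5 * (A * c.k.factorial) := by ring
        _ ≤ 5 * G := by gcongr; exact c.card_adm_mul_le
    have h5 : searchHeadsTime c = G * (headCheckTime r c.k + 4 + incTime numC numK c.k + 4) +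
        A * searchTime r c.k c.LS.length + 6 := by
      simp only [searchHeadsTime, tryTime, hcr]
      rw [Finset.sum_add_distrib, Finset.sum_add_distrib, Finset.sum_add_distrib,
        ← Finset.sum_filter]
      simp only [Finset.sum_const, Finset.card_range, smul_eq_mul]
      rw [hA]
      ring
    calc searchHeadsTime c ≤ G * (h * D + 4 * D + b * D + 4 * D) +
          A * (C * (R * (c.k ^ 3 * ((r + 1) * D)))) + 6 * (G * D) := by
          rw [h5]; gcongr <;> omega
      _ = (h + 8 + b + 6) * (G * D) + (A * c.k ^ 3) * (C * R * (r + 1) * D) := by ring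
      _ ≤ (h + 8 + b + 6) * (G * R * D) + (5 * G) * (C * R * (r + 1) * D) := by gcongr
      _ = _ := by ring
  calc _ ≤ 13 * (G * R * D) + ((12 + (p + 12) * (r + 2)) * (G * R * D) +
        ((m + 16) * (G * R * D) + (h + 8 + b + 6 + C * 5 * (r + 1)) * (G * R * D))) := by
        gcongr; omega
    _ = _ := by ring

/-! ### Instances -/

/-- The lists of an input word, together with the overlap function. -/
def Instance.ctx {r n : ℕ} (I : Instance r n) (α : Finset (Fin n) → Finset (Fin n) → Bool)
    (LS LC : List (List ℕ)) : Ctx := ⟨r, n, I.k, α, LS, LC⟩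

theorem forall₂_lists {n : ℕ} {L : List (List ℕ)} {S : List (Finset (Fin n))}
    (h : List.Forall₂ Lists L S) :
    S = L.map (toSet n) ∧ ∀ w ∈ L, w.Nodup ∧ ∀ u ∈ w, u < n := by
  induction h with
  | nil => simp
  | cons h1 h2 ih =>
    obtain ⟨h3, h4, rfl⟩ := lists_iff.1 h1
    refine ⟨by simp [ih.1], fun w hw => ?_⟩
    rcases List.mem_cons.1 hw with rfl | hw
    · exact ⟨h3, h4⟩
    · exact ih.2 w hw

theorem card_toSet {n : ℕ} {w : List ℕ} (h1 : w.Nodup) (h2 : ∀ u ∈ w, u < n) :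
    (toSet n w).card = w.length := by
  have h := (lists_iff.2 ⟨h1, h2, rfl⟩ : Lists w (toSet n w)).2
  rw [← List.toFinset_card_of_nodup h1, h, Finset.card_map]

theorem Exec.pos {O : Subroutine} {p : Prog} {σ σ' : State} {t : ℕ} (h : Exec O p σ σ' t) :
    1 ≤ t := by
  induction h <;> omega

/-- Even evaluating `α` on two empty sets takes a step. Hence ordinary steps may also be charged `a
* n ^ c`. -/
theorem WellConditioned.one_le {r n : ℕ} {α : Finset (Fin n) → Finset (Fin n) → Bool} {A : Prog}
    {a c : ℕ} (h : WellConditioned r α A a c) : 1 ≤ a * n ^ c := by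
  obtain ⟨τ, hτ, σ, -, hx⟩ := h.poly_time ∅ ∅ [] [] (by simp) (by simp)
    (by simp [Lists]) (by simp [Lists])
  exact hx.pos.trans hτ

/-- Replacing the unit-cost subroutine by a program. -/
theorem Exec.implemented {r n : ℕ} {α : Finset (Fin n) → Finset (Fin n) → Bool} {A : Prog}
    {a c : ℕ} (h : WellConditioned r α A a c) {p : Prog} {σ σ' : State} {t : ℕ}
    (hx : Exec (unitCost r α) p σ σ' t) :
    ∃ t' ≤ t * (a * n ^ c), Exec (implementedBy A n) p σ σ' t' := by
  have h1 := h.one_le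
  set M := a * n ^ c with hM
  have hle : ∀ x : ℕ, x ≤ x * M := fun x => Nat.le_mul_of_pos_right _ h1
  induction hx with
  | skip σ => exact ⟨1, hle _, .skip σ⟩
  | assign σ x e => exact ⟨_, hle _, .assign σ x e⟩
  | store σ a e f => exact ⟨_, hle _, .store σ a e f⟩
  | seq _ _ ih ih' =>
    obtain ⟨t, ht, hx⟩ := ih
    obtain ⟨t', ht', hx'⟩ := ih'
    exact ⟨t + t', by rw [add_mul]; omega, .seq hx hx'⟩
  | ite_true he _ ih =>
    obtain ⟨t, ht, hx⟩ := ih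
    exact ⟨_, by rw [add_mul]; exact add_le_add (hle _) ht, .ite_true he hx⟩
  | ite_false he _ ih =>
    obtain ⟨t, ht, hx⟩ := ih
    exact ⟨_, by rw [add_mul]; exact add_le_add (hle _) ht, .ite_false he hx⟩
  | loop_done he => exact ⟨_, hle _, .loop_done he⟩
  | loop_step he _ _ ih ih' =>
    obtain ⟨t, ht, hx⟩ := ih
    obtain ⟨t', ht', hx'⟩ := ih'
    exact ⟨_, by rw [add_mul, add_mul]; exact add_le_add (add_le_add (hle _) ht) ht',
      .loop_step he hx hx'⟩
  | query hO =>
    -- The unit-cost subroutine only answers on encodings of sets of size at most `r`, exactly where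
    -- the program is guaranteed to work.
    obtain ⟨s, s', hs, hs', hv, hw, rfl, rfl⟩ := hO
    obtain ⟨τ, hτ, hO'⟩ := h.poly_time s s' _ _ hs hs' hv hw
    exact ⟨_, by rw [add_mul, one_mul]; exact add_le_add (hle _) hτ, .query hO'⟩

section

variable {r n : ℕ} {α : Finset (Fin n) → Finset (Fin n) → Bool} {I : Instance r n}
  {LS LC : List (List ℕ)}

theorem Instance.ctx_valid (hr : 1 ≤ r) {A : Prog} {a c : ℕ} (h : WellConditioned r α A a c)
    (hS : List.Forall₂ Lists LS I.S) (hC : List.Forall₂ Lists LC I.C) :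
    (I.ctx α LS LC).Valid := by
  obtain ⟨h1, h2⟩ := forall₂_lists hS
  obtain ⟨h3, h4⟩ := forall₂_lists hC
  refine ⟨hr, fun w hw => ⟨(h2 w hw).1, (h2 w hw).2, ?_⟩, fun w hw => (h4 w hw).1,
    fun w hw => (h4 w hw).2, fun w hw => ?_, h.hereditary, h.sdiff_nonempty⟩
  · rw [← card_toSet (h2 w hw).1 (h2 w hw).2]
    exact I.card_le _ (by rw [h1]; exact List.mem_map_of_mem hw)
  · rintro rfl
    obtain ⟨x, hx⟩ := I.head_nonempty (toSet n []) (by rw [h3]; exact List.mem_map_of_mem hw)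
    simp at hx

theorem Instance.mem_val (hC : I.C = LC.map (toSet n)) {x : Fin n} :
    x ∈ val I.C ↔ (I.ctx α LS LC).InHead x := by
  simp only [val, Finset.mem_sup, List.mem_toFinset, hC, List.mem_map, id, InHead, Instance.ctx]
  constructor
  · rintro ⟨_, ⟨w, hw, rfl⟩, hx⟩
    exact ⟨w, hw, by simpa using hx⟩
  · rintro ⟨w, hw, hx⟩
    exact ⟨_, ⟨w, hw, rfl⟩, by simpa using hx⟩

/-- A head inside both lists would give a shared head element. Thus different output positions carry
different sets. -/
theorem Ctx.Compat.disjoint {c : Ctx} (hc : c.Valid) {v w : List ℕ} (h : c.Compat v w)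
    {D : List ℕ} (hD : D ∈ c.LC) (hv : D ⊆ v) (hw : D ⊆ w) : False := by
  obtain ⟨u, hu⟩ := List.exists_mem_of_ne_nil _ (hc.ne_nil D hD)
  exact h.1 u (hw hu) (hv hu) ⟨D, hD, hu⟩

/-- The output of the program is a packing. -/
theorem Instance.isPacking_of_out (hc : (I.ctx α LS LC).Valid) (hS : I.S = LS.map (toSet n))
    (hC : I.C = LC.map (toSet n)) {idx : ℕ → ℕ} (h : (I.ctx α LS LC).Out idx) :
    (∀ i < I.k, idx i < I.S.length) ∧
      IsPacking α I ((Finset.range I.k).image fun i => I.S.getD (idx i) ∅) := by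
  have hlt : ∀ i < I.k, idx i < LS.length := fun i hi => (h i hi).1
  have hget : ∀ i < I.k, I.S.getD (idx i) ∅ = toSet n (LS.getD (idx i) []) := fun i hi => by
    have := hlt i hi
    rw [List.getD_eq_getElem _ _ this, List.getD_eq_getElem _ _ (by rw [hS]; simpa using this)]
    simp [hS]
  have hcompat : ∀ i < I.k, ∀ j < I.k, i ≠ j →
      (I.ctx α LS LC).Compat (LS.getD (idx i) []) (LS.getD (idx j) []) :=
    fun i hi j hj hij => (h i hi).2.2 j hj hij
  refine ⟨fun i hi => by rw [hS]; simpa using hlt i hi, ?_, ?_, ?_, ?_, ?_⟩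
  · rw [Finset.card_image_of_injOn, Finset.card_range]
    intro i hi j hj hij
    simp only [Finset.coe_range, Set.mem_Iio] at hi hj
    by_contra hne
    obtain ⟨D, hD, hDs⟩ := (h i hi).2.1
    refine (hcompat i hi j hj hne).disjoint hc hD hDs fun u hu => ?_
    simp only [hget i hi, hget j hj] at hij
    have hun : u < n := hc.lt D hD u hu
    have : (⟨u, hun⟩ : Fin n) ∈ toSet n (LS.getD (idx i) []) := by
      rw [mem_toSet]; exact hDs hu
    rw [hij, mem_toSet] at this
    exact this
  · intro X hX
    obtain ⟨i, hi, rfl⟩ := Finset.mem_image.1 hX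
    have := hlt i (Finset.mem_range.1 hi)
    rw [hget i (Finset.mem_range.1 hi), hS, List.getD_eq_getElem _ _ this]
    exact List.mem_map_of_mem (List.getElem_mem _)
  · intro X hX
    obtain ⟨i, hi, rfl⟩ := Finset.mem_image.1 hX
    have hi := Finset.mem_range.1 hi
    obtain ⟨D, hD, hDs⟩ := (h i hi).2.1
    refine ⟨toSet n D, by rw [hC]; exact List.mem_map_of_mem hD, ?_⟩
    rw [hget i hi]
    exact toSet_mono hDs
  all_goals
    intro X hX Y hY hXY
    obtain ⟨i, hi, rfl⟩ := Finset.mem_image.1 hX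
    obtain ⟨j, hj, rfl⟩ := Finset.mem_image.1 hY
    have hi := Finset.mem_range.1 hi
    have hj := Finset.mem_range.1 hj
    have hij : i ≠ j := by rintro rfl; exact hXY rfl
    have hcij := hcompat i hi j hj hij
    rw [hget i hi, hget j hj]
  · refine Finset.eq_empty_of_forall_notMem fun x hx => ?_
    simp only [Finset.mem_inter, mem_toSet] at hx
    exact hcij.1 x hx.1.2 hx.1.1 ((Instance.mem_val hC).1 hx.2)
  · exact hcij.2.1

/-- A packing has at most `n` members and extends an admissible choice of heads. -/
theorem Instance.exists_solution (hn : 0 < n) (hc : (I.ctx α LS LC).Valid) (hS : I.S = LS.map (toSet n))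
    (hC : I.C = LC.map (toSet n)) {K : Finset (Finset (Fin n))} (hK : IsPacking α I K) :
    I.k ≤ n ∧ ∃ d : ℕ → ℕ, (∀ i < I.k, d i < LC.length) ∧ (I.ctx α LS LC).Adm d ∧
      ∃ κ, (I.ctx α LS LC).Solution ((I.ctx α LS LC).headFam d) κ := by
  classical
  have hlist : ∀ X ∈ K, ∃ w ∈ LS, toSet n w = X := fun X hX => by
    have := hK.mem X hX
    rw [hS] at this
    simpa using this
  have hhead : ∀ X ∈ K, ∃ i, ∃ h : i < LC.length, toSet n LC[i] ⊆ X := fun X hX => by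
    obtain ⟨D, hD, hDX⟩ := hK.head X hX
    rw [hC] at hD
    obtain ⟨w, hw, rfl⟩ := List.mem_map.1 hD
    obtain ⟨i, hi, rfl⟩ := List.getElem_of_mem hw
    exact ⟨i, hi, hDX⟩
  choose! f hf using hhead
  choose! L hL using hlist
  have helt : ∀ X ∈ K, ∃ x : Fin n, x ∈ X ∧ x ∈ val I.C ∧ (x : ℕ) ∈ LC.getD (f X) [] := by
    intro X hX
    obtain ⟨hi, hsub⟩ := hf X hX
    have hmem : LC[f X] ∈ LC := List.getElem_mem _
    obtain ⟨u, hu⟩ := List.exists_mem_of_ne_nil _ (hc.ne_nil _ hmem)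
    have hun : u < n := hc.lt _ hmem u hu
    refine ⟨⟨u, hun⟩, hsub (by rw [mem_toSet]; exact hu), ?_, ?_⟩
    · exact (Instance.mem_val (α := α) (LS := LS) hC).2 ⟨_, hmem, hu⟩
    · rw [List.getD_eq_getElem _ _ hi]; exact hu
  have : Nonempty (Fin n) := ⟨⟨0, hn⟩⟩
  choose! x hx using helt
  -- A head element belongs to at most one member of the packing.
  have hdisj : ∀ X ∈ K, ∀ Y ∈ K, ∀ y : Fin n, y ∈ X → y ∈ Y → y ∈ val I.C → X = Y := by
    intro X hX Y hY y h1 h2 h3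
    by_contra hne
    have := hK.disjoint_heads X hX Y hY hne
    exact Finset.notMem_empty y (this ▸ by simp [h1, h2, h3])
  refine ⟨?_, ?_⟩
  · have : K.card ≤ (Finset.univ : Finset (Fin n)).card :=
      Finset.card_le_card_of_injOn x (fun _ _ => by simp) fun X hX Y hY hxy =>
        hdisj X hX Y hY (x X) (hx X hX).1 (hxy ▸ (hx Y hY).1) (hx X hX).2.1
    rw [Finset.card_univ, Fintype.card_fin] at this
    exact hK.card.trans this
  -- Different members contain different heads, so `k` distinct head indices can be chosen and
  -- sorted into an increasing sequence.
  · have hinj : Set.InjOn f K := fun X hX Y hY hXY => by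
      refine hdisj X hX Y hY (x X) (hx X hX).1 ?_ (hx X hX).2.1
      refine (hf Y hY).2 ?_
      obtain ⟨hi, -⟩ := hf Y hY
      have := (hx X hX).2.2
      rw [hXY, List.getD_eq_getElem _ _ hi] at this
      rw [mem_toSet]; exact this
    obtain ⟨T, hTsub, hTcard⟩ : ∃ T ⊆ K.image f, T.card = I.k :=
      Finset.exists_subset_card_eq (by rw [Finset.card_image_of_injOn hinj]; exact hK.card)
    let d : ℕ → ℕ := fun i => if h : i < I.k then T.orderEmbOfFin hTcard ⟨i, h⟩ else 0
    have hd : ∀ i (h : i < I.k), d i = T.orderEmbOfFin hTcard ⟨i, h⟩ := fun i h => dif_pos h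
    -- `X i` is the member whose chosen head has index `d i`; beyond `k` it is a dummy.
    have hX : ∀ i, ∃ X, i < I.k → X ∈ K ∧ f X = d i := fun i => by
      by_cases h : i < I.k
      · have := hTsub (Finset.orderEmbOfFin_mem T hTcard ⟨i, h⟩)
        obtain ⟨X, hX, hXe⟩ := Finset.mem_image.1 this
        exact ⟨X, fun _ => ⟨hX, by rw [hd i h, hXe]⟩⟩
      · exact ⟨∅, fun h' => absurd h' h⟩
    choose X hX using hX
    have hlt : ∀ i < I.k, d i < LC.length := fun i hi => by
      rw [← (hX i hi).2]; exact (hf _ (hX i hi).1).1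
    have hsub : ∀ i < I.k, LC.getD (d i) [] ⊆ L (X i) := fun i hi u hu => by
      obtain ⟨h1, h2⟩ := hf _ (hX i hi).1
      rw [List.getD_eq_getElem _ _ (hlt i hi)] at hu
      have hun : u < n := hc.lt _ (List.getElem_mem _) u hu
      have h3 : (⟨u, hun⟩ : Fin n) ∈ X i := h2 (by
        rw [mem_toSet]; simpa only [(hX i hi).2] using hu)
      rw [← (hL _ (hX i hi).1).2, mem_toSet] at h3
      exact h3
    refine ⟨d, hlt, ⟨fun i hi => ?_, fun i hi => ?_⟩, fun i => L (X i), fun i hi => ?_, hsub,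
      fun i hi j hj hij => ?_⟩
    · have hmem : LC.getD (d i) [] ∈ LC := by
        rw [List.getD_eq_getElem _ _ (hlt i hi)]; exact List.getElem_mem _
      exact (((hc.nodup _ hmem).subperm (hsub i hi)).length_le).trans
        (hc.ok _ (hL _ (hX i hi).1).1).2.2
    · change i + 1 < I.k at hi
      rw [hd i (by omega), hd (i + 1) hi]
      exact (T.orderEmbOfFin hTcard).strictMono (by simp [Fin.lt_def])
    · exact (hL _ (hX i hi).1).1
    · change i < I.k at hi
      change j < I.k at hj
      have hne : X i ≠ X j := fun he => by
        have h1 : d i = d j := by rw [← (hX i hi).2, ← (hX j hj).2, he]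
        rw [hd i hi, hd j hj] at h1
        have := (T.orderEmbOfFin hTcard).injective h1
        exact hij (by simpa using this)
      have ei := (hL _ (hX i hi).1).2
      have ej := (hL _ (hX j hj).1).2
      refine ⟨fun u hu hu' hh => ?_, ?_, ?_⟩
      · have hun : u < n := (hc.ok _ (hL _ (hX i hi).1).1).2.1 u hu'
        refine hne (hdisj _ (hX i hi).1 _ (hX j hj).1 ⟨u, hun⟩ ?_ ?_ ?_)
        · rw [← ei, mem_toSet]; exact hu'
        · rw [← ej, mem_toSet]; exact hu
        · exact (Instance.mem_val hC).2 hh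
      · change α (toSet n (L (X i))) (toSet n (L (X j))) = false
        rw [ei, ej]; exact hK.no_conflict _ (hX i hi).1 _ (hX j hj).1 hne
      · change α (toSet n (L (X j))) (toSet n (L (X i))) = false
        rw [ei, ej]; exact hK.no_conflict _ (hX j hj).1 _ (hX i hi).1 hne.symm

/-- There are few sets of size at most `r`. -/
theorem Instance.length_S_le (hn : 0 < n) (I : Instance r n) :
    I.S.length ≤ (r + 1) * n ^ r := by
  classical
  rw [← List.toFinset_card_of_nodup I.nodup_S]
  calc I.S.toFinset.card
      ≤ ((Finset.range (r + 1)).biUnion fun i =>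
          (Finset.univ : Finset (Fin n)).powersetCard i).card := by
        refine Finset.card_le_card fun X hX => ?_
        rw [List.mem_toFinset] at hX
        have := I.card_le X hX
        simp only [Finset.mem_biUnion, Finset.mem_range, Finset.mem_powersetCard]
        exact ⟨X.card, by omega, Finset.subset_univ _, rfl⟩
    _ ≤ ∑ i ∈ Finset.range (r + 1), ((Finset.univ : Finset (Fin n)).powersetCard i).card :=
        Finset.card_biUnion_le
    _ ≤ ∑ i ∈ Finset.range (r + 1), n ^ r := by
        refine Finset.sum_le_sum fun i hi => ?_
        rw [Finset.card_powersetCard, Finset.card_univ, Fintype.card_fin]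
        exact (Nat.choose_le_pow n i).trans
          (Nat.pow_le_pow_right hn (by have := Finset.mem_range.1 hi; omega))
    _ = (r + 1) * n ^ r := by simp

end

end PCH

/-! ### Assembly of the theorem -/

theorem mainTheorem4 (r : ℕ) (hr : 1 ≤ r) :
    ∃ (P : PCH.Prog) (B : ℕ),
      ∀ (n : ℕ) (α : Finset (Fin n) → Finset (Fin n) → Bool) (A : PCH.Prog) (a c : ℕ),
        PCH.WellConditioned r α A a c →
        ∀ (g : ℕ → ℕ) (I : PCH.Instance r n), I.C.length = g I.k → 0 < g I.k →
          PCH.SolvesWithin P (PCH.unitCost r α) α I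
              (B * (g I.k ^ I.k * (r * I.k) ^ ((r - 1) * I.k) * n ^ r)) ∧
            PCH.SolvesWithin P (PCH.implementedBy A n) α I
              (B * (g I.k ^ I.k * (r * I.k) ^ ((r - 1) * I.k) * n ^ r) * (a * n ^ c)) := by
  obtain ⟨B, hB⟩ := PCH.exists_solveTime r hr
  refine ⟨PCH.solve r, B, fun n α A a c hα g I hg hpos => ?_⟩
  have key : PCH.SolvesWithin (PCH.solve r) (PCH.unitCost r α) α I
      (B * (g I.k ^ I.k * (r * I.k) ^ ((r - 1) * I.k) * n ^ r)) := by
    rintro w ⟨LS, LC, hS, hC, rfl⟩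
    have hc := PCH.Instance.ctx_valid hr hα hS hC
    have hSmap := (PCH.forall₂_lists hS).1
    have hCmap := (PCH.forall₂_lists hC).1
    have hlen : LC.length = g I.k := by rw [← hg, hCmap, List.length_map]
    have hword : n :: I.k :: I.S.length :: I.C.length :: (PCH.flatten LS ++ PCH.flatten LC) =
        (I.ctx α LS LC).word := by
      rw [PCH.Ctx.word, PCH.flatten_append, hSmap, hCmap, List.length_map, List.length_map]
      rfl
    -- There is a head, and it is non-empty.
    have hn : 0 < n := by
      obtain ⟨D, hD⟩ := List.exists_mem_of_length_pos (hg ▸ hpos)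
      obtain ⟨x, -⟩ := I.head_nonempty D hD
      exact x.pos
    have hLS : LS.length ≤ (r + 1) * n ^ r := by
      have := I.length_S_le hn
      rwa [hSmap, List.length_map] at this
    obtain ⟨σ, t, ht, hx, hq⟩ := PCH.runs_solve hc (hlen ▸ hpos)
    have htime := hB (I.ctx α LS LC) rfl (hlen ▸ hpos) hn hLS
    rw [hword]
    refine ⟨σ, t, (ht.trans htime).trans (le_of_eq ?_), hx, ?_⟩
    · rw [← hlen]; rfl
    · rcases hq with ⟨h0, hout⟩ | ⟨h0, hno⟩
      · exact Or.inl ⟨h0, PCH.Instance.isPacking_of_out hc hSmap hCmap hout⟩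
      · refine Or.inr ⟨h0, fun K hK => ?_⟩
        obtain ⟨hkn, d, hd, hadm, κ, hκ⟩ := PCH.Instance.exists_solution hn hc hSmap hCmap hK
        exact hno hkn d hd hadm κ hκ
  refine ⟨key, fun w hw => ?_⟩
  obtain ⟨σ, t, ht, hx, hout⟩ := key w hw
  obtain ⟨t', ht', hx'⟩ := hx.implemented hα
  exact ⟨σ, t', ht'.trans (Nat.mul_le_mul_right _ ht), hx', hout⟩
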